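/- **Setting.** Fix integers $d\ge 1$, $l\ge 0$ and a function $g:\mathbb R^d\times\mathbb R^l\to\mathbb R$, measurable in its first argument. For each sample size $n$ let $p=p_n>d$ and $q=q_n$ be integers, $\beta_0=\beta_{0,n}\in\mathbb R^{p\times d}$, $\vartheta_0=\vartheta_{0,n}\in\mathbb R^l$, $B=B_n\in\mathbb R^{p\times q}$ with orthonormal columns, $G=G_n:\mathbb R^q\to\mathbb R$ measurable, $r_n\in\mathbb R$, and let $(X,\varepsilon)$ be a random element of $\mathbb R^p\times\mathbb R$ (its law may depend on $n$). The local alternative is $$H_{1n}:\quad Y_n=g(\beta_0^\top X,\vartheta_0)+r_n\,G(B^\top X)+\varepsilon,$$ where $\varepsilon$ is integrable, $E(\varepsilon\mid X)=0$, $E[G(B^\top X)]=0$, $\mathbb P(G(B^\top X)=0)<1$, and either $r_n=1/\sqrt n$ for all $n$ or $\sqrt n\,r_n\to\infty$. Write $Y^0=g(\beta_0^\top X,\vartheta_0)+\varepsilon$ for the response under the null model. **Regularity conditions.** There are constants $c>0$ and $C$, not depending on $n$, such that for every $n$: 1. $E(X)=0$, $\mathrm{Var}(X)=I_p$, $E(X_k^4)\le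 C$ for $1\le k\le p$, and $E[(v^\top X)^4]\le C$ for every unit vector $v\in\mathrm{span}(\beta_0)$; 2. (linearity condition) for every $b\in\mathbb R^p$, $E(b^\top X\mid\beta_0^\top X)$ is almost surely an affine function of $\beta_0^\top X$; 3. $Y^0$ and $X$ are conditionally independent given $\beta_0^\top X$; 4. the $d$-th largest eigenvalue of the null target matrix $M=\int E[X I(Y^0\le t)]\,E[X^\top I(Y^0\le t)]\,dF_{Y^0}(t)$ is at least $c$; 5. almost surely the conditional law of $\varepsilon$ given $X$ has a Lebesgue density bounded by $C$; 6. $E[G(B^\top X)^2]\le C$. **Estimators.** Let $(X_i,\varepsilon_i)$, $1\le i\le n$, be i.i.d. copies of $(X,\varepsilon)$, with responses $Y_i$ generated by $H_{1n}$. Put $\bar X=\frac1n\sum_i X_i$, $\hat\Sigma=\frac1n\sum_i(X_i-\bar X)(X_i-\bar X)^\top$, $Z_i=\hat\Sigma^{-1/2}(X_i-\bar X)$ (with the pseudo-inverse if $\hat\Sigma$ is singular), $\hat\alpha_t=\frac1n\sum_i Z_iI(Y_i\le t)$ and $\hat M_n=\frac1n\sum_j\hat\alpha_{Y_j}\hat\alpha_{Y_j}^\top$,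 with eigenvalues $\hat\lambda_1\ge\dots\ge\hat\lambda_p$. With $c_n=r_n^2\log r_n^{-2}$ the minimum ridge-type eigenvalue ratio (MRER) estimator is $$\hat q=\arg\min_{1\le j\le p-1}\frac{\hat\lambda_{j+1}^2+c_n}{\hat\lambda_j^2+c_n}$$ (the smallest minimizer in case of ties). Let $\hat B(d)$ be any $p\times d$ matrix whose columns are orthonormal eigenvectors of $\hat M_n$ belonging to its $d$ largest eigenvalues. **Theorem 4.2.** Suppose that $p\,r_n\to0$. Then under $H_{1n}$: - $\mathbb P(\hat q=d)\to1$; - if $B_L=B_{L,n}$ is a $p\times d$ matrix with orthonormal columns and $\mathrm{span}(B_L)=\mathrm{span}(\beta_0)$, then $\|\hat B(d)-B_L\|=O_p(\sqrt p\,r_n)$ in the Frobenius norm, up to the orthogonal indeterminacy of the eigenvectors: there are (sample-dependent) orthogonal $d\times d$ matrices $Q_n$ with $\|\hat B(d)\,Q_n-B_L\|=O_p(\sqrt p\,r_n)$. -/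

import Mathlib

open MeasureTheory ProbabilityTheory Filter Topology
open scoped Matrix Matrix.Norms.Frobenius

noncomputable section

/-! ### Spectral notions for real symmetric matrices -/

/-- The `j`-th largest eigenvalue (counted with multiplicity, `1 ≤ j ≤ p`) of a real symmetric
`p × p` matrix; for `j` outside `1, …, p` the value is irrelevant and set to `0`. -/
def eigDesc {p : ℕ} {A : Matrix (Fin p) (Fin p) ℝ} (hA : A.IsHermitian) (j : ℕ) : ℝ :=
  if h : 1 ≤ j ∧ j ≤ p then
    hA.eigenvalues₀ ⟨j - 1, by rw [Fintype.card_fin]; omega⟩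
  else 0

/-- The columns of `V` are orthonormal eigenvectors of `A` which belong, in this order, to the `d`
largest eigenvalues of `A`. -/
def IsLeadingEigenvectors {p d : ℕ} {A : Matrix (Fin p) (Fin p) ℝ} (hA : A.IsHermitian)
    (V : Matrix (Fin p) (Fin d) ℝ) : Prop :=
  Vᵀ * V = 1 ∧ ∀ j : Fin d, A *ᵥ V.col j = eigDesc hA ((j : ℕ) + 1) • V.col j

/-- The column space of a matrix. -/
def colSpan {p d : ℕ} (A : Matrix (Fin p) (Fin d) ℝ) : Submodule ℝ (Fin p → ℝ) :=
  Submodule.span ℝ (Set.range A.col)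

/-! ### The sample matrix of cumulative slicing estimation -/

/-- Sample mean of the covariates. -/
def sampleMean {n p : ℕ} (X : Fin n → Fin p → ℝ) : Fin p → ℝ :=
  (n : ℝ)⁻¹ • ∑ i, X i

/-- Sample covariance matrix of the covariates. -/
def sampleCov {n p : ℕ} (X : Fin n → Fin p → ℝ) : Matrix (Fin p) (Fin p) ℝ :=
  (n : ℝ)⁻¹ • ∑ i, Matrix.vecMulVec (X i - sampleMean X) (X i - sampleMean X)

theorem isHermitian_average {n p : ℕ} (v : Fin n → Fin p → ℝ) :
    ((n : ℝ)⁻¹ • ∑ i, Matrix.vecMulVec (v i) (v i)).IsHermitian := by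
  ext k l
  simp [Matrix.sum_apply, Matrix.vecMulVec_apply, mul_comm]

theorem sampleCov_isHermitian {n p : ℕ} (X : Fin n → Fin p → ℝ) : (sampleCov X).IsHermitian :=
  isHermitian_average _

/-- The standardized covariates: the inverse square root of the sample covariance matrix (obtained
by applying `x ↦ 1 / √x` to its eigenvalues) times the centered observation. -/
def standardized {n p : ℕ} (X : Fin n → Fin p → ℝ) (i : Fin n) : Fin p → ℝ :=
  (sampleCov_isHermitian X).cfc (fun x => (Real.sqrt x)⁻¹) *ᵥ (X i - sampleMean X)

/-- `α̂_t = n⁻¹ ∑ᵢ Zᵢ I(Yᵢ ≤ t)`. -/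
def alphaHat {n p : ℕ} (X : Fin n → Fin p → ℝ) (Y : Fin n → ℝ) (t : ℝ) : Fin p → ℝ :=
  (n : ℝ)⁻¹ • ∑ i, (if Y i ≤ t then (1 : ℝ) else 0) • standardized X i

/-- `M̂ = n⁻¹ ∑ⱼ α̂_{Yⱼ} α̂_{Yⱼ}ᵀ`. -/
def cseMatrix {n p : ℕ} (X : Fin n → Fin p → ℝ) (Y : Fin n → ℝ) : Matrix (Fin p) (Fin p) ℝ :=
  (n : ℝ)⁻¹ • ∑ j, Matrix.vecMulVec (alphaHat X Y (Y j)) (alphaHat X Y (Y j))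

theorem cseMatrix_isHermitian {n p : ℕ} (X : Fin n → Fin p → ℝ) (Y : Fin n → ℝ) :
    (cseMatrix X Y).IsHermitian :=
  isHermitian_average _

/-! ### The minimum ridge-type eigenvalue ratio estimator -/

/-- The ridge-type eigenvalue ratio `(λ_{j+1}² + c) / (λ_j² + c)`. -/
def ridgeRatio {p : ℕ} {A : Matrix (Fin p) (Fin p) ℝ} (hA : A.IsHermitian) (c : ℝ) (j : ℕ) : ℝ :=
  (eigDesc hA (j + 1) ^ 2 + c) / (eigDesc hA j ^ 2 + c)

/-- The estimator: the (smallest) index `1 ≤ j ≤ p - 1` which minimizes the ridge-type ratio. -/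
def mrer {p : ℕ} {A : Matrix (Fin p) (Fin p) ℝ} (hA : A.IsHermitian) (c : ℝ) : ℕ :=
  sInf {j : ℕ | 1 ≤ j ∧ j + 1 ≤ p ∧
    ∀ k : ℕ, 1 ≤ k → k + 1 ≤ p → ridgeRatio hA c j ≤ ridgeRatio hA c k}

/-! ### The population model

The joint law `P` of covariate vector and error is a measure on `(Fin p → ℝ) × ℝ`; a point is
`z = (x, e)`. -/

/-- The null response `g(βᵀx, ϑ) + e`. -/
def nullResponse {d l p : ℕ} (g : (Fin d → ℝ) → (Fin l → ℝ) → ℝ) (β : Matrix (Fin p) (Fin d) ℝ)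
    (ϑ : Fin l → ℝ) (z : (Fin p → ℝ) × ℝ) : ℝ :=
  g (βᵀ *ᵥ z.1) ϑ + z.2

/-- The response `g(βᵀx, ϑ) + r G(Bᵀx) + e` under the local alternative. -/
def localResponse {d l p q : ℕ} (g : (Fin d → ℝ) → (Fin l → ℝ) → ℝ)
    (β : Matrix (Fin p) (Fin d) ℝ) (ϑ : Fin l → ℝ) (B : Matrix (Fin p) (Fin q) ℝ)
    (G : (Fin q → ℝ) → ℝ) (r : ℝ) (z : (Fin p → ℝ) × ℝ) : ℝ :=
  g (βᵀ *ᵥ z.1) ϑ + r * G (Bᵀ *ᵥ z.1) + z.2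

/-- The population vector `α_t = E[X I(Y ≤ t)]`. -/
def alphaPop {p : ℕ} (P : Measure ((Fin p → ℝ) × ℝ)) (Y : (Fin p → ℝ) × ℝ → ℝ) (t : ℝ) :
    Fin p → ℝ :=
  fun k => ∫ z, z.1 k * (if Y z ≤ t then (1 : ℝ) else 0) ∂P

/-- The target matrix `M = ∫ E[X I(Y ≤ t)] E[Xᵀ I(Y ≤ t)] dF_Y(t)`. -/
def targetMatrix {p : ℕ} (P : Measure ((Fin p → ℝ) × ℝ)) (Y : (Fin p → ℝ) × ℝ → ℝ) :
    Matrix (Fin p) (Fin p) ℝ :=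
  Matrix.of fun k m => ∫ t, alphaPop P Y t k * alphaPop P Y t m ∂(P.map Y)

theorem targetMatrix_isHermitian {p : ℕ} (P : Measure ((Fin p → ℝ) × ℝ))
    (Y : (Fin p → ℝ) × ℝ → ℝ) : (targetMatrix P Y).IsHermitian := by
  ext k m
  simp [targetMatrix, mul_comm]

theorem measurable_index {p d : ℕ} (β : Matrix (Fin p) (Fin d) ℝ) :
    Measurable (fun z : (Fin p → ℝ) × ℝ => βᵀ *ᵥ z.1) := by
  have : Continuous (fun z : (Fin p → ℝ) × ℝ => βᵀ *ᵥ z.1) := by fun_prop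
  exact this.measurable

/-- The σ-algebra generated by the index `βᵀX`. -/
abbrev indexSigma {p d : ℕ} (β : Matrix (Fin p) (Fin d) ℝ) : MeasurableSpace ((Fin p → ℝ) × ℝ) :=
  MeasurableSpace.comap (fun z => βᵀ *ᵥ z.1) inferInstance

theorem indexSigma_le {p d : ℕ} (β : Matrix (Fin p) (Fin d) ℝ) :
    indexSigma β ≤ (inferInstance : MeasurableSpace ((Fin p → ℝ) × ℝ)) :=
  (measurable_index β).comap_le

/-- Linearity condition: for every `b`, `E(bᵀX | βᵀX)` is an affine function of `βᵀX`. -/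
def LinearityCondition {p d : ℕ} (P : Measure ((Fin p → ℝ) × ℝ))
    (β : Matrix (Fin p) (Fin d) ℝ) : Prop :=
  ∀ b : Fin p → ℝ, ∃ (a₀ : ℝ) (a : Fin d → ℝ),
    P[fun z => b ⬝ᵥ z.1 | indexSigma β] =ᵐ[P] fun z => a₀ + a ⬝ᵥ (βᵀ *ᵥ z.1)

/-- What the local alternative requires of the error and of the departure `G(BᵀX)`:
`E(ε | X) = 0`, `B` has orthonormal columns, `E G(BᵀX) = 0` and `P(G(BᵀX) = 0) < 1`. -/
structure IsLocalAlternative {p q : ℕ} (P : Measure ((Fin p → ℝ) × ℝ))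
    (B : Matrix (Fin p) (Fin q) ℝ) (G : (Fin q → ℝ) → ℝ) : Prop where
  integrable_error : Integrable (fun z => z.2) P
  error_condExp :
    P[fun z => z.2 | MeasurableSpace.comap (Prod.fst : (Fin p → ℝ) × ℝ → Fin p → ℝ) inferInstance]
      =ᵐ[P] 0
  orthonormal : Bᵀ * B = 1
  measurable_departure : Measurable G
  integrable_departure : Integrable (fun z => G (Bᵀ *ᵥ z.1)) P
  mean_departure : ∫ z, G (Bᵀ *ᵥ z.1) ∂P = 0
  departure_ne_zero : P {z | G (Bᵀ *ᵥ z.1) = 0} < 1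

/-- Regularity conditions at a fixed sample size, with bounds `c`, `C`. Here `Y₀` denotes the null
response `g(βᵀX, ϑ) + ε`. -/
structure RegularityConditions {d l p q : ℕ} (c C : ℝ) (P : Measure ((Fin p → ℝ) × ℝ))
    [IsFiniteMeasure P] (g : (Fin d → ℝ) → (Fin l → ℝ) → ℝ) (β : Matrix (Fin p) (Fin d) ℝ)
    (ϑ : Fin l → ℝ) (B : Matrix (Fin p) (Fin q) ℝ) (G : (Fin q → ℝ) → ℝ) : Prop where
  /-- bounded fourth moments of the components of `X` -/
  integrable_fourth : ∀ k, Integrable (fun z => z.1 k ^ 4) P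
  fourth_moment : ∀ k, ∫ z, z.1 k ^ 4 ∂P ≤ C
  /-- bounded fourth moments of the indices `vᵀX`, `v` a unit vector in `span(β)` -/
  fourth_moment_index : ∀ v ∈ colSpan β, v ⬝ᵥ v = 1 → ∫ z, (v ⬝ᵥ z.1) ^ 4 ∂P ≤ C
  /-- `E X = 0` and `Var X = I` -/
  mean_zero : ∀ k, ∫ z, z.1 k ∂P = 0
  cov_one : ∀ k m, ∫ z, z.1 k * z.1 m ∂P = (1 : Matrix (Fin p) (Fin p) ℝ) k m
  linearity : LinearityCondition P β
  /-- `span(β)` is a dimension reduction subspace of the null model: `Y₀ ⊥ X | βᵀX` -/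
  condIndep : CondIndepFun (indexSigma β) (indexSigma_le β) (nullResponse g β ϑ) Prod.fst P
  /-- the smallest of the `d` leading eigenvalues of the null target matrix is bounded below -/
  eigenvalue_lower : c ≤ eigDesc (targetMatrix_isHermitian P (nullResponse g β ϑ)) d
  /-- the conditional law of `ε` given `X` has a density bounded by `C` -/
  error_density : ∀ᵐ x ∂P.fst, P.condKernel x ≤ ENNReal.ofReal C • (volume : Measure ℝ)
  /-- bounded second moment of the departure `G(BᵀX)` -/
  integrable_departure_sq : Integrable (fun z => G (Bᵀ *ᵥ z.1) ^ 2) P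
  departure_sq : ∫ z, G (Bᵀ *ᵥ z.1) ^ 2 ∂P ≤ C

/-! ### Stochastic boundedness -/

/-- `Wₙ = O_p(aₙ)` (the `Wₙ` may live on different probability spaces; for sets that are not
measurable, `μ n` is the outer measure). -/
def IsBigOInProb {Ω : ℕ → Type*} [∀ n, MeasurableSpace (Ω n)] (μ : ∀ n, Measure (Ω n))
    (W : ∀ n, Ω n → ℝ) (a : ℕ → ℝ) : Prop :=
  ∀ ε : ℝ, 0 < ε → ∃ K : ℝ, ∀ᶠ n in atTop, μ n {ω | K * a n < |W n ω|} ≤ ENNReal.ofReal ε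

end

/-! ### Squared Euclidean norms as dot products -/

/-! Write `ψ t` for the null slicing vector `E[X I(Y⁰ ≤ t)]` and `U` for an orthonormal frame of
`span(β)`. Linearity and conditional independence put every `ψ t` in `span(β)`
(`dot_alphaPop_null_eq_zero`), so the average of `ψ(Yⱼ) ψ(Yⱼ)ᵀ` along the observed responses has
rank at most `d`. The sample matrix is the average of `aⱼ aⱼᵀ` with `aⱼ = α̂_{Yⱼ}`, and one number
controls it: a bound `Δ` for the average of `‖aⱼ - ψ(Yⱼ)‖²`. On vectors orthogonal to `U` its
quadratic form sees only the differences, hence `λ̂_{d+1} ≤ Δ`. A unit eigenvector with eigenvalue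
`λ > 0` lies within squared distance `Δ / λ` of `span(β)`, while `λ̂_d` stays bounded below and
`λ̂_1` above.

`Δ` has a deterministic and a random part. Since the conditional density of `ε` is bounded, shifting
the response by `r G` moves the population slicing vectors by `O(r)`, uniformly in `t`
(`alphaPop_local_sub_null_le`). The random part has mean `O(p / n)`, for two reasons. The whitening
error acts on `ψ` only through `(Σ̂ - 1) U`, which has `p d` entries instead of `p²`
(`alphaHat_error_le`). The slicing error is averaged over the responses, so a second moment
computation replaces a supremum over `t` (`integral_average_sq_le`). The full error of `Σ̂`, of
order `p² / n`, only has to be small enough to keep `Σ̂^{-1/2}` bounded.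

As `1 / n ≤ r²` eventually, `Δ = O_p(p r²)`, and aligning frames by a polar factor
(`exists_orthogonal_alignment`) gives the rate `√p r`. For the ratio estimator, `p r → 0` gives `Δ ≤
K r` with probability tending to one. Then `λ̂_{d+1}² ≤ K² r² ≤ cₙ` because `log r⁻² → ∞`. As also
`cₙ → 0`, the ratio at `d` tends to zero while the others stay away from it
(`mrer_eq_of_eigenvalue_bounds`). -/

theorem dot_self_nonneg {ι : Type*} [Fintype ι] (x : ι → ℝ) : 0 ≤ x ⬝ᵥ x :=
  Finset.sum_nonneg fun i _ => mul_self_nonneg (x i)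

theorem dot_self_pos {ι : Type*} [Fintype ι] {x : ι → ℝ} (hx : x ≠ 0) : 0 < x ⬝ᵥ x :=
  lt_of_le_of_ne (dot_self_nonneg x) fun h => hx (dotProduct_self_eq_zero.1 h.symm)

theorem dot_self_eq_sum_sq {ι : Type*} [Fintype ι] (x : ι → ℝ) : x ⬝ᵥ x = ∑ i, x i ^ 2 := by
  simp [dotProduct, sq]

theorem dot_sq_le {ι : Type*} [Fintype ι] (x y : ι → ℝ) :
    (x ⬝ᵥ y) ^ 2 ≤ (x ⬝ᵥ x) * (y ⬝ᵥ y) := by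
  rw [dot_self_eq_sum_sq, dot_self_eq_sum_sq]
  exact Finset.sum_mul_sq_le_sq_mul_sq _ _ _

theorem add_dot_self_le {ι : Type*} [Fintype ι] (x y : ι → ℝ) :
    (x + y) ⬝ᵥ (x + y) ≤ 2 * (x ⬝ᵥ x) + 2 * (y ⬝ᵥ y) := by
  have := dot_self_nonneg (x - y)
  simp only [add_dotProduct, dotProduct_add, sub_dotProduct, dotProduct_sub] at *
  linarith

theorem sub_dot_self_le {ι : Type*} [Fintype ι] (x y : ι → ℝ) :
    (x - y) ⬝ᵥ (x - y) ≤ 2 * (x ⬝ᵥ x) + 2 * (y ⬝ᵥ y) := by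
  have := dot_self_nonneg (x + y)
  simp only [add_dotProduct, dotProduct_add, sub_dotProduct, dotProduct_sub] at *
  linarith

theorem mulVec_dot_self_le {m ι : Type*} [Fintype m] [Fintype ι] (A : Matrix m ι ℝ) (x : ι → ℝ) :
    (A *ᵥ x) ⬝ᵥ (A *ᵥ x) ≤ (∑ i, ∑ j, A i j ^ 2) * (x ⬝ᵥ x) := by
  rw [dot_self_eq_sum_sq, Finset.sum_mul]
  refine Finset.sum_le_sum fun i _ => ?_
  have := dot_sq_le (A i) x
  rwa [dot_self_eq_sum_sq (A i)] at this

theorem mulVec_dot_mulVec {m ι : Type*} [Fintype m] [Fintype ι] [DecidableEq ι]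
    {U : Matrix m ι ℝ} (hU : Uᵀ * U = 1) (a b : ι → ℝ) : (U *ᵥ a) ⬝ᵥ (U *ᵥ b) = a ⬝ᵥ b := by
  rw [Matrix.dotProduct_mulVec, Matrix.vecMul_mulVec, ← Matrix.dotProduct_mulVec, hU,
    Matrix.one_mulVec]

theorem dot_self_transpose_mulVec_le {m ι : Type*} [Fintype m] [Fintype ι] [DecidableEq ι]
    {U : Matrix m ι ℝ} (hU : Uᵀ * U = 1) (x : m → ℝ) : (Uᵀ *ᵥ x) ⬝ᵥ (Uᵀ *ᵥ x) ≤ x ⬝ᵥ x := by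
  have h := dot_self_nonneg (x - U *ᵥ (Uᵀ *ᵥ x))
  have h1 : x ⬝ᵥ (U *ᵥ (Uᵀ *ᵥ x)) = (Uᵀ *ᵥ x) ⬝ᵥ (Uᵀ *ᵥ x) := by
    rw [Matrix.dotProduct_mulVec, Matrix.mulVec_transpose]
  simp only [sub_dotProduct, dotProduct_sub, mulVec_dot_mulVec hU, h1,
    dotProduct_comm (U *ᵥ (Uᵀ *ᵥ x)) x] at h
  linarith

theorem quadratic_eigenvectors {m ι : Type*} [Fintype m] [Fintype ι] [DecidableEq ι]
    {A : Matrix m m ℝ} {W : Matrix m ι ℝ} (hW : Wᵀ * W = 1) {lam : ι → ℝ}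
    (hAW : ∀ k, A *ᵥ W.col k = lam k • W.col k) (b : ι → ℝ) :
    (W *ᵥ b) ⬝ᵥ (A *ᵥ (W *ᵥ b)) = ∑ k, lam k * b k ^ 2 := by
  have h : A *ᵥ (W *ᵥ b) = W *ᵥ fun k => lam k * b k := by
    have h2 : A * W = W * Matrix.diagonal lam := by
      ext i k
      have := congrFun (hAW k) i
      simp only [Matrix.mul_diagonal]
      simpa [Matrix.mulVec, Matrix.mul_apply, dotProduct, mul_comm] using this
    rw [Matrix.mulVec_mulVec, h2, ← Matrix.mulVec_mulVec]
    congr 1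
    ext k
    simp [Matrix.mulVec_diagonal]
  rw [h, mulVec_dot_mulVec hW]
  simp only [dotProduct]
  exact Finset.sum_congr rfl fun k _ => by ring

/-! ### Ordered eigenvalues and eigenvectors -/

section Eigen

variable {p : ℕ} {A : Matrix (Fin p) (Fin p) ℝ} (hA : A.IsHermitian)
include hA

theorem eigDesc_antitone {i j : ℕ} (hi : 1 ≤ i) (hij : i ≤ j) (hj : j ≤ p) :
    eigDesc hA j ≤ eigDesc hA i := by
  rw [eigDesc, eigDesc, dif_pos ⟨hi.trans hij, hj⟩, dif_pos ⟨hi, hij.trans hj⟩]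
  exact hA.eigenvalues₀_antitone (by simp; omega)

theorem exists_eigDesc_basis : ∃ W : Matrix (Fin p) (Fin p) ℝ, Wᵀ * W = 1 ∧ W * Wᵀ = 1 ∧
    ∀ k : Fin p, A *ᵥ W.col k = eigDesc hA ((k : ℕ) + 1) • W.col k := by
  -- `eigenvalues` is the sorted list `eigenvalues₀` reindexed by an arbitrary enumeration of `Fin
  -- p`. `σ` is that enumeration, so the eigenvector number `σ k` belongs to the `(k + 1)`-th
  -- largest eigenvalue.
  let σ : Fin p → Fin p := fun k =>
    (Fintype.equivOfCardEq (Fintype.card_fin (Fintype.card (Fin p)))) (Fin.cast (by simp) k)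
  have hσ : Function.Injective σ := fun a b h => by simpa [σ] using h
  let U : Matrix (Fin p) (Fin p) ℝ := hA.eigenvectorUnitary
  have hU : Uᵀ * U = 1 := by
    have := Unitary.coe_star_mul_self hA.eigenvectorUnitary
    simpa [Matrix.star_eq_conjTranspose] using this
  have hW : (U.submatrix id σ)ᵀ * U.submatrix id σ = 1 := by
    rw [Matrix.transpose_submatrix, ← Matrix.submatrix_mul _ _ _ id _ Function.bijective_id, hU,
      Matrix.submatrix_one _ hσ]
  refine ⟨U.submatrix id σ, hW, mul_eq_one_comm.1 hW, fun k => ?_⟩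
  have h := hA.mulVec_eigenvectorBasis (σ k)
  have h1 : hA.eigenvalues (σ k) = eigDesc hA ((k : ℕ) + 1) := by
    rw [eigDesc, dif_pos ⟨by omega, by omega⟩, Matrix.IsHermitian.eigenvalues]
    congr 1
    simp only [σ, Equiv.symm_apply_apply]
    rfl
  rw [h1] at h
  exact h

/-- Half of Courant–Fischer: by a dimension count the `d`-dimensional range of `U` contains a
nonzero vector orthogonal to the first `d - 1` eigenvectors, and on such vectors the form is at most
`λ_d` times the squared norm. -/
theorem le_eigDesc_of_quadratic {d : ℕ} (hd : 1 ≤ d) (hdp : d ≤ p)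
    {U : Matrix (Fin p) (Fin d) ℝ} (hU : Uᵀ * U = 1) {κ : ℝ}
    (h : ∀ a, κ * (a ⬝ᵥ a) ≤ (U *ᵥ a) ⬝ᵥ (A *ᵥ (U *ᵥ a))) : κ ≤ eigDesc hA d := by
  obtain ⟨W, hW, hW', hAW⟩ := exists_eigDesc_basis hA
  let L : (Fin d → ℝ) →ₗ[ℝ] (Fin (d - 1) → ℝ) :=
    ((Wᵀ * U).submatrix (Fin.castLE (by omega)) id).mulVecLin
  obtain ⟨a, ha, ha0⟩ := (Submodule.ne_bot_iff _).1
    (LinearMap.ker_ne_bot_of_finrank_lt (f := L) (by simp; omega))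
  have hb (k : Fin p) (hk : (k : ℕ) < d - 1) : (Wᵀ *ᵥ (U *ᵥ a)) k = 0 := by
    have := congrFun (LinearMap.mem_ker.1 ha) ⟨k, hk⟩
    rw [Matrix.mulVec_mulVec]
    simpa [L, Matrix.mulVec, Matrix.submatrix] using this
  have hx : U *ᵥ a = W *ᵥ (Wᵀ *ᵥ (U *ᵥ a)) := by
    rw [Matrix.mulVec_mulVec _ W, hW', Matrix.one_mulVec]
  have h1 := h a
  rw [hx, quadratic_eigenvectors hW hAW] at h1
  have h2 : a ⬝ᵥ a = ∑ k, (Wᵀ *ᵥ (U *ᵥ a)) k ^ 2 := by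
    rw [← dot_self_eq_sum_sq, ← mulVec_dot_mulVec hU a a, ← mulVec_dot_mulVec hW (Wᵀ *ᵥ _), ← hx]
  have h3 : ∑ k : Fin p, eigDesc hA ((k : ℕ) + 1) * (Wᵀ *ᵥ (U *ᵥ a)) k ^ 2 ≤
      eigDesc hA d * (a ⬝ᵥ a) := by
    rw [h2, Finset.mul_sum]
    refine Finset.sum_le_sum fun k _ => ?_
    by_cases hk : (k : ℕ) < d - 1
    · simp [hb k hk]
    · exact mul_le_mul_of_nonneg_right (eigDesc_antitone hA hd (by omega) (by omega)) (sq_nonneg _)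
  exact le_of_mul_le_mul_right (h1.trans h3) (dot_self_pos ha0)

/-- The other half: the span of the first `d + 1` eigenvectors meets the kernel of `Uᵀ`
nontrivially, and on that span the form is at least `λ_{d+1}` times the squared norm. The case `d =
0`, with no constraint, bounds the largest eigenvalue. -/
theorem eigDesc_le_of_quadratic {d : ℕ} (hdp : d < p) (U : Matrix (Fin p) (Fin d) ℝ) {Δ : ℝ}
    (h : ∀ x, Uᵀ *ᵥ x = 0 → x ⬝ᵥ (A *ᵥ x) ≤ Δ * (x ⬝ᵥ x)) : eigDesc hA (d + 1) ≤ Δ := by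
  obtain ⟨W, hW, hW', hAW⟩ := exists_eigDesc_basis hA
  let V : Matrix (Fin p) (Fin (d + 1)) ℝ := W.submatrix id (Fin.castLE hdp)
  let L : (Fin (d + 1) → ℝ) →ₗ[ℝ] (Fin d → ℝ) := (Uᵀ * V).mulVecLin
  obtain ⟨a, ha, ha0⟩ := (Submodule.ne_bot_iff _).1
    (LinearMap.ker_ne_bot_of_finrank_lt (f := L) (by simp))
  have hV : Vᵀ * V = 1 := by
    rw [Matrix.transpose_submatrix, ← Matrix.submatrix_mul _ _ _ id _ Function.bijective_id, hW,
      Matrix.submatrix_one _ (Fin.castLE_injective hdp)]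
  have h0 : Uᵀ *ᵥ (V *ᵥ a) = 0 := by
    rw [Matrix.mulVec_mulVec]; exact LinearMap.mem_ker.1 ha
  have h1 := h _ h0
  have hx : V *ᵥ a = W *ᵥ (Wᵀ *ᵥ (V *ᵥ a)) := by
    rw [Matrix.mulVec_mulVec _ W, hW', Matrix.one_mulVec]
  have hb (k : Fin p) (hk : d < (k : ℕ)) : (Wᵀ *ᵥ (V *ᵥ a)) k = 0 := by
    have h2 : Wᵀ * V = (1 : Matrix (Fin p) (Fin p) ℝ).submatrix id (Fin.castLE hdp) := by
      rw [← hW]; rfl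
    rw [Matrix.mulVec_mulVec, h2]
    simp only [Matrix.mulVec, dotProduct, Matrix.submatrix_apply]
    refine Finset.sum_eq_zero fun j _ => ?_
    rw [Matrix.one_apply_ne, zero_mul]
    intro hj
    have := congrArg Fin.val hj
    simp at this
    omega
  have h2 : (V *ᵥ a) ⬝ᵥ (V *ᵥ a) = ∑ k, (Wᵀ *ᵥ (V *ᵥ a)) k ^ 2 := by
    rw [← dot_self_eq_sum_sq, ← mulVec_dot_mulVec hW (Wᵀ *ᵥ _), ← hx]
  have h3 : eigDesc hA (d + 1) * ((V *ᵥ a) ⬝ᵥ (V *ᵥ a)) ≤ (V *ᵥ a) ⬝ᵥ (A *ᵥ (V *ᵥ a)) := by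
    rw [h2, hx, quadratic_eigenvectors hW hAW, ← hx, Finset.mul_sum]
    refine Finset.sum_le_sum fun k _ => ?_
    by_cases hk : d < (k : ℕ)
    · simp [hb k hk]
    · exact mul_le_mul_of_nonneg_right (eigDesc_antitone hA (by omega) (by omega) (by omega))
        (sq_nonneg _)
  refine le_of_mul_le_mul_right (h3.trans h1) ?_
  rw [mulVec_dot_mulVec hV]
  exact dot_self_pos ha0

theorem eigDesc_nonneg (h : ∀ x, 0 ≤ x ⬝ᵥ (A *ᵥ x)) (j : ℕ) : 0 ≤ eigDesc hA j := by
  by_cases hj : 1 ≤ j ∧ j ≤ p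
  · obtain ⟨W, hW, hW', hAW⟩ := exists_eigDesc_basis hA
    have h1 := h (W.col ⟨j - 1, by omega⟩)
    have h2 : W.col ⟨j - 1, by omega⟩ ⬝ᵥ W.col ⟨j - 1, by omega⟩ = 1 := by
      have := congrFun (congrFun hW ⟨j - 1, by omega⟩) ⟨j - 1, by omega⟩
      simpa [Matrix.mul_apply, dotProduct] using this
    rw [hAW, dotProduct_smul, h2] at h1
    simpa [show j - 1 + 1 = j by omega] using h1
  · simp [eigDesc, hj]

/-! ### Functional calculus of a symmetric matrix -/

theorem cfc_mulVec_dot_self (f : ℝ → ℝ) (x : Fin p → ℝ) :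
    (hA.cfc f *ᵥ x) ⬝ᵥ (hA.cfc f *ᵥ x) =
      ∑ k, f (hA.eigenvalues k) ^ 2 * ((hA.eigenvectorUnitary : Matrix (Fin p) (Fin p) ℝ)ᵀ *ᵥ x) k ^ 2 := by
  have hU : (hA.eigenvectorUnitary : Matrix (Fin p) (Fin p) ℝ)ᵀ * (hA.eigenvectorUnitary : Matrix (Fin p) (Fin p) ℝ) = 1 := by
    have := Unitary.coe_star_mul_self hA.eigenvectorUnitary
    simpa [Matrix.star_eq_conjTranspose] using this
  have h : hA.cfc f = (hA.eigenvectorUnitary : Matrix (Fin p) (Fin p) ℝ) *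
      (Matrix.diagonal (f ∘ hA.eigenvalues) * (hA.eigenvectorUnitary : Matrix (Fin p) (Fin p) ℝ)ᵀ) := by
    rw [Matrix.IsHermitian.cfc, Unitary.conjStarAlgAut_apply, mul_assoc]
    rfl
  rw [h, ← Matrix.mulVec_mulVec, mulVec_dot_mulVec hU, ← Matrix.mulVec_mulVec, dot_self_eq_sum_sq]
  simp [Matrix.mulVec_diagonal, mul_pow]

/-- Both functions of the matrix are diagonal in the same eigenbasis, so a comparison on the
spectrum transfers to each vector. -/
theorem cfc_mulVec_dot_self_le {f h : ℝ → ℝ} {K : ℝ}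
    (hfh : ∀ k, f (hA.eigenvalues k) ^ 2 ≤ K * h (hA.eigenvalues k) ^ 2) (x : Fin p → ℝ) :
    (hA.cfc f *ᵥ x) ⬝ᵥ (hA.cfc f *ᵥ x) ≤ K * ((hA.cfc h *ᵥ x) ⬝ᵥ (hA.cfc h *ᵥ x)) := by
  rw [cfc_mulVec_dot_self, cfc_mulVec_dot_self, Finset.mul_sum]
  refine Finset.sum_le_sum fun k _ => ?_
  rw [← mul_assoc]
  exact mul_le_mul_of_nonneg_right (hfh k) (sq_nonneg _)

theorem isHermitian_cfc_one : hA.cfc (fun _ => (1 : ℝ)) = 1 := by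
  rw [Matrix.IsHermitian.cfc]
  have : (RCLike.ofReal ∘ (fun _ => (1 : ℝ)) ∘ hA.eigenvalues : Fin p → ℝ) = 1 := rfl
  rw [this]
  simp

theorem isHermitian_cfc_sub_one (f : ℝ → ℝ) : hA.cfc (fun x => f x - 1) = hA.cfc f - 1 := by
  rw [← isHermitian_cfc_one hA]
  simp only [Matrix.IsHermitian.cfc]
  rw [← map_sub]
  congr 1
  ext i j
  by_cases h : i = j <;> simp [h]

theorem isHermitian_cfc_id : hA.cfc (fun x => x) = A := by
  rw [Matrix.IsHermitian.cfc]
  exact hA.spectral_theorem.symm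

theorem eigenvalues_sub_one_sq_le (k : Fin p) :
    (hA.eigenvalues k - 1) ^ 2 ≤ ∑ i, ∑ j, (A - 1) i j ^ 2 := by
  let u : Fin p → ℝ := ⇑(hA.eigenvectorBasis k)
  have hu : u ⬝ᵥ u = 1 := by
    have h := hA.eigenvectorBasis.orthonormal.1 k
    have h2 := EuclideanSpace.real_norm_sq_eq (hA.eigenvectorBasis k)
    rw [h] at h2
    rw [dot_self_eq_sum_sq, ← h2]; norm_num
  have h1 : (A - 1) *ᵥ u = (hA.eigenvalues k - 1) • u := by
    rw [Matrix.sub_mulVec, Matrix.one_mulVec, sub_smul, one_smul]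
    congr 1
    exact hA.mulVec_eigenvectorBasis k
  have h2 := mulVec_dot_self_le (A - 1) u
  rw [h1, smul_dotProduct, dotProduct_smul, hu] at h2
  simp only [smul_eq_mul, mul_one] at h2
  nlinarith

theorem quarter_le_eigenvalues (h : ∑ i, ∑ j, (A - 1) i j ^ 2 ≤ 1 / 4) (k : Fin p) :
    1 / 4 ≤ hA.eigenvalues k := by
  have := (eigenvalues_sub_one_sq_le hA k).trans h
  nlinarith

theorem invSqrt_mulVec_dot_self_le (h : ∑ i, ∑ j, (A - 1) i j ^ 2 ≤ 1 / 4) (x : Fin p → ℝ) :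
    (hA.cfc (fun x => (Real.sqrt x)⁻¹) *ᵥ x) ⬝ᵥ (hA.cfc (fun x => (Real.sqrt x)⁻¹) *ᵥ x)
      ≤ 4 * (x ⬝ᵥ x) := by
  have h1 := cfc_mulVec_dot_self_le hA (f := fun x => (Real.sqrt x)⁻¹) (h := fun _ => 1) (K := 4)
    (fun k => ?_) x
  · rwa [isHermitian_cfc_one, Matrix.one_mulVec] at h1
  · have := quarter_le_eigenvalues hA h k
    rw [inv_pow, Real.sq_sqrt (by linarith)]
    rw [inv_le_comm₀ (by linarith) (by norm_num)]
    linarith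

/-- The bound keeps the vector `(A - 1) x` instead of passing to a norm of `A - 1`; this is what
later restricts the covariance error to `span(β)`. On the spectrum, `s = √t ≥ 1/2` gives `|s⁻¹ - 1|
= s⁻¹ |1 - s| ≤ 2 |1 - s| (1 + s) = 2 |t - 1|`. -/
theorem invSqrt_sub_one_mulVec_dot_self_le (h : ∑ i, ∑ j, (A - 1) i j ^ 2 ≤ 1 / 4)
    (x : Fin p → ℝ) :
    ((hA.cfc (fun x => (Real.sqrt x)⁻¹) - 1) *ᵥ x) ⬝ᵥ
      ((hA.cfc (fun x => (Real.sqrt x)⁻¹) - 1) *ᵥ x) ≤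
      4 * (((A - 1) *ᵥ x) ⬝ᵥ ((A - 1) *ᵥ x)) := by
  have h1 := cfc_mulVec_dot_self_le hA (f := fun x => (Real.sqrt x)⁻¹ - 1) (h := fun x => x - 1)
    (K := 4) (fun k => ?_) x
  · rwa [isHermitian_cfc_sub_one, isHermitian_cfc_sub_one hA (fun x => x), isHermitian_cfc_id] at h1
  · have h0 := quarter_le_eigenvalues hA h k
    set t := hA.eigenvalues k
    have hs : 1 / 2 ≤ Real.sqrt t := Real.le_sqrt_of_sq_le (by norm_num; linarith)
    have ht : t = Real.sqrt t ^ 2 := (Real.sq_sqrt (by linarith)).symm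
    set s := Real.sqrt t
    have e : s⁻¹ - 1 = s⁻¹ * (1 - s) := by field_simp
    have hi : s⁻¹ ^ 2 ≤ 4 := by
      rw [inv_pow, inv_le_comm₀ (by positivity) (by norm_num)]; nlinarith
    simp only [e, mul_pow, ht]
    have h3 : (s ^ 2 - 1) ^ 2 = (1 - s) ^ 2 * (1 + s) ^ 2 := by ring
    rw [h3]
    refine mul_le_mul hi ?_ (sq_nonneg _) (by norm_num)
    nlinarith [sq_nonneg (1 - s)]

end Eigen

/-! ### Orthogonal alignment of two orthonormal frames -/

section FunctionalCalculus

variable {p : ℕ} {A : Matrix (Fin p) (Fin p) ℝ} (hA : A.IsHermitian)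
include hA

theorem isHermitian_cfc_mul (f h : ℝ → ℝ) :
    hA.cfc f * hA.cfc h = hA.cfc (fun x => f x * h x) := by
  simp only [Matrix.IsHermitian.cfc]
  rw [← map_mul, Matrix.diagonal_mul_diagonal]
  congr 1

theorem isHermitian_cfc_transpose (f : ℝ → ℝ) : (hA.cfc f)ᵀ = hA.cfc f := by
  have h : star (hA.cfc f) = hA.cfc f := by
    simp only [Matrix.IsHermitian.cfc]
    rw [← map_star, Matrix.star_eq_conjTranspose, Matrix.diagonal_conjTranspose]
    congr 1
  rwa [Matrix.star_eq_conjTranspose, Matrix.conjTranspose_eq_transpose_of_trivial] at h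

theorem isHermitian_cfc_congr {f h : ℝ → ℝ} (hfh : ∀ k, f (hA.eigenvalues k) = h (hA.eigenvalues k)) :
    hA.cfc f = hA.cfc h := by
  have : f ∘ hA.eigenvalues = h ∘ hA.eigenvalues := funext hfh
  simp only [Matrix.IsHermitian.cfc, this]

theorem isHermitian_trace_cfc (f : ℝ → ℝ) : (hA.cfc f).trace = ∑ k, f (hA.eigenvalues k) := by
  simp only [Matrix.IsHermitian.cfc]
  rw [Unitary.conjStarAlgAut_apply, Matrix.trace_mul_comm, ← mul_assoc, Unitary.coe_star_mul_self,
    one_mul, Matrix.trace_diagonal]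
  rfl

end FunctionalCalculus

/-! ### Frobenius norms and the polar factor -/

theorem frobenius_norm_sq {m ι : Type*} [Fintype m] [Fintype ι] (A : Matrix m ι ℝ) :
    ‖A‖ ^ 2 = ∑ i, ∑ j, A i j ^ 2 := by
  have h : 0 ≤ ∑ i, ∑ j, A i j ^ 2 :=
    Finset.sum_nonneg fun _ _ => Finset.sum_nonneg fun _ _ => sq_nonneg _
  rw [Matrix.frobenius_norm_def, ← Real.sqrt_eq_rpow]
  simp only [Real.rpow_ofNat, Real.norm_eq_abs, sq_abs]
  exact Real.sq_sqrt h

theorem frobenius_norm_sq_eq_trace {m ι : Type*} [Fintype m] [Fintype ι] (A : Matrix m ι ℝ) :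
    ‖A‖ ^ 2 = (Aᵀ * A).trace := by
  rw [frobenius_norm_sq, Finset.sum_comm]
  simp [Matrix.trace, Matrix.mul_apply, sq]

/-- With `H = Vᵀ U Uᵀ V`, the residual of `V` off the range of `U` has Gram matrix `1 - H`, so `δ =
tr(1 - H)` and the eigenvalues of `H` are at most one. If `δ < 1`, `H` is invertible and the polar
factor `Q = H^{-1/2} Vᵀ U` is orthogonal. Then `‖V Q - U‖² = 2d - 2 tr H^{1/2} ≤ 2d - 2 tr H = 2δ`,
since `√x ≥ x` on `[0, 1]`. -/
theorem exists_orthogonal_alignment {p d : ℕ} (hd : 1 ≤ d) {U V : Matrix (Fin p) (Fin d) ℝ}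
    (hU : Uᵀ * U = 1) (hV : Vᵀ * V = 1) :
    ∃ Q ∈ Matrix.orthogonalGroup (Fin d) ℝ,
      ‖V * Q - U‖ ^ 2 ≤ 4 * d * ‖V - U * (Uᵀ * V)‖ ^ 2 := by
  set δ := ‖V - U * (Uᵀ * V)‖ ^ 2 with hδ
  have hd' : (1 : ℝ) ≤ d := by exact_mod_cast hd
  have hδ0 : 0 ≤ δ := sq_nonneg _
  set H : Matrix (Fin d) (Fin d) ℝ := (Vᵀ * U) * (Vᵀ * U)ᵀ with hH
  have hHt : (Vᵀ * U)ᵀ = Uᵀ * V := by simp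
  have hHH : H.IsHermitian := by
    have : H.conjTranspose = H := by simp [hH]
    exact this
  have hgram : (V - U * (Uᵀ * V))ᵀ * (V - U * (Uᵀ * V)) = 1 - H := by
    have e1 : (U * (Uᵀ * V))ᵀ * (U * (Uᵀ * V)) = H := by
      rw [Matrix.transpose_mul, Matrix.mul_assoc, ← Matrix.mul_assoc Uᵀ U, hU, Matrix.one_mul, hH, hHt,
        Matrix.transpose_mul, Matrix.transpose_transpose]
    have e2 : (U * (Uᵀ * V))ᵀ * V = H := by
      rw [Matrix.transpose_mul, Matrix.mul_assoc, hH, hHt, Matrix.transpose_mul, Matrix.transpose_transpose]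
    have e3 : Vᵀ * (U * (Uᵀ * V)) = H := by rw [← Matrix.mul_assoc, hH, hHt]
    rw [Matrix.transpose_sub, Matrix.sub_mul, Matrix.mul_sub, Matrix.mul_sub, hV, e1, e2, e3]
    abel
  have hδt : δ = ∑ k, (1 - hHH.eigenvalues k) := by
    rw [hδ, frobenius_norm_sq_eq_trace, hgram, Matrix.trace_sub, Matrix.trace_one,
      hHH.trace_eq_sum_eigenvalues]
    simp
  have hle1 (k : Fin d) : 0 ≤ 1 - hHH.eigenvalues k := by
    let u : Fin d → ℝ := ⇑(hHH.eigenvectorBasis k)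
    have hu : u ⬝ᵥ u = 1 := by
      have h2 := EuclideanSpace.real_norm_sq_eq (hHH.eigenvectorBasis k)
      rw [hHH.eigenvectorBasis.orthonormal.1 k] at h2
      rw [dot_self_eq_sum_sq, ← h2]; norm_num
    have h1 : (1 - H) *ᵥ u = (1 - hHH.eigenvalues k) • u := by
      rw [Matrix.sub_mulVec, Matrix.one_mulVec, sub_smul, one_smul]
      congr 1
      exact hHH.mulVec_eigenvectorBasis k
    have h2 := dot_self_nonneg ((V - U * (Uᵀ * V)) *ᵥ u)
    rw [Matrix.dotProduct_mulVec, Matrix.vecMul_mulVec, ← Matrix.dotProduct_mulVec, hgram, h1,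
      dotProduct_smul, hu] at h2
    simpa using h2
  by_cases hlt : δ < 1
  · have hpos (k : Fin d) : 0 < hHH.eigenvalues k := by
      have : 1 - hHH.eigenvalues k ≤ δ := by
        rw [hδt]
        exact Finset.single_le_sum (f := fun k => 1 - hHH.eigenvalues k) (fun i _ => hle1 i)
          (Finset.mem_univ k)
      linarith
    set S := hHH.cfc fun x => (Real.sqrt x)⁻¹ with hS
    have hSt : Sᵀ = S := isHermitian_cfc_transpose hHH _
    have hSH : S * H = hHH.cfc fun x => (Real.sqrt x)⁻¹ * x := by
      rw [← isHermitian_cfc_mul, isHermitian_cfc_id]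
    have hSHS : S * H * S = 1 := by
      rw [hSH, hS, isHermitian_cfc_mul, ← isHermitian_cfc_one hHH]
      refine isHermitian_cfc_congr hHH fun k => ?_
      have := Real.sqrt_pos.2 (hpos k)
      have h2 := Real.mul_self_sqrt (hpos k).le
      field_simp
      nlinarith
    have hQ : (S * (Vᵀ * U)) * (S * (Vᵀ * U))ᵀ = 1 := by
      rw [Matrix.transpose_mul, hSt, Matrix.mul_assoc, ← Matrix.mul_assoc (Vᵀ * U), ← hH, ← Matrix.mul_assoc, hSHS]
    have hQ' := mul_eq_one_comm.1 hQ
    refine ⟨S * (Vᵀ * U), (Matrix.mem_orthogonalGroup_iff _ _).2 hQ, ?_⟩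
    have htr : (∑ k, hHH.eigenvalues k) ≤ (Uᵀ * (V * (S * (Vᵀ * U)))).trace := by
      have e : (Uᵀ * (V * (S * (Vᵀ * U)))).trace = (S * H).trace := by
        rw [Matrix.trace_mul_comm, Matrix.mul_assoc, Matrix.trace_mul_comm, hH, hHt,
          Matrix.mul_assoc S]
        simp only [Matrix.mul_assoc]
      rw [e, hSH, isHermitian_trace_cfc]
      refine Finset.sum_le_sum fun k _ => ?_
      have h1 := Real.sqrt_pos.2 (hpos k)
      have h2 := Real.mul_self_sqrt (hpos k).le
      have h3 : Real.sqrt (hHH.eigenvalues k) ≤ 1 :=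
        Real.sqrt_le_one.2 (by linarith [hle1 k])
      have h4 : (Real.sqrt (hHH.eigenvalues k))⁻¹ * hHH.eigenvalues k =
          Real.sqrt (hHH.eigenvalues k) := by
        field_simp
        nlinarith
      rw [h4]
      nlinarith
    have hnorm : ‖V * (S * (Vᵀ * U)) - U‖ ^ 2 =
        2 * d - 2 * (Uᵀ * (V * (S * (Vᵀ * U)))).trace := by
      set Q := S * (Vᵀ * U)
      have e1 : ((V * Q)ᵀ * (V * Q)).trace = d := by
        rw [Matrix.transpose_mul, Matrix.mul_assoc, ← Matrix.mul_assoc Vᵀ V, hV, Matrix.one_mul, hQ']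
        simp
      have e2 : ((V * Q)ᵀ * U).trace = (Uᵀ * (V * Q)).trace := by
        rw [← Matrix.trace_transpose, Matrix.transpose_mul, Matrix.transpose_transpose]
      rw [frobenius_norm_sq_eq_trace, Matrix.transpose_sub, Matrix.sub_mul, Matrix.mul_sub, Matrix.mul_sub, hU,
        Matrix.trace_sub, Matrix.trace_sub, Matrix.trace_sub, e1, e2]
      simp
      ring
    have h5 : δ = d - ∑ k, hHH.eigenvalues k := by
      rw [hδt, Finset.sum_sub_distrib]; simp
    rw [hnorm]
    nlinarith
  -- For `δ ≥ 1` no alignment is needed: any two frames satisfy `‖V - U‖² ≤ 4d ≤ 4dδ`. This case is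
  -- the source of the factor `4d`.
  · refine ⟨1, one_mem _, ?_⟩
    have hn (W : Matrix (Fin p) (Fin d) ℝ) (hW : Wᵀ * W = 1) : ‖W‖ ^ 2 = d := by
      rw [frobenius_norm_sq_eq_trace, hW]; simp
    have h1 := hn U hU
    have h2 := hn V hV
    rw [Matrix.mul_one]
    have h3 := norm_sub_le V U
    have h4 : ‖V - U‖ ^ 2 ≤ (‖V‖ + ‖U‖) ^ 2 := pow_le_pow_left₀ (norm_nonneg _) h3 2
    nlinarith [sq_nonneg (‖V‖ - ‖U‖)]

/-! ### The ridge-type eigenvalue ratio -/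

/-- The ratio at `d` is at most `2c / κ²`. Before `d` the numerator is at least `κ²` and the
denominator at most `L² + c`, so `h2` makes the ratio larger. After `d` the ridge dominates: `λ_k² ≤
c` forces a ratio of at least `c / 2c = 1/2`, which `h1` makes larger than `2c / κ²`. -/
theorem mrer_eq_of_eigenvalue_bounds {p d : ℕ} {A : Matrix (Fin p) (Fin p) ℝ} (hA : A.IsHermitian)
    (hd : 1 ≤ d) (hdp : d < p) {c κ L : ℝ} (hc : 0 < c) (hκ : 0 < κ)
    (hnn : ∀ j, 0 ≤ eigDesc hA j) (hlow : κ ≤ eigDesc hA d) (hup : eigDesc hA 1 ≤ L)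
    (hgap : eigDesc hA (d + 1) ^ 2 ≤ c) (h1 : 4 * c < κ ^ 2)
    (h2 : 2 * c * (L ^ 2 + c) < κ ^ 4) : mrer hA c = d := by
  have hratio : ridgeRatio hA c d ≤ 2 * c / κ ^ 2 := by
    rw [ridgeRatio]
    refine div_le_div₀ (by positivity) (by linarith) (by positivity) ?_
    nlinarith
  have hlt (k : ℕ) (hk : 1 ≤ k) (hkp : k + 1 ≤ p) (hkd : k ≠ d) :
      ridgeRatio hA c d < ridgeRatio hA c k := by
    refine hratio.trans_lt ?_
    rw [ridgeRatio]
    rcases lt_or_gt_of_ne hkd with h | h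
    · have e1 : κ ≤ eigDesc hA (k + 1) :=
        hlow.trans (eigDesc_antitone hA (by omega) (by omega) (by omega))
      have e2 : eigDesc hA k ≤ L := (eigDesc_antitone hA le_rfl hk (by omega)).trans hup
      have e3 := hnn k
      have e4 : eigDesc hA k ^ 2 ≤ L ^ 2 := pow_le_pow_left₀ e3 e2 2
      have e5 : κ ^ 2 ≤ eigDesc hA (k + 1) ^ 2 := pow_le_pow_left₀ hκ.le e1 2
      rw [div_lt_div_iff₀ (by positivity) (by positivity)]
      have : 2 * c * (eigDesc hA k ^ 2 + c) ≤ 2 * c * (L ^ 2 + c) := by gcongr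
      nlinarith [mul_le_mul_of_nonneg_right e5 (sq_nonneg κ), mul_pos hc (pow_pos hκ 2)]
    · have e1 : eigDesc hA k ≤ eigDesc hA (d + 1) :=
        eigDesc_antitone hA (by omega) (by omega) (by omega)
      have e2 : eigDesc hA k ^ 2 ≤ eigDesc hA (d + 1) ^ 2 := pow_le_pow_left₀ (hnn k) e1 2
      rw [div_lt_div_iff₀ (by positivity) (by positivity)]
      have e3 := sq_nonneg (eigDesc hA (k + 1))
      have e4 : 2 * c * (eigDesc hA k ^ 2 + c) ≤ 2 * c * (c + c) := by gcongr; linarith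
      nlinarith [mul_lt_mul_of_pos_right h1 hc, mul_nonneg e3 (sq_nonneg κ)]
  have hset : {j : ℕ | 1 ≤ j ∧ j + 1 ≤ p ∧
      ∀ k : ℕ, 1 ≤ k → k + 1 ≤ p → ridgeRatio hA c j ≤ ridgeRatio hA c k} = {d} := by
    ext j
    simp only [Set.mem_ofPred_eq, Set.mem_singleton_iff]
    constructor
    · rintro ⟨hj, hjp, hmin⟩
      by_contra hne
      exact absurd (hmin d hd (by omega)) (not_le.2 (hlt j hj hjp hne))
    · rintro rfl
      refine ⟨hd, by omega, fun k hk hkp => ?_⟩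
      by_cases hkd : k = j
      · rw [hkd]
      · exact (hlt k hk hkp hkd).le
  rw [mrer, hset, csInf_singleton]

/-! ### Perturbation of averages of rank-one matrices -/

section Average

variable {n p d : ℕ} (a ψ : Fin n → Fin p → ℝ)

theorem average_bilin (x y : Fin p → ℝ) :
    x ⬝ᵥ (((n : ℝ)⁻¹ • ∑ i, Matrix.vecMulVec (a i) (a i)) *ᵥ y) =
      (n : ℝ)⁻¹ * ∑ i, (a i ⬝ᵥ x) * (a i ⬝ᵥ y) := by
  rw [Matrix.smul_mulVec, dotProduct_smul, smul_eq_mul, Matrix.sum_mulVec, dotProduct_sum]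
  congr 1
  refine Finset.sum_congr rfl fun i _ => ?_
  rw [Matrix.vecMulVec_mulVec, op_smul_eq_smul, dotProduct_smul, dotProduct_comm x, smul_eq_mul,
    mul_comm]

theorem average_quadratic (x : Fin p → ℝ) :
    x ⬝ᵥ (((n : ℝ)⁻¹ • ∑ i, Matrix.vecMulVec (a i) (a i)) *ᵥ x) =
      (n : ℝ)⁻¹ * ∑ i, (a i ⬝ᵥ x) ^ 2 := by
  rw [average_bilin]; simp only [sq]

theorem average_mono {f h : Fin n → ℝ} (hfh : ∀ i, f i ≤ h i) :
    (n : ℝ)⁻¹ * ∑ i, f i ≤ (n : ℝ)⁻¹ * ∑ i, h i :=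
  mul_le_mul_of_nonneg_left (Finset.sum_le_sum fun i _ => hfh i) (by positivity)

theorem average_sub_dot_sq_le (x : Fin p → ℝ) :
    (n : ℝ)⁻¹ * ∑ i, ((a i - ψ i) ⬝ᵥ x) ^ 2 ≤
      ((n : ℝ)⁻¹ * ∑ i, (a i - ψ i) ⬝ᵥ (a i - ψ i)) * (x ⬝ᵥ x) := by
  rw [mul_assoc, Finset.sum_mul]
  exact average_mono fun i => dot_sq_le _ _

theorem average_eigDesc_nonneg (j : ℕ) : 0 ≤ eigDesc (isHermitian_average a) j :=
  eigDesc_nonneg _ (fun x => by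
    rw [average_quadratic]
    exact mul_nonneg (by positivity) (Finset.sum_nonneg fun _ _ => sq_nonneg _)) j

/-- The `ψ i` vanish on the kernel of `Uᵀ`, so there the quadratic form is that of the differences
`a i - ψ i`. The error enters squared, without the cross terms of a matrix perturbation bound. -/
theorem average_eigDesc_succ_le (hdp : d < p) (U : Matrix (Fin p) (Fin d) ℝ)
    (hψ : ∀ i x, Uᵀ *ᵥ x = 0 → ψ i ⬝ᵥ x = 0) :
    eigDesc (isHermitian_average a) (d + 1) ≤
      (n : ℝ)⁻¹ * ∑ i, (a i - ψ i) ⬝ᵥ (a i - ψ i) := by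
  refine eigDesc_le_of_quadratic _ hdp U fun x hx => ?_
  rw [average_quadratic]
  refine le_trans (le_of_eq ?_) (average_sub_dot_sq_le a ψ x)
  simp only [sub_dotProduct, hψ _ x hx, sub_zero]

theorem average_eigDesc_one_le (hp : 0 < p) (hψ : ∀ i, ψ i ⬝ᵥ ψ i ≤ 1) :
    eigDesc (isHermitian_average a) 1 ≤
      2 + 2 * ((n : ℝ)⁻¹ * ∑ i, (a i - ψ i) ⬝ᵥ (a i - ψ i)) := by
  -- A frame without columns imposes no constraint, so this bounds the largest eigenvalue.
  refine eigDesc_le_of_quadratic (d := 0) _ hp 0 fun x _ => ?_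
  rw [average_quadratic]
  have hx := dot_self_nonneg x
  have h1 : (n : ℝ)⁻¹ * ∑ i, (a i ⬝ᵥ x) ^ 2 ≤
      (n : ℝ)⁻¹ * ∑ i : Fin n, (2 * (x ⬝ᵥ x) + 2 * ((a i - ψ i) ⬝ᵥ x) ^ 2) := by
    refine average_mono fun i => ?_
    have e1 := dot_sq_le (ψ i) x
    have e2 := mul_le_mul_of_nonneg_right (hψ i) hx
    have e3 : a i ⬝ᵥ x = ψ i ⬝ᵥ x + (a i - ψ i) ⬝ᵥ x := by rw [sub_dotProduct]; ring
    rw [e3]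
    nlinarith [sq_nonneg (ψ i ⬝ᵥ x - (a i - ψ i) ⬝ᵥ x)]
  have h2 := average_sub_dot_sq_le a ψ x
  have h3 : (n : ℝ)⁻¹ * n ≤ 1 := inv_mul_le_one
  rw [Finset.sum_add_distrib, ← Finset.mul_sum, ← Finset.mul_sum] at h1
  simp only [Finset.sum_const, Finset.card_univ, Fintype.card_fin, nsmul_eq_mul] at h1
  nlinarith [mul_le_mul_of_nonneg_right h3 hx]

theorem le_average_eigDesc (hd : 1 ≤ d) (hdp : d ≤ p) {U : Matrix (Fin p) (Fin d) ℝ}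
    (hU : Uᵀ * U = 1) {κ : ℝ}
    (hψ : ∀ b : Fin d → ℝ, κ * (b ⬝ᵥ b) ≤ (n : ℝ)⁻¹ * ∑ i, (ψ i ⬝ᵥ (U *ᵥ b)) ^ 2) :
    κ / 2 - (n : ℝ)⁻¹ * ∑ i, (a i - ψ i) ⬝ᵥ (a i - ψ i) ≤ eigDesc (isHermitian_average a) d := by
  refine le_eigDesc_of_quadratic _ hd hdp hU fun b => ?_
  rw [average_quadratic]
  have h1 : (n : ℝ)⁻¹ * ∑ i, (ψ i ⬝ᵥ (U *ᵥ b)) ^ 2 ≤ (n : ℝ)⁻¹ * ∑ i : Fin n,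
      (2 * (a i ⬝ᵥ (U *ᵥ b)) ^ 2 + 2 * ((a i - ψ i) ⬝ᵥ (U *ᵥ b)) ^ 2) := by
    refine average_mono fun i => ?_
    rw [sub_dotProduct]
    nlinarith [sq_nonneg (2 * (a i ⬝ᵥ (U *ᵥ b)) - ψ i ⬝ᵥ (U *ᵥ b))]
  have h2 := average_sub_dot_sq_le a ψ (U *ᵥ b)
  rw [mulVec_dot_mulVec hU] at h2
  rw [Finset.sum_add_distrib, ← Finset.mul_sum, ← Finset.mul_sum] at h1
  have h3 := hψ b
  nlinarith

/-- The residual `z` is orthogonal to every `ψ i`, so `λ ‖z‖² = zᵀ M b` is the average of `((a i - ψ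
i) ⬝ z) (a i ⬝ b)`. By Cauchy–Schwarz its square is at most `Δ ‖z‖²` times the average of `(a i ⬝
b)²`, and the latter is `λ` itself. One factor `λ ‖z‖²` cancels. -/
theorem average_eigenvector_residual_le {U : Matrix (Fin p) (Fin d) ℝ} (hU : Uᵀ * U = 1)
    (hψ : ∀ i x, Uᵀ *ᵥ x = 0 → ψ i ⬝ᵥ x = 0) {b : Fin p → ℝ} (hb : b ⬝ᵥ b = 1) {lam : ℝ}
    (hlam : 0 < lam) (hM : ((n : ℝ)⁻¹ • ∑ i, Matrix.vecMulVec (a i) (a i)) *ᵥ b = lam • b) :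
    lam * ((b - U *ᵥ (Uᵀ *ᵥ b)) ⬝ᵥ (b - U *ᵥ (Uᵀ *ᵥ b))) ≤
      (n : ℝ)⁻¹ * ∑ i, (a i - ψ i) ⬝ᵥ (a i - ψ i) := by
  set z := b - U *ᵥ (Uᵀ *ᵥ b) with hz
  set Δ := (n : ℝ)⁻¹ * ∑ i, (a i - ψ i) ⬝ᵥ (a i - ψ i)
  have hΔ : 0 ≤ Δ := mul_nonneg (by positivity) (Finset.sum_nonneg fun _ _ => dot_self_nonneg _)
  have hUz : Uᵀ *ᵥ z = 0 := by
    rw [hz, Matrix.mulVec_sub, Matrix.mulVec_mulVec _ Uᵀ U, hU, Matrix.one_mulVec, sub_self]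
  have hzz : z ⬝ᵥ z = z ⬝ᵥ b := by
    conv_lhs => rw [hz]
    rw [dotProduct_sub, dotProduct_comm _ (U *ᵥ _), ← hz, dotProduct_comm (U *ᵥ _) z,
      Matrix.dotProduct_mulVec, ← Matrix.mulVec_transpose, hUz, zero_dotProduct, sub_zero]
  have h1 : lam * (z ⬝ᵥ z) = (n : ℝ)⁻¹ * ∑ i, ((a i - ψ i) ⬝ᵥ z) * (a i ⬝ᵥ b) := by
    have := average_bilin a z b
    rw [hM, dotProduct_smul, smul_eq_mul] at this
    rw [hzz, this]
    simp only [sub_dotProduct, hψ _ z hUz, sub_zero]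
  have h2 : lam = (n : ℝ)⁻¹ * ∑ i, (a i ⬝ᵥ b) ^ 2 := by
    have := average_quadratic a b
    rwa [hM, dotProduct_smul, smul_eq_mul, hb, mul_one] at this
  have h3 : (lam * (z ⬝ᵥ z)) ^ 2 ≤ (Δ * (z ⬝ᵥ z)) * lam := by
    rw [h1, mul_pow]
    have e1 := Finset.sum_mul_sq_le_sq_mul_sq Finset.univ (fun i => (a i - ψ i) ⬝ᵥ z)
      fun i => a i ⬝ᵥ b
    have e2 := average_sub_dot_sq_le a ψ z
    calc ((n : ℝ)⁻¹) ^ 2 * (∑ i, ((a i - ψ i) ⬝ᵥ z) * (a i ⬝ᵥ b)) ^ 2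
        ≤ ((n : ℝ)⁻¹) ^ 2 * ((∑ i, ((a i - ψ i) ⬝ᵥ z) ^ 2) * ∑ i, (a i ⬝ᵥ b) ^ 2) := by gcongr
      _ = ((n : ℝ)⁻¹ * ∑ i, ((a i - ψ i) ⬝ᵥ z) ^ 2) * lam := by rw [h2]; ring
      _ ≤ _ := by gcongr
  have hzn := dot_self_nonneg z
  rcases hzn.eq_or_lt with h | h
  · rw [← h]; simpa using hΔ
  · have : lam * (z ⬝ᵥ z) * (lam * (z ⬝ᵥ z)) ≤ Δ * (lam * (z ⬝ᵥ z)) := by nlinarith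
    exact le_of_mul_le_mul_right this (by positivity)

end Average

/-! ### The error of the sample slicing vectors, for a given sample -/

section Sample

variable {n p d : ℕ} (X : Fin n → Fin p → ℝ) (Y : Fin n → ℝ)

/-- Squared Frobenius distance of the uncentered sample second moments from the identity. -/
noncomputable def secondMomentError : ℝ :=
  ∑ k, ∑ m, ((n : ℝ)⁻¹ * ∑ i, (X i k * X i m - (1 : Matrix (Fin p) (Fin p) ℝ) k m)) ^ 2

/-- Squared norm of the sample mean. -/
noncomputable def meanError : ℝ :=
  ∑ k, ((n : ℝ)⁻¹ * ∑ i, X i k) ^ 2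

/-- Squared Frobenius distance of the sample cross moments with the indices `UᵀX` from `U`. -/
noncomputable def crossMomentError (U : Matrix (Fin p) (Fin d) ℝ) : ℝ :=
  ∑ k, ∑ j, ((n : ℝ)⁻¹ * ∑ i, (X i k * (U.col j ⬝ᵥ X i) - U k j)) ^ 2

/-- Average squared distance of the sample slicing vectors from `a`, along the responses. -/
noncomputable def slicingError (a : ℝ → Fin p → ℝ) : ℝ :=
  (n : ℝ)⁻¹ * ∑ j, ∑ k,
    ((n : ℝ)⁻¹ * ∑ i, (X i k * (if Y i ≤ Y j then (1 : ℝ) else 0) - a (Y j) k)) ^ 2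

theorem secondMomentError_nonneg : 0 ≤ secondMomentError X :=
  Finset.sum_nonneg fun _ _ => Finset.sum_nonneg fun _ _ => sq_nonneg _

theorem meanError_nonneg : 0 ≤ meanError X :=
  Finset.sum_nonneg fun _ _ => sq_nonneg _

theorem crossMomentError_nonneg (U : Matrix (Fin p) (Fin d) ℝ) : 0 ≤ crossMomentError X U :=
  Finset.sum_nonneg fun _ _ => Finset.sum_nonneg fun _ _ => sq_nonneg _

theorem slicingError_nonneg (a : ℝ → Fin p → ℝ) : 0 ≤ slicingError X Y a :=
  mul_nonneg (by positivity)
    (Finset.sum_nonneg fun _ _ => Finset.sum_nonneg fun _ _ => sq_nonneg _)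

theorem sampleMean_apply (k : Fin p) : sampleMean X k = (n : ℝ)⁻¹ * ∑ i, X i k := by
  simp [sampleMean, Finset.sum_apply]

theorem sampleMean_dot_self : sampleMean X ⬝ᵥ sampleMean X = meanError X := by
  rw [dot_self_eq_sum_sq]
  simp only [sampleMean_apply, meanError]

theorem average_sub_const (hn : 0 < n) (f : Fin n → ℝ) (c : ℝ) :
    (n : ℝ)⁻¹ * ∑ i, (f i - c) = (n : ℝ)⁻¹ * ∑ i, f i - c := by
  have : (n : ℝ) ≠ 0 := by positivity
  rw [Finset.sum_sub_distrib]
  simp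
  field_simp

theorem sampleCov_apply (hn : 0 < n) (k m : Fin p) :
    sampleCov X k m = (n : ℝ)⁻¹ * ∑ i, X i k * X i m - sampleMean X k * sampleMean X m := by
  have h0 : (n : ℝ) ≠ 0 := by positivity
  simp only [sampleCov, Matrix.smul_apply, Matrix.sum_apply, Matrix.vecMulVec_apply, Pi.sub_apply,
    smul_eq_mul]
  have hs (k : Fin p) : ∑ i, X i k = n * sampleMean X k := by
    rw [sampleMean_apply]; field_simp
  have e : ∑ i, (X i k - sampleMean X k) * (X i m - sampleMean X m) =
      ∑ i, X i k * X i m - (∑ i, X i k) * sampleMean X m - sampleMean X k * (∑ i, X i m) +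
        n * (sampleMean X k * sampleMean X m) := by
    simp only [sub_mul, mul_sub, Finset.sum_sub_distrib, Finset.sum_mul, Finset.mul_sum]
    simp
    ring
  rw [e, hs, hs]
  field_simp
  ring

theorem sampleCov_sub_one_sq_sum_le (hn : 0 < n) :
    ∑ k, ∑ m, (sampleCov X - 1) k m ^ 2 ≤ 2 * secondMomentError X + 2 * meanError X ^ 2 := by
  have e : 2 * secondMomentError X + 2 * meanError X ^ 2 = ∑ k, ∑ m,
      (2 * ((n : ℝ)⁻¹ * ∑ i, (X i k * X i m - (1 : Matrix (Fin p) (Fin p) ℝ) k m)) ^ 2 +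
        2 * (sampleMean X k * sampleMean X m) ^ 2) := by
    simp only [Finset.sum_add_distrib, ← Finset.mul_sum, secondMomentError, mul_pow,
      ← Finset.sum_mul]
    rw [sq (meanError X)]
    simp only [sampleMean_apply, meanError]
  rw [e]
  refine Finset.sum_le_sum fun k _ => Finset.sum_le_sum fun m _ => ?_
  rw [average_sub_const hn, Matrix.sub_apply, sampleCov_apply X hn]
  set x := (n : ℝ)⁻¹ * ∑ i, X i k * X i m
  set y := sampleMean X k * sampleMean X m
  nlinarith [sq_nonneg (x - (1 : Matrix (Fin p) (Fin p) ℝ) k m + y)]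

/-- Only `p d` entries are involved, which yields `p / n` in mean where the full covariance error
yields `p² / n`. -/
theorem sampleCov_sub_one_mul_sq_sum_le (hn : 0 < n) {U : Matrix (Fin p) (Fin d) ℝ}
    (hU : Uᵀ * U = 1) :
    ∑ k, ∑ j, ((sampleCov X - 1) * U : Matrix (Fin p) (Fin d) ℝ) k j ^ 2 ≤
      2 * crossMomentError X U + 2 * meanError X ^ 2 := by
  have hb := dot_self_transpose_mulVec_le hU (sampleMean X)
  rw [sampleMean_dot_self, dot_self_eq_sum_sq] at hb
  have hcol (j : Fin d) (x : Fin p → ℝ) : U.col j ⬝ᵥ x = (Uᵀ *ᵥ x) j := rfl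
  have hle : ∑ k, ∑ j, (2 * ((n : ℝ)⁻¹ * ∑ i, (X i k * (U.col j ⬝ᵥ X i) - U k j)) ^ 2 +
        2 * (sampleMean X k * (Uᵀ *ᵥ sampleMean X) j) ^ 2) ≤
      2 * crossMomentError X U + 2 * meanError X ^ 2 := by
    simp only [Finset.sum_add_distrib, ← Finset.mul_sum, crossMomentError, mul_pow,
      ← Finset.sum_mul]
    rw [← dot_self_eq_sum_sq, sampleMean_dot_self, sq (meanError X)]
    have := mul_le_mul_of_nonneg_left hb (meanError_nonneg X)
    linarith
  refine le_trans (Finset.sum_le_sum fun k _ => Finset.sum_le_sum fun j _ => ?_) hle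
  have e : ((sampleCov X - 1) * U : Matrix (Fin p) (Fin d) ℝ) k j = ((n : ℝ)⁻¹ * ∑ i, X i k * (U.col j ⬝ᵥ X i)) -
      sampleMean X k * (Uᵀ *ᵥ sampleMean X) j - U k j := by
    rw [Matrix.sub_mul, Matrix.one_mul, Matrix.sub_apply, Matrix.mul_apply]
    congr 1
    simp only [sampleCov_apply X hn, sub_mul, Finset.sum_sub_distrib, Matrix.mulVec, dotProduct,
      Finset.mul_sum, Finset.sum_mul, Matrix.transpose_apply, Matrix.col]
    rw [Finset.sum_comm]
    congr 1
    · exact Finset.sum_congr rfl fun i _ => Finset.sum_congr rfl fun m _ => by ring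
    · exact Finset.sum_congr rfl fun m _ => by ring
  rw [e, average_sub_const hn]
  set x := (n : ℝ)⁻¹ * ∑ i, X i k * (U.col j ⬝ᵥ X i)
  set y := sampleMean X k * (Uᵀ *ᵥ sampleMean X) j
  nlinarith [sq_nonneg (x - U k j + y)]

theorem alphaHat_eq_mulVec (t : ℝ) :
    alphaHat X Y t = (sampleCov_isHermitian X).cfc (fun x => (Real.sqrt x)⁻¹) *ᵥ
      ((n : ℝ)⁻¹ • ∑ i, (if Y i ≤ t then (1 : ℝ) else 0) • (X i - sampleMean X)) := by
  rw [Matrix.mulVec_smul, alphaHat]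
  congr 1
  rw [Matrix.mulVec_sum]
  exact Finset.sum_congr rfl fun i _ => by rw [standardized, Matrix.mulVec_smul]

theorem sliceMean_sub_dot_self_le (hn : 0 < n) (t : ℝ) (a : Fin p → ℝ) :
    ((n : ℝ)⁻¹ • ∑ i, (if Y i ≤ t then (1 : ℝ) else 0) • (X i - sampleMean X) - a) ⬝ᵥ
      ((n : ℝ)⁻¹ • ∑ i, (if Y i ≤ t then (1 : ℝ) else 0) • (X i - sampleMean X) - a) ≤
      2 * ∑ k, ((n : ℝ)⁻¹ * ∑ i, (X i k * (if Y i ≤ t then (1 : ℝ) else 0) - a k)) ^ 2 +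
        2 * meanError X := by
  set F : ℝ := (n : ℝ)⁻¹ * ∑ i, (if Y i ≤ t then (1 : ℝ) else 0) with hF
  have hF0 : 0 ≤ F := mul_nonneg (by positivity) (Finset.sum_nonneg fun i _ => by split_ifs <;> simp)
  have hF1 : F ≤ 1 := by
    have : F ≤ (n : ℝ)⁻¹ * ∑ i : Fin n, 1 := average_mono fun i => by split_ifs <;> simp
    refine this.trans ?_
    simp [inv_mul_le_one]
  set v : Fin p → ℝ := fun k =>
    (n : ℝ)⁻¹ * ∑ i, (X i k * (if Y i ≤ t then (1 : ℝ) else 0) - a k) with hv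
  have e : (n : ℝ)⁻¹ • ∑ i, (if Y i ≤ t then (1 : ℝ) else 0) • (X i - sampleMean X) - a =
      v - F • sampleMean X := by
    ext k
    have hvk : v k = (n : ℝ)⁻¹ * ∑ i, X i k * (if Y i ≤ t then (1 : ℝ) else 0) - a k :=
      average_sub_const hn _ _
    simp only [Pi.sub_apply, hvk, Pi.smul_apply, Finset.sum_apply, smul_eq_mul,
      mul_sub, Finset.sum_sub_distrib, ← Finset.sum_mul, hF]
    have : ∑ i, (if Y i ≤ t then (1 : ℝ) else 0) * X i k =
        ∑ i, X i k * (if Y i ≤ t then (1 : ℝ) else 0) :=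
      Finset.sum_congr rfl fun i _ => mul_comm _ _
    rw [this]
    ring
  rw [e]
  refine (sub_dot_self_le _ _).trans ?_
  rw [dot_self_eq_sum_sq v, smul_dotProduct, dotProduct_smul, sampleMean_dot_self]
  have := mul_le_mul_of_nonneg_right (mul_le_one₀ hF1 hF0 hF1) (meanError_nonneg X)
  simp only [smul_eq_mul]
  nlinarith

/-- Split `α̂ - ψ = Σ̂^{-1/2} (α - ψ) + (Σ̂^{-1/2} - 1) ψ`, where `α` is the centered slice mean
before whitening. The first term needs only a bounded `Σ̂^{-1/2}`. Since `ψ = U Uᵀ ψ`, the second is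
controlled by `(Σ̂ - 1) U`. -/
theorem alphaHat_error_le (hn : 0 < n) {U : Matrix (Fin p) (Fin d) ℝ} (hU : Uᵀ * U = 1)
    {a ψ : ℝ → Fin p → ℝ} {b : ℝ} (hψU : ∀ t, U *ᵥ (Uᵀ *ᵥ ψ t) = ψ t) (hψ1 : ∀ t, ψ t ⬝ᵥ ψ t ≤ 1)
    (hab : ∀ t, (a t - ψ t) ⬝ᵥ (a t - ψ t) ≤ b) (h1 : secondMomentError X ≤ 1 / 16)
    (h2 : meanError X ≤ 1 / 4) :
    (n : ℝ)⁻¹ * ∑ j, (alphaHat X Y (Y j) - ψ (Y j)) ⬝ᵥ (alphaHat X Y (Y j) - ψ (Y j)) ≤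
      40 * (meanError X + crossMomentError X U + slicingError X Y a) + 16 * b := by
  have hm := meanError_nonneg X
  -- The two thresholds are chosen so that `2 · 1/16 + 2 · (1/4)² = 1/4`.
  have hcov : ∑ k, ∑ m, (sampleCov X - 1) k m ^ 2 ≤ 1 / 4 := by
    refine (sampleCov_sub_one_sq_sum_le X hn).trans ?_
    nlinarith
  set hA := sampleCov_isHermitian X
  -- Constants: `‖α̂ - ψ‖² ≤ 8 ‖α - ψ‖² + 8 ‖(Σ̂ - 1) ψ‖²`. Passing through `a` and separating the
  -- sample mean gives `‖α - ψ‖² ≤ 4 (slicing term) + 4 meanError + 2 b`. Together with `e3` the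
  -- mean error collects `32 + 8 = 40`.
  have hpt (j : Fin n) :
      (alphaHat X Y (Y j) - ψ (Y j)) ⬝ᵥ (alphaHat X Y (Y j) - ψ (Y j)) ≤
      32 * (∑ k, ((n : ℝ)⁻¹ * ∑ i,
        (X i k * (if Y i ≤ Y j then (1 : ℝ) else 0) - a (Y j) k)) ^ 2) +
        (40 * (meanError X + crossMomentError X U) + 16 * b) := by
    set α : Fin p → ℝ :=
      (n : ℝ)⁻¹ • ∑ i, (if Y i ≤ Y j then (1 : ℝ) else 0) • (X i - sampleMean X) with hα
    have e : alphaHat X Y (Y j) - ψ (Y j) =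
        hA.cfc (fun x => (Real.sqrt x)⁻¹) *ᵥ (α - ψ (Y j)) +
          (hA.cfc (fun x => (Real.sqrt x)⁻¹) - 1) *ᵥ ψ (Y j) := by
      rw [alphaHat_eq_mulVec, Matrix.mulVec_sub, Matrix.sub_mulVec, Matrix.one_mulVec]
      abel
    have e1 := invSqrt_mulVec_dot_self_le hA hcov (α - ψ (Y j))
    have e2 := invSqrt_sub_one_mulVec_dot_self_le hA hcov (ψ (Y j))
    have e3 : ((sampleCov X - 1) *ᵥ ψ (Y j)) ⬝ᵥ ((sampleCov X - 1) *ᵥ ψ (Y j)) ≤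
        2 * crossMomentError X U + meanError X := by
      rw [← hψU (Y j), Matrix.mulVec_mulVec]
      refine (mulVec_dot_self_le _ _).trans ?_
      have f1 := sampleCov_sub_one_mul_sq_sum_le X hn hU
      have f2 := (dot_self_transpose_mulVec_le hU (ψ (Y j))).trans (hψ1 _)
      have f3 : 0 ≤ ∑ k, ∑ j, ((sampleCov X - 1) * U : Matrix (Fin p) (Fin d) ℝ) k j ^ 2 :=
        Finset.sum_nonneg fun _ _ => Finset.sum_nonneg fun _ _ => sq_nonneg _
      have := mul_le_mul_of_nonneg_left f2 f3
      nlinarith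
    have e4 := sliceMean_sub_dot_self_le X Y hn (Y j) (a (Y j))
    rw [← hα] at e4
    have e5 : α - ψ (Y j) = (α - a (Y j)) + (a (Y j) - ψ (Y j)) := by abel
    have e6 := add_dot_self_le (α - a (Y j)) (a (Y j) - ψ (Y j))
    rw [← e5] at e6
    have e7 := add_dot_self_le (hA.cfc (fun x => (Real.sqrt x)⁻¹) *ᵥ (α - ψ (Y j)))
      ((hA.cfc (fun x => (Real.sqrt x)⁻¹) - 1) *ᵥ ψ (Y j))
    rw [← e] at e7
    have e8 := hab (Y j)
    have e9 := crossMomentError_nonneg X U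
    linarith
  refine (average_mono hpt).trans ?_
  rw [Finset.sum_add_distrib, ← Finset.mul_sum, mul_add]
  have hs : (n : ℝ)⁻¹ * (32 * ∑ j, ∑ k, ((n : ℝ)⁻¹ * ∑ i,
        (X i k * (if Y i ≤ Y j then (1 : ℝ) else 0) - a (Y j) k)) ^ 2) =
      32 * slicingError X Y a := by rw [slicingError]; ring
  have h0 : (n : ℝ) ≠ 0 := by positivity
  rw [hs]
  simp only [Finset.sum_const, Finset.card_univ, Fintype.card_fin, nsmul_eq_mul]
  rw [inv_mul_cancel_left₀ h0]
  linarith [slicingError_nonneg X Y a]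

end Sample

/-! ### Effect of a shift on a response with bounded conditional error density -/

/-- Disintegrate `P` over its first coordinate. Given `x`, the two indicators differ only for `e`
between `s₁ x` and `s₂ x`, an interval of conditional mass at most `C |s₁ x - s₂ x|`. -/
theorem abs_integral_indicator_sub_le {α : Type*} [MeasurableSpace α] (P : Measure (α × ℝ))
    [IsFiniteMeasure P] {C : ℝ} (hC : 0 ≤ C)
    (hdens : ∀ᵐ x ∂P.fst, P.condKernel x ≤ ENNReal.ofReal C • (volume : Measure ℝ))
    {w s₁ s₂ : α → ℝ} (hw : Measurable w) (h₁ : Measurable s₁) (h₂ : Measurable s₂)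
    (hint : Integrable (fun z : α × ℝ => |w z.1| * |s₁ z.1 - s₂ z.1|) P) :
    |∫ z, w z.1 * ((if z.2 ≤ s₁ z.1 then (1 : ℝ) else 0) - (if z.2 ≤ s₂ z.1 then (1 : ℝ) else 0)) ∂P|
      ≤ C * ∫ z, |w z.1| * |s₁ z.1 - s₂ z.1| ∂P := by
  have hm (s : α → ℝ) (hs : Measurable s) :
      Measurable fun z : α × ℝ => if z.2 ≤ s z.1 then (1 : ℝ) else 0 :=
    Measurable.ite (measurableSet_le measurable_snd (hs.comp measurable_fst)) measurable_const
      measurable_const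
  set f : α × ℝ → ℝ := fun z =>
    w z.1 * ((if z.2 ≤ s₁ z.1 then (1 : ℝ) else 0) - (if z.2 ≤ s₂ z.1 then (1 : ℝ) else 0)) with hf
  have hfm : Measurable f := (hw.comp measurable_fst).mul ((hm s₁ h₁).sub (hm s₂ h₂))
  have hgm : Measurable fun z : α × ℝ => |w z.1| * |s₁ z.1 - s₂ z.1| := by fun_prop
  have hle : ∫⁻ z, ENNReal.ofReal ‖f z‖ ∂P ≤
      ENNReal.ofReal (C * ∫ z, |w z.1| * |s₁ z.1 - s₂ z.1| ∂P) := by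
    have hR : ENNReal.ofReal (C * ∫ z, |w z.1| * |s₁ z.1 - s₂ z.1| ∂P) =
        ∫⁻ x, ENNReal.ofReal C * ENNReal.ofReal (|w x| * |s₁ x - s₂ x|) ∂P.fst := by
      rw [ENNReal.ofReal_mul hC, ofReal_integral_eq_lintegral_ofReal hint
        (ae_of_all _ fun z => by positivity), Measure.fst, lintegral_map (by fun_prop) measurable_fst,
        lintegral_const_mul _ (by fun_prop)]
    rw [hR, ← Measure.lintegral_condKernel (by fun_prop)]
    refine lintegral_mono_ae ?_
    filter_upwards [hdens] with x hx
    have hpt (e : ℝ) : ENNReal.ofReal ‖f (x, e)‖ ≤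
        ENNReal.ofReal |w x| * (Set.uIoc (s₁ x) (s₂ x)).indicator 1 e := by
      simp only [hf, norm_mul, Real.norm_eq_abs]
      rw [ENNReal.ofReal_mul (abs_nonneg _)]
      gcongr
      by_cases he : e ∈ Set.uIoc (s₁ x) (s₂ x)
      · rw [Set.indicator_of_mem he]
        refine ENNReal.ofReal_le_one.2 ?_
        split_ifs <;> simp
      · rw [Set.indicator_of_notMem he]
        rw [Set.mem_uIoc, not_or, not_and, not_and] at he
        have : e ≤ s₁ x ↔ e ≤ s₂ x := by
          constructor
          · intro h; by_contra h'; exact he.2 (not_le.1 h') h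
          · intro h; by_contra h'; exact he.1 (not_le.1 h') h
        simp [this]
    calc ∫⁻ e, ENNReal.ofReal ‖f (x, e)‖ ∂P.condKernel x
        ≤ ∫⁻ e, ENNReal.ofReal |w x| * (Set.uIoc (s₁ x) (s₂ x)).indicator 1 e ∂P.condKernel x :=
          lintegral_mono hpt
      _ = ENNReal.ofReal |w x| * P.condKernel x (Set.uIoc (s₁ x) (s₂ x)) := by
          rw [lintegral_const_mul _ (measurable_one.indicator measurableSet_uIoc),
            lintegral_indicator_one measurableSet_uIoc]
      _ ≤ ENNReal.ofReal |w x| * (ENNReal.ofReal C * ENNReal.ofReal |s₂ x - s₁ x|) := by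
          gcongr
          refine (hx _).trans ?_
          rw [Measure.smul_apply, smul_eq_mul, Real.volume_uIoc]
      _ = ENNReal.ofReal C * ENNReal.ofReal (|w x| * |s₁ x - s₂ x|) := by
          rw [ENNReal.ofReal_mul (abs_nonneg _), abs_sub_comm]; ring
  have h0 := norm_integral_le_lintegral_norm (μ := P) f
  rw [Real.norm_eq_abs] at h0
  refine h0.trans ?_
  refine (ENNReal.toReal_mono ENNReal.ofReal_ne_top hle).trans ?_
  rw [ENNReal.toReal_ofReal]
  exact mul_nonneg hC (integral_nonneg fun z => by positivity)

/-! ### Moments of the covariates -/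

section Moments

variable {d l p q : ℕ} {c C : ℝ} {P : Measure ((Fin p → ℝ) × ℝ)} [IsProbabilityMeasure P]
  {g : (Fin d → ℝ) → (Fin l → ℝ) → ℝ} {β : Matrix (Fin p) (Fin d) ℝ} {ϑ : Fin l → ℝ}
  {B : Matrix (Fin p) (Fin q) ℝ} {G : (Fin q → ℝ) → ℝ}

theorem measurable_dot_fst (v : Fin p → ℝ) :
    Measurable fun z : (Fin p → ℝ) × ℝ => v ⬝ᵥ z.1 := by
  have : Continuous fun z : (Fin p → ℝ) × ℝ => v ⬝ᵥ z.1 := by fun_prop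
  exact this.measurable

namespace RegularityConditions

variable (hreg : RegularityConditions c C P g β ϑ B G)
include hreg

theorem memLp_apply (k : Fin p) : MemLp (fun z : (Fin p → ℝ) × ℝ => z.1 k) 4 P := by
  have hm : Measurable fun z : (Fin p → ℝ) × ℝ => z.1 k := by fun_prop
  rw [← integrable_norm_rpow_iff hm.aestronglyMeasurable (by norm_num) (by norm_num)]
  refine (hreg.integrable_fourth k).congr (ae_of_all _ fun z => ?_)
  have : ((4 : ENNReal).toReal) = ((4 : ℕ) : ℝ) := by norm_num
  simp only [this, Real.rpow_natCast, Real.norm_eq_abs]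
  exact (Even.pow_abs (by decide) _).symm

theorem memLp_dot (v : Fin p → ℝ) : MemLp (fun z : (Fin p → ℝ) × ℝ => v ⬝ᵥ z.1) 4 P := by
  simp only [dotProduct]
  exact memLp_finsetSum _ fun k _ => (hreg.memLp_apply k).const_mul (v k)

theorem memLp_two_dot (v : Fin p → ℝ) : MemLp (fun z : (Fin p → ℝ) × ℝ => v ⬝ᵥ z.1) 2 P :=
  (hreg.memLp_dot v).mono_exponent (by norm_num)

theorem integrable_dot (v : Fin p → ℝ) : Integrable (fun z : (Fin p → ℝ) × ℝ => v ⬝ᵥ z.1) P :=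
  (hreg.memLp_two_dot v).integrable (by norm_num)

theorem integrable_dot_sq (v : Fin p → ℝ) :
    Integrable (fun z : (Fin p → ℝ) × ℝ => (v ⬝ᵥ z.1) ^ 2) P :=
  (hreg.memLp_two_dot v).integrable_sq

theorem integrable_dot_fourth (v : Fin p → ℝ) :
    Integrable (fun z : (Fin p → ℝ) × ℝ => (v ⬝ᵥ z.1) ^ 4) P := by
  refine (hreg.memLp_dot v).integrable_norm_pow (by norm_num) |>.congr (ae_of_all _ fun z => ?_)
  simp only [Real.norm_eq_abs]
  exact Even.pow_abs (by decide) _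

theorem integrable_dot_mul_dot (v w : Fin p → ℝ) :
    Integrable (fun z : (Fin p → ℝ) × ℝ => (v ⬝ᵥ z.1) * (w ⬝ᵥ z.1)) P :=
  (hreg.memLp_two_dot v).integrable_mul (hreg.memLp_two_dot w)

theorem integral_dot (v : Fin p → ℝ) : ∫ z, v ⬝ᵥ z.1 ∂P = 0 := by
  simp only [dotProduct]
  rw [integral_finsetSum _ fun k _ =>
    ((hreg.memLp_apply k).integrable (by norm_num)).const_mul (v k)]
  simp [integral_const_mul, hreg.mean_zero]

theorem integral_dot_mul_dot (v w : Fin p → ℝ) :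
    ∫ z, (v ⬝ᵥ z.1) * (w ⬝ᵥ z.1) ∂P = v ⬝ᵥ w := by
  have hi (k m : Fin p) : Integrable (fun z : (Fin p → ℝ) × ℝ => z.1 k * z.1 m) P := by
    have h (k : Fin p) : MemLp (fun z : (Fin p → ℝ) × ℝ => z.1 k) 2 P :=
      (hreg.memLp_apply k).mono_exponent (by norm_num)
    exact (h k).integrable_mul (h m)
  have e : (fun z : (Fin p → ℝ) × ℝ => (v ⬝ᵥ z.1) * (w ⬝ᵥ z.1)) =
      fun z => ∑ k, ∑ m, v k * w m * (z.1 k * z.1 m) := by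
    ext z
    simp only [dotProduct, Finset.sum_mul_sum]
    exact Finset.sum_congr rfl fun k _ => Finset.sum_congr rfl fun m _ => by ring
  rw [e, integral_finsetSum _ fun k _ => integrable_finsetSum _ fun m _ => (hi k m).const_mul _]
  simp only [dotProduct]
  refine Finset.sum_congr rfl fun k _ => ?_
  rw [integral_finsetSum _ fun m _ => (hi k m).const_mul _]
  simp only [integral_const_mul, hreg.cov_one]
  simp [Matrix.one_apply]

theorem integral_dot_sq (v : Fin p → ℝ) : ∫ z, (v ⬝ᵥ z.1) ^ 2 ∂P = v ⬝ᵥ v := by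
  rw [← hreg.integral_dot_mul_dot]; simp only [sq]

theorem integral_abs_dot_le (v : Fin p → ℝ) : ∫ z, |v ⬝ᵥ z.1| ∂P ≤ (v ⬝ᵥ v + 1) / 2 := by
  have h : ∫ z, |v ⬝ᵥ z.1| ∂P ≤ ∫ z, ((v ⬝ᵥ z.1) ^ 2 + 1) / 2 ∂P := by
    refine integral_mono (hreg.integrable_dot v).abs
      (((hreg.integrable_dot_sq v).add (integrable_const _)).div_const 2) fun z => ?_
    show |v ⬝ᵥ z.1| ≤ ((v ⬝ᵥ z.1) ^ 2 + 1) / 2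
    nlinarith [sq_nonneg (|v ⬝ᵥ z.1| - 1), sq_abs (v ⬝ᵥ z.1)]
  refine h.trans (le_of_eq ?_)
  rw [integral_div, integral_add (hreg.integrable_dot_sq v) (integrable_const _),
    hreg.integral_dot_sq]
  simp

theorem bound_nonneg : 0 ≤ C :=
  le_trans (integral_nonneg fun _ => sq_nonneg _) hreg.departure_sq

end RegularityConditions

theorem indicator_abs_le_one (s : Prop) [Decidable s] : |(if s then (1 : ℝ) else 0)| ≤ 1 := by
  split_ifs <;> simp

theorem integrable_mul_indicator {α : Type*} [MeasurableSpace α] {μ : Measure α} {f : α → ℝ}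
    (hf : Integrable f μ) {Y : α → ℝ} (hY : Measurable Y) (t : ℝ) :
    Integrable (fun z => f z * (if Y z ≤ t then (1 : ℝ) else 0)) μ := by
  refine hf.mul_bdd (c := 1) ?_ (ae_of_all _ fun z => indicator_abs_le_one _)
  exact (Measurable.ite (measurableSet_le hY measurable_const) measurable_const
    measurable_const).aestronglyMeasurable

theorem RegularityConditions.dot_alphaPop (hreg : RegularityConditions c C P g β ϑ B G)
    {Y : (Fin p → ℝ) × ℝ → ℝ} (hY : Measurable Y) (v : Fin p → ℝ) (t : ℝ) :
    v ⬝ᵥ alphaPop P Y t = ∫ z, (v ⬝ᵥ z.1) * (if Y z ≤ t then (1 : ℝ) else 0) ∂P := by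
  simp only [dotProduct, alphaPop, Finset.sum_mul]
  rw [integral_finsetSum]
  · refine Finset.sum_congr rfl fun k _ => ?_
    rw [← integral_const_mul]
    simp only [mul_assoc]
  · intro k _
    exact integrable_mul_indicator (((hreg.memLp_apply k).integrable (by norm_num)).const_mul _) hY t

/-- Testing with `v = K⁻¹ x` balances the two terms. This duality turns scalar bounds for `E[(vᵀX)
…]`, obtained from `2ab ≤ a² + b²`, into Euclidean bounds for slicing vectors that do not involve
`p`. -/
theorem dot_self_le_of_dot_le {ι : Type*} [Fintype ι] {x : ι → ℝ} {K L : ℝ} (hK : 0 ≤ K)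
    (h : ∀ v : ι → ℝ, v ⬝ᵥ x ≤ K * ((v ⬝ᵥ v + L) / 2)) : x ⬝ᵥ x ≤ K ^ 2 * L := by
  rcases hK.eq_or_lt with rfl | hK
  · simpa using h x
  · have := h (K⁻¹ • x)
    simp only [smul_dotProduct, dotProduct_smul, smul_eq_mul] at this
    field_simp at this
    nlinarith

end Moments

/-! ### Conditional independence and sufficient dimension reduction -/

theorem integral_mul_condExp_left {Ω : Type*} {m mΩ : MeasurableSpace Ω} {μ : Measure Ω}
    [IsFiniteMeasure μ] (hm : m ≤ mΩ) {f h : Ω → ℝ} (hf : StronglyMeasurable[m] f)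
    (hfh : Integrable (fun ω => f ω * h ω) μ) (hh : Integrable h μ) :
    ∫ ω, f ω * (μ[h | m]) ω ∂μ = ∫ ω, f ω * h ω ∂μ := by
  rw [← integral_condExp hm (f := fun ω => f ω * h ω)]
  exact integral_congr_ae (condExp_mul_of_stronglyMeasurable_left hf hfh hh).symm

theorem ae_abs_condExp_indicator_le_one {Ω : Type*} {m mΩ : MeasurableSpace Ω} {μ : Measure Ω}
    [IsFiniteMeasure μ] (A : Set Ω) :
    ∀ᵐ ω ∂μ, |(μ⟦A | m⟧) ω| ≤ 1 := by
  have := ae_bdd_abs_condExp_of_ae_bdd_abs (m := m) (μ := μ) (R := 1) (f := A.indicator fun _ => (1 : ℝ))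
    (ae_of_all _ fun ω => by
      by_cases h : ω ∈ A <;> simp [h])
  simpa using this

/-- Let `D` be the indicator of `Y ∈ s` minus its conditional expectation given `m`. The product
formula and the self-adjointness of conditional expectation show that `D` integrates to zero over
every event of `X`. Hence `E[D | X] = 0`, and a function `f` of `X` can be pulled out. No inclusion
between `m` and the σ-algebra of `X` is required. -/
theorem integral_mul_indicator_of_condIndepFun {Ω E F : Type*} {m mΩ : MeasurableSpace Ω}
    [StandardBorelSpace Ω] {mE : MeasurableSpace E} {mF : MeasurableSpace F} {μ : Measure Ω}
    [IsFiniteMeasure μ] (hm : m ≤ mΩ) {Y : Ω → F} {X : Ω → E} (hY : Measurable Y)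
    (hX : Measurable X) (hind : CondIndepFun m hm Y X μ)
    {f : Ω → ℝ} (hf : StronglyMeasurable[MeasurableSpace.comap X mE] f) (hfi : Integrable f μ)
    {s : Set F} (hs : MeasurableSet s) :
    ∫ ω, f ω * (Y ⁻¹' s).indicator (fun _ => (1 : ℝ)) ω ∂μ =
      ∫ ω, f ω * (μ⟦Y ⁻¹' s | m⟧) ω ∂μ := by
  rw [condIndepFun_iff_condExp_inter_preimage_eq_mul hY hX] at hind
  set I : Ω → ℝ := (Y ⁻¹' s).indicator fun _ => (1 : ℝ) with hI
  have hIi : Integrable I μ := (integrable_const (1 : ℝ)).indicator (hY hs)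
  have hbd := ae_abs_condExp_indicator_le_one (m := m) (μ := μ) (Y ⁻¹' s)
  have hDi : Integrable (fun ω => I ω - (μ[I | m]) ω) μ := hIi.sub integrable_condExp
  have hset (t : Set Ω) (ht : MeasurableSet[MeasurableSpace.comap X mE] t) :
      ∫ ω in t, (I ω - (μ[I | m]) ω) ∂μ = 0 := by
    obtain ⟨u, hu, rfl⟩ := ht
    have htm := hX hu
    have e1 : ∫ ω in X ⁻¹' u, I ω ∂μ =
        ∫ ω, ((Y ⁻¹' s) ∩ (X ⁻¹' u)).indicator (fun _ => (1 : ℝ)) ω ∂μ := by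
      rw [← integral_indicator htm, Set.inter_comm, ← Set.indicator_indicator]
    have hcu : Integrable ((X ⁻¹' u).indicator fun _ => (1 : ℝ)) μ :=
      (integrable_const (1 : ℝ)).indicator htm
    have e2 : ∫ ω, (μ[I | m]) ω * (μ⟦X ⁻¹' u | m⟧) ω ∂μ =
        ∫ ω, (μ[I | m]) ω * (X ⁻¹' u).indicator (fun _ => (1 : ℝ)) ω ∂μ := by
      refine integral_mul_condExp_left hm stronglyMeasurable_condExp ?_ hcu
      exact hcu.bdd_mul (c := 1) (integrable_condExp.aestronglyMeasurable) hbd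
    have e3 : ∫ ω in X ⁻¹' u, (μ[I | m]) ω ∂μ =
        ∫ ω, (μ[I | m]) ω * (X ⁻¹' u).indicator (fun _ => (1 : ℝ)) ω ∂μ := by
      rw [← integral_indicator htm]
      refine integral_congr_ae (ae_of_all _ fun ω => ?_)
      by_cases h : ω ∈ X ⁻¹' u <;> simp [h]
    rw [integral_sub hIi.integrableOn integrable_condExp.integrableOn, e1, e3, ← e2,
      ← integral_condExp hm (f := ((Y ⁻¹' s) ∩ (X ⁻¹' u)).indicator fun _ => (1 : ℝ)),
      integral_congr_ae (hind s u hs hu), sub_self]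
  have hz : (fun _ => (0 : ℝ)) =ᵐ[μ] μ[fun ω => I ω - (μ[I | m]) ω | MeasurableSpace.comap X mE] := by
    refine ae_eq_condExp_of_forall_setIntegral_eq hX.comap_le hDi
      (fun _ _ _ => (integrable_const _).integrableOn) (fun t ht _ => ?_) aestronglyMeasurable_const
    rw [hset t ht]; simp
  have hfD : Integrable (fun ω => f ω * (I ω - (μ[I | m]) ω)) μ := by
    refine hfi.mul_bdd (c := 2) hDi.aestronglyMeasurable ?_
    filter_upwards [hbd] with ω hω
    have h1 : |I ω| ≤ 1 := by
      by_cases h : ω ∈ Y ⁻¹' s <;> simp [hI, h]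
    exact (abs_sub _ _).trans (by linarith)
  have h0 : ∫ ω, f ω * (I ω - (μ[I | m]) ω) ∂μ = 0 := by
    rw [← integral_mul_condExp_left hX.comap_le hf hfD hDi]
    refine (integral_congr_ae (g := fun _ => (0 : ℝ)) ?_).trans (by simp)
    filter_upwards [hz] with ω hω
    rw [← hω, mul_zero]
  have h1 : Integrable (fun ω => f ω * I ω) μ := by
    refine hfi.mul_bdd (c := 1) hIi.aestronglyMeasurable (ae_of_all _ fun ω => ?_)
    by_cases h : ω ∈ Y ⁻¹' s <;> simp [hI, h]
  have h2 : Integrable (fun ω => f ω * (μ[I | m]) ω) μ :=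
    hfi.mul_bdd (c := 1) integrable_condExp.aestronglyMeasurable hbd
  simp only [mul_sub] at h0
  rw [integral_sub h1 h2] at h0
  linarith

section Population

variable {d l p q : ℕ} {c C : ℝ} {P : Measure ((Fin p → ℝ) × ℝ)} [IsProbabilityMeasure P]
  {g : (Fin d → ℝ) → (Fin l → ℝ) → ℝ} {β : Matrix (Fin p) (Fin d) ℝ} {ϑ : Fin l → ℝ}
  {B : Matrix (Fin p) (Fin q) ℝ} {G : (Fin q → ℝ) → ℝ}

theorem measurable_null_index (hg : Measurable fun u => g u ϑ) (β : Matrix (Fin p) (Fin d) ℝ) :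
    Measurable fun x : Fin p → ℝ => g (βᵀ *ᵥ x) ϑ := by
  have : Continuous fun x : Fin p → ℝ => βᵀ *ᵥ x := by fun_prop
  exact hg.comp this.measurable

theorem measurable_nullResponse (hg : Measurable fun u => g u ϑ) (β : Matrix (Fin p) (Fin d) ℝ) :
    Measurable (nullResponse g β ϑ) :=
  ((measurable_null_index hg β).comp measurable_fst).add measurable_snd

theorem measurable_departure_index (hG : Measurable G) (B : Matrix (Fin p) (Fin q) ℝ) :
    Measurable fun x : Fin p → ℝ => G (Bᵀ *ᵥ x) := by
  have : Continuous fun x : Fin p → ℝ => Bᵀ *ᵥ x := by fun_prop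
  exact hG.comp this.measurable

theorem measurable_localResponse (hg : Measurable fun u => g u ϑ) (hG : Measurable G)
    (β : Matrix (Fin p) (Fin d) ℝ) (B : Matrix (Fin p) (Fin q) ℝ) (r : ℝ) :
    Measurable (localResponse g β ϑ B G r) :=
  (((measurable_null_index hg β).comp measurable_fst).add
    (((measurable_departure_index hG B).comp measurable_fst).const_mul r)).add measurable_snd

namespace RegularityConditions

variable (hreg : RegularityConditions c C P g β ϑ B G)
include hreg

/-- The conditional expectation is an affine function `L = a₀ + (βa)ᵀX` of the index. Projecting,
`E[L²] = E[L bᵀX] = aᵀβᵀb = 0`, because `E X = 0` and `Var X = I`. -/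
theorem condExp_dot_ae_eq_zero {b : Fin p → ℝ} (hb : βᵀ *ᵥ b = 0) :
    P[fun z => b ⬝ᵥ z.1 | indexSigma β] =ᵐ[P] 0 := by
  obtain ⟨a₀, a, ha⟩ := hreg.linearity b
  set L : (Fin p → ℝ) × ℝ → ℝ := fun z => a₀ + a ⬝ᵥ (βᵀ *ᵥ z.1) with hL
  have hLeq (z : (Fin p → ℝ) × ℝ) : L z = a₀ + (β *ᵥ a) ⬝ᵥ z.1 := by
    simp only [hL]
    rw [Matrix.dotProduct_mulVec, Matrix.vecMul_transpose]
  have hLm : StronglyMeasurable[indexSigma β] L := by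
    have h1 : Measurable[indexSigma β] fun z : (Fin p → ℝ) × ℝ => βᵀ *ᵥ z.1 :=
      comap_measurable _
    have h2 : Measurable fun u : Fin d → ℝ => a₀ + a ⬝ᵥ u := by
      have : Continuous fun u : Fin d → ℝ => a₀ + a ⬝ᵥ u := by fun_prop
      exact this.measurable
    exact (h2.comp h1).stronglyMeasurable
  have hLp : MemLp L 2 P := by
    have : L = fun z => a₀ + (β *ᵥ a) ⬝ᵥ z.1 := funext hLeq
    rw [this]
    exact (memLp_const a₀).add (hreg.memLp_two_dot _)
  have h1 : ∫ z, L z * L z ∂P = 0 := by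
    have e1 : ∫ z, L z * L z ∂P = ∫ z, L z * (P[fun z => b ⬝ᵥ z.1 | indexSigma β]) z ∂P := by
      refine integral_congr_ae ?_
      filter_upwards [ha] with z hz
      rw [hz]
    rw [e1, integral_mul_condExp_left (indexSigma_le β) hLm
      (hLp.integrable_mul (hreg.memLp_two_dot b)) (hreg.integrable_dot b)]
    simp only [hLeq, add_mul]
    rw [integral_add ((hreg.integrable_dot b).const_mul _) (hreg.integrable_dot_mul_dot _ _),
      integral_const_mul, hreg.integral_dot, hreg.integral_dot_mul_dot, dotProduct_comm,
      Matrix.dotProduct_mulVec, ← Matrix.mulVec_transpose, hb]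
    simp
  have h2 := (integral_eq_zero_iff_of_nonneg (fun z => mul_self_nonneg (L z))
    (hLp.integrable_mul hLp)).1 h1
  filter_upwards [ha, h2] with z hz hz2
  rw [hz]
  exact mul_self_eq_zero.1 hz2

/-- Conditional independence replaces the indicator by `P(Y⁰ ≤ t | βᵀX)`. That is a function of the
index, so `bᵀX` may be replaced by `E(bᵀX | βᵀX) = 0`. -/
theorem dot_alphaPop_null_eq_zero (hg : Measurable fun u => g u ϑ) {b : Fin p → ℝ}
    (hb : βᵀ *ᵥ b = 0) (t : ℝ) : b ⬝ᵥ alphaPop P (nullResponse g β ϑ) t = 0 := by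
  have hY := measurable_nullResponse hg β
  rw [hreg.dot_alphaPop hY]
  have hfm : StronglyMeasurable[MeasurableSpace.comap
      (Prod.fst : (Fin p → ℝ) × ℝ → Fin p → ℝ) inferInstance]
      (fun z : (Fin p → ℝ) × ℝ => b ⬝ᵥ z.1) := by
    have h2 : Measurable fun u : Fin p → ℝ => b ⬝ᵥ u := by
      have : Continuous fun u : Fin p → ℝ => b ⬝ᵥ u := by fun_prop
      exact this.measurable
    exact (h2.comp (comap_measurable _)).stronglyMeasurable
  have h := integral_mul_indicator_of_condIndepFun (indexSigma_le β) hY measurable_fst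
    hreg.condIndep hfm (hreg.integrable_dot b) (measurableSet_Iic (a := t))
  have e : ∀ z, (nullResponse g β ϑ ⁻¹' Set.Iic t).indicator (fun _ => (1 : ℝ)) z =
      if nullResponse g β ϑ z ≤ t then (1 : ℝ) else 0 := fun z => by
    by_cases hz : nullResponse g β ϑ z ≤ t
    · rw [if_pos hz, Set.indicator_of_mem (by exact hz)]
    · rw [if_neg hz, Set.indicator_of_notMem (by exact hz)]
  simp only [e] at h
  rw [h]
  set I := P⟦nullResponse g β ϑ ⁻¹' Set.Iic t | indexSigma β⟧
  have hbd := ae_abs_condExp_indicator_le_one (m := indexSigma β) (μ := P)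
    (nullResponse g β ϑ ⁻¹' Set.Iic t)
  have h3 := integral_mul_condExp_left (indexSigma_le β) (f := I) (h := fun z => b ⬝ᵥ z.1)
    stronglyMeasurable_condExp
    ((hreg.integrable_dot b).bdd_mul (c := 1) integrable_condExp.aestronglyMeasurable hbd)
    (hreg.integrable_dot b)
  rw [integral_congr_ae (ae_of_all _ fun z => mul_comm (b ⬝ᵥ z.1) (I z)), ← h3]
  refine (integral_congr_ae (g := fun _ => (0 : ℝ)) ?_).trans (by simp)
  filter_upwards [hreg.condExp_dot_ae_eq_zero hb] with z hz
  rw [hz]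
  simp

/-! ### Size, smoothness and bias of the population slicing vectors -/

theorem alphaPop_dot_self_le_one {Y : (Fin p → ℝ) × ℝ → ℝ} (hY : Measurable Y) (t : ℝ) :
    alphaPop P Y t ⬝ᵥ alphaPop P Y t ≤ 1 := by
  have := dot_self_le_of_dot_le (x := alphaPop P Y t) (K := 1) (L := 1) zero_le_one fun v => ?_
  · simpa using this
  · rw [hreg.dot_alphaPop hY, one_mul]
    refine le_trans ?_ (hreg.integral_abs_dot_le v)
    refine integral_mono (integrable_mul_indicator (hreg.integrable_dot v) hY t)
      (hreg.integrable_dot v).abs fun z => ?_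
    show (v ⬝ᵥ z.1) * _ ≤ |v ⬝ᵥ z.1|
    split_ifs
    · simpa using le_abs_self _
    · simp

theorem integrable_departure_abs_mul (hG : Measurable G) (v : Fin p → ℝ) :
    Integrable (fun z : (Fin p → ℝ) × ℝ => |v ⬝ᵥ z.1| * |G (Bᵀ *ᵥ z.1)|) P := by
  have hm := ((measurable_departure_index hG B).comp measurable_fst :
    Measurable fun z : (Fin p → ℝ) × ℝ => G (Bᵀ *ᵥ z.1))
  exact (hreg.memLp_two_dot v).abs.integrable_mul
    (((memLp_two_iff_integrable_sq hm.aestronglyMeasurable).2 hreg.integrable_departure_sq).abs)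

/-- For fixed `t` the departure shifts the threshold for `ε` by `r G(BᵀX)`, so each projection of
the difference on `v` is at most `C |r| E[|vᵀX| |G|] ≤ C |r| (‖v‖² + C) / 2`. -/
theorem alphaPop_local_sub_null_le (hg : Measurable fun u => g u ϑ) (hG : Measurable G)
    (r t : ℝ) :
    (alphaPop P (localResponse g β ϑ B G r) t - alphaPop P (nullResponse g β ϑ) t) ⬝ᵥ
      (alphaPop P (localResponse g β ϑ B G r) t - alphaPop P (nullResponse g β ϑ) t) ≤
      C ^ 3 * r ^ 2 := by
  have hC := hreg.bound_nonneg
  have hY := measurable_localResponse hg hG β B r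
  have hY0 := measurable_nullResponse hg β
  have h := dot_self_le_of_dot_le (K := C * |r|) (L := C) (mul_nonneg hC (abs_nonneg r))
    (x := alphaPop P (localResponse g β ϑ B G r) t - alphaPop P (nullResponse g β ϑ) t) fun v => ?_
  · refine h.trans (le_of_eq ?_)
    rw [mul_pow, sq_abs]; ring
  · have hi := hreg.integrable_departure_abs_mul hG v
    have he : (fun z : (Fin p → ℝ) × ℝ => |v ⬝ᵥ z.1| *
        |(t - g (βᵀ *ᵥ z.1) ϑ - r * G (Bᵀ *ᵥ z.1)) - (t - g (βᵀ *ᵥ z.1) ϑ)|) =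
        fun z => |r| * (|v ⬝ᵥ z.1| * |G (Bᵀ *ᵥ z.1)|) := by
      ext z
      rw [sub_sub_cancel_left, abs_neg, abs_mul]; ring
    have key := abs_integral_indicator_sub_le P hC hreg.error_density
      (w := fun x => v ⬝ᵥ x) (s₁ := fun x => t - g (βᵀ *ᵥ x) ϑ - r * G (Bᵀ *ᵥ x))
      (s₂ := fun x => t - g (βᵀ *ᵥ x) ϑ)
      (by have : Continuous fun x : Fin p → ℝ => v ⬝ᵥ x := by fun_prop
          exact this.measurable)
      (((measurable_null_index hg β).const_sub t).sub
        ((measurable_departure_index hG B).const_mul r))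
      ((measurable_null_index hg β).const_sub t) (by rw [he]; exact hi.const_mul _)
    rw [he, integral_const_mul] at key
    rw [dotProduct_sub, hreg.dot_alphaPop hY, hreg.dot_alphaPop hY0,
      ← integral_sub (integrable_mul_indicator (hreg.integrable_dot v) hY t)
        (integrable_mul_indicator (hreg.integrable_dot v) hY0 t)]
    have e : ∀ z : (Fin p → ℝ) × ℝ,
        (v ⬝ᵥ z.1) * (if localResponse g β ϑ B G r z ≤ t then (1 : ℝ) else 0) -
          (v ⬝ᵥ z.1) * (if nullResponse g β ϑ z ≤ t then (1 : ℝ) else 0) =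
        (v ⬝ᵥ z.1) * ((if z.2 ≤ t - g (βᵀ *ᵥ z.1) ϑ - r * G (Bᵀ *ᵥ z.1) then (1 : ℝ) else 0) -
          (if z.2 ≤ t - g (βᵀ *ᵥ z.1) ϑ then (1 : ℝ) else 0)) := fun z => by
      have i1 : localResponse g β ϑ B G r z ≤ t ↔
          z.2 ≤ t - g (βᵀ *ᵥ z.1) ϑ - r * G (Bᵀ *ᵥ z.1) := by
        rw [localResponse]; constructor <;> intro h <;> linarith
      have i2 : nullResponse g β ϑ z ≤ t ↔ z.2 ≤ t - g (βᵀ *ᵥ z.1) ϑ := by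
        rw [nullResponse]; constructor <;> intro h <;> linarith
      simp only [i1, i2, mul_sub]
    simp only [e]
    refine (le_abs_self _).trans (key.trans ?_)
    rw [mul_assoc]
    refine mul_le_mul_of_nonneg_left (mul_le_mul_of_nonneg_left ?_ (abs_nonneg r)) hC
    have h2 : ∫ z, |v ⬝ᵥ z.1| * |G (Bᵀ *ᵥ z.1)| ∂P ≤
        ∫ z, ((v ⬝ᵥ z.1) ^ 2 + G (Bᵀ *ᵥ z.1) ^ 2) / 2 ∂P := by
      refine integral_mono hi
        (((hreg.integrable_dot_sq v).add hreg.integrable_departure_sq).div_const 2) fun z => ?_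
      show |v ⬝ᵥ z.1| * |G (Bᵀ *ᵥ z.1)| ≤ ((v ⬝ᵥ z.1) ^ 2 + G (Bᵀ *ᵥ z.1) ^ 2) / 2
      nlinarith [sq_nonneg (|v ⬝ᵥ z.1| - |G (Bᵀ *ᵥ z.1)|), sq_abs (v ⬝ᵥ z.1),
        sq_abs (G (Bᵀ *ᵥ z.1))]
    rw [integral_div, integral_add (hreg.integrable_dot_sq v) hreg.integrable_departure_sq,
      hreg.integral_dot_sq] at h2
    linarith [hreg.departure_sq]

/-- Lipschitz continuity of `ψ`. It allows `ψ` at the null response to be compared with `ψ` at the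
observed one, which lies `r G` away. -/
theorem alphaPop_null_sub_le (hg : Measurable fun u => g u ϑ) (t t' : ℝ) :
    (alphaPop P (nullResponse g β ϑ) t - alphaPop P (nullResponse g β ϑ) t') ⬝ᵥ
      (alphaPop P (nullResponse g β ϑ) t - alphaPop P (nullResponse g β ϑ) t') ≤
      C ^ 2 * (t - t') ^ 2 := by
  have hC := hreg.bound_nonneg
  have hY0 := measurable_nullResponse hg β
  have h := dot_self_le_of_dot_le (K := C * |t - t'|) (L := 1) (mul_nonneg hC (abs_nonneg _))
    (x := alphaPop P (nullResponse g β ϑ) t - alphaPop P (nullResponse g β ϑ) t') fun v => ?_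
  · refine h.trans (le_of_eq ?_)
    rw [mul_pow, sq_abs]; ring
  · have he : (fun z : (Fin p → ℝ) × ℝ => |v ⬝ᵥ z.1| *
        |(t - g (βᵀ *ᵥ z.1) ϑ) - (t' - g (βᵀ *ᵥ z.1) ϑ)|) =
        fun z => |t - t'| * |v ⬝ᵥ z.1| := by
      ext z
      rw [sub_sub_sub_cancel_right, mul_comm]
    have key := abs_integral_indicator_sub_le P hC hreg.error_density
      (w := fun x => v ⬝ᵥ x) (s₁ := fun x => t - g (βᵀ *ᵥ x) ϑ)
      (s₂ := fun x => t' - g (βᵀ *ᵥ x) ϑ)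
      (by have : Continuous fun x : Fin p → ℝ => v ⬝ᵥ x := by fun_prop
          exact this.measurable)
      ((measurable_null_index hg β).const_sub t) ((measurable_null_index hg β).const_sub t')
      (by rw [he]; exact (hreg.integrable_dot v).abs.const_mul _)
    rw [he, integral_const_mul] at key
    rw [dotProduct_sub, hreg.dot_alphaPop hY0, hreg.dot_alphaPop hY0,
      ← integral_sub (integrable_mul_indicator (hreg.integrable_dot v) hY0 t)
        (integrable_mul_indicator (hreg.integrable_dot v) hY0 t')]
    have e (t : ℝ) (z : (Fin p → ℝ) × ℝ) :
        nullResponse g β ϑ z ≤ t ↔ z.2 ≤ t - g (βᵀ *ᵥ z.1) ϑ := by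
      rw [nullResponse]; constructor <;> intro h <;> linarith
    simp only [e, ← mul_sub]
    refine (le_abs_self _).trans (key.trans ?_)
    rw [mul_assoc]
    exact mul_le_mul_of_nonneg_left (mul_le_mul_of_nonneg_left (hreg.integral_abs_dot_le v)
      (abs_nonneg _)) hC

end RegularityConditions

end Population

/-! ### Column spaces and orthonormal frames -/

theorem mem_colSpan_of_orthogonal {p d : ℕ} {β : Matrix (Fin p) (Fin d) ℝ} {w : Fin p → ℝ}
    (h : ∀ b, βᵀ *ᵥ b = 0 → b ⬝ᵥ w = 0) : w ∈ colSpan β := by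
  by_contra hw
  obtain ⟨f, hfw, hf⟩ := Submodule.exists_le_ker_of_notMem hw
  have hfb (x : Fin p → ℝ) : f x = (fun i => f fun j => if i = j then 1 else 0) ⬝ᵥ x := by
    rw [LinearMap.pi_apply_eq_sum_univ f x]
    exact Finset.sum_congr rfl fun i _ => mul_comm _ _
  refine hfw ((hfb w).trans (h _ ?_))
  ext j
  have : f (β.col j) = 0 := hf (Submodule.subset_span ⟨j, rfl⟩)
  rw [hfb, dotProduct_comm] at this
  exact this

theorem dot_eq_zero_of_mem_colSpan {p d : ℕ} {U : Matrix (Fin p) (Fin d) ℝ} {x y : Fin p → ℝ}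
    (hx : Uᵀ *ᵥ x = 0) (hy : y ∈ colSpan U) : y ⬝ᵥ x = 0 := by
  induction hy using Submodule.span_induction with
  | mem y hy =>
    obtain ⟨j, rfl⟩ := hy
    exact congrFun hx j
  | zero => simp
  | add y z _ _ hy hz => rw [add_dotProduct, hy, hz, add_zero]
  | smul a y _ hy => rw [smul_dotProduct, hy, smul_zero]

theorem transpose_mulVec_eq_zero_of_colSpan_eq {p d e : ℕ} {U : Matrix (Fin p) (Fin d) ℝ}
    {β : Matrix (Fin p) (Fin e) ℝ} (h : colSpan U = colSpan β) {x : Fin p → ℝ}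
    (hx : Uᵀ *ᵥ x = 0) : βᵀ *ᵥ x = 0 := by
  ext j
  refine dot_eq_zero_of_mem_colSpan hx (y := β.col j) ?_
  rw [h]
  exact Submodule.subset_span ⟨j, rfl⟩

theorem mulVec_transpose_mulVec_of_orthogonal {p d : ℕ} {U : Matrix (Fin p) (Fin d) ℝ}
    (hU : Uᵀ * U = 1) {y : Fin p → ℝ} (hy : ∀ x, Uᵀ *ᵥ x = 0 → x ⬝ᵥ y = 0) :
    U *ᵥ (Uᵀ *ᵥ y) = y := by
  have hz : Uᵀ *ᵥ (y - U *ᵥ (Uᵀ *ᵥ y)) = 0 := by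
    rw [Matrix.mulVec_sub, Matrix.mulVec_mulVec _ Uᵀ U, hU, Matrix.one_mulVec, sub_self]
  have h1 := hy _ hz
  have h2 : (y - U *ᵥ (Uᵀ *ᵥ y)) ⬝ᵥ (U *ᵥ (Uᵀ *ᵥ y)) = 0 := by
    rw [Matrix.dotProduct_mulVec, ← Matrix.mulVec_transpose, hz, zero_dotProduct]
  have h3 : (y - U *ᵥ (Uᵀ *ᵥ y)) ⬝ᵥ (y - U *ᵥ (Uᵀ *ᵥ y)) = 0 := by
    rw [dotProduct_sub, h1, h2, sub_zero]
  exact (sub_eq_zero.1 (dotProduct_self_eq_zero.1 h3)).symm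

theorem exists_isLeadingEigenvectors {p d : ℕ} (hdp : d ≤ p) {A : Matrix (Fin p) (Fin p) ℝ}
    (hA : A.IsHermitian) : ∃ W : Matrix (Fin p) (Fin d) ℝ, IsLeadingEigenvectors hA W := by
  obtain ⟨W, hW, -, hAW⟩ := exists_eigDesc_basis hA
  refine ⟨W.submatrix id (Fin.castLE hdp), ?_, fun j => hAW (Fin.castLE hdp j)⟩
  rw [Matrix.transpose_submatrix, ← Matrix.submatrix_mul _ _ _ id _ Function.bijective_id, hW,
    Matrix.submatrix_one _ (Fin.castLE_injective hdp)]

theorem integral_dot_mul_dot_eq {Z : Type*} [MeasurableSpace Z] {P : Measure Z} {d : ℕ}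
    {w : Z → Fin d → ℝ} (hi : ∀ k m, Integrable (fun z => w z k * w z m) P) (x y : Fin d → ℝ) :
    ∫ z, (w z ⬝ᵥ x) * (w z ⬝ᵥ y) ∂P =
      x ⬝ᵥ (Matrix.of (fun k m => ∫ z, w z k * w z m ∂P) *ᵥ y) := by
  have e : ∀ z, (w z ⬝ᵥ x) * (w z ⬝ᵥ y) = ∑ k, ∑ m, x k * y m * (w z k * w z m) := fun z => by
    simp only [dotProduct, Finset.sum_mul_sum]
    exact Finset.sum_congr rfl fun k _ => Finset.sum_congr rfl fun m _ => by ring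
  simp only [e]
  rw [integral_finsetSum _ fun k _ => integrable_finsetSum _ fun m _ => (hi k m).const_mul _]
  simp only [dotProduct, Matrix.mulVec, Finset.mul_sum]
  refine Finset.sum_congr rfl fun k _ => ?_
  rw [integral_finsetSum _ fun m _ => (hi k m).const_mul _]
  refine Finset.sum_congr rfl fun m _ => ?_
  rw [integral_const_mul, Matrix.of_apply]
  ring

/-! ### The null target matrix -/

section Target

variable {d l p q : ℕ} {c C : ℝ} {P : Measure ((Fin p → ℝ) × ℝ)} [IsProbabilityMeasure P]
  {g : (Fin d → ℝ) → (Fin l → ℝ) → ℝ} {β : Matrix (Fin p) (Fin d) ℝ} {ϑ : Fin l → ℝ}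
  {B : Matrix (Fin p) (Fin q) ℝ} {G : (Fin q → ℝ) → ℝ}

theorem measurable_alphaPop {Y : (Fin p → ℝ) × ℝ → ℝ} (hY : Measurable Y) (k : Fin p) :
    Measurable fun t => alphaPop P Y t k := by
  have hm : Measurable (Function.uncurry fun (t : ℝ) (z : (Fin p → ℝ) × ℝ) =>
      z.1 k * (if Y z ≤ t then (1 : ℝ) else 0)) := by
    refine Measurable.mul (by fun_prop) (Measurable.ite ?_ measurable_const measurable_const)
    exact measurableSet_le (hY.comp measurable_snd) measurable_fst
  exact hm.stronglyMeasurable.integral_prod_right.measurable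

theorem measurable_dot_alphaPop {Y : (Fin p → ℝ) × ℝ → ℝ} (hY : Measurable Y) (x : Fin p → ℝ) :
    Measurable fun t => alphaPop P Y t ⬝ᵥ x := by
  simp only [dotProduct]
  exact Finset.measurable_sum _ fun k _ => (measurable_alphaPop hY k).mul_const _

namespace RegularityConditions

variable (hreg : RegularityConditions c C P g β ϑ B G)
include hreg

theorem alphaPop_dot_sq_le {Y : (Fin p → ℝ) × ℝ → ℝ} (hY : Measurable Y) (t : ℝ)
    (x : Fin p → ℝ) : (alphaPop P Y t ⬝ᵥ x) ^ 2 ≤ x ⬝ᵥ x := by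
  have h1 := mul_le_mul_of_nonneg_right (hreg.alphaPop_dot_self_le_one hY t) (dot_self_nonneg x)
  rw [one_mul] at h1
  exact (dot_sq_le _ _).trans h1

theorem integrable_alphaPop_dot_mul {Y Y' : (Fin p → ℝ) × ℝ → ℝ} (hY : Measurable Y)
    (hY' : Measurable Y') (x y : Fin p → ℝ) :
    Integrable (fun z => (alphaPop P Y (Y' z) ⬝ᵥ x) * (alphaPop P Y (Y' z) ⬝ᵥ y)) P := by
  have hm : Measurable fun z => (alphaPop P Y (Y' z) ⬝ᵥ x) * (alphaPop P Y (Y' z) ⬝ᵥ y) :=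
    ((measurable_dot_alphaPop hY x).comp hY').mul ((measurable_dot_alphaPop hY y).comp hY')
  refine Integrable.of_bound hm.aestronglyMeasurable ((x ⬝ᵥ x + y ⬝ᵥ y) / 2)
    (ae_of_all _ fun z => ?_)
  have h1 := hreg.alphaPop_dot_sq_le hY (Y' z) x
  have h2 := hreg.alphaPop_dot_sq_le hY (Y' z) y
  rw [Real.norm_eq_abs, abs_mul]
  nlinarith [sq_nonneg (|alphaPop P Y (Y' z) ⬝ᵥ x| - |alphaPop P Y (Y' z) ⬝ᵥ y|),
    sq_abs (alphaPop P Y (Y' z) ⬝ᵥ x), sq_abs (alphaPop P Y (Y' z) ⬝ᵥ y)]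

theorem targetMatrix_bilin {Y : (Fin p → ℝ) × ℝ → ℝ} (hY : Measurable Y) (x y : Fin p → ℝ) :
    x ⬝ᵥ (targetMatrix P Y *ᵥ y) =
      ∫ z, (alphaPop P Y (Y z) ⬝ᵥ x) * (alphaPop P Y (Y z) ⬝ᵥ y) ∂P := by
  have hsingle (k : Fin p) (t : ℝ) : alphaPop P Y t ⬝ᵥ Pi.single k 1 = alphaPop P Y t k := by simp
  have hi (k m : Fin p) :
      Integrable (fun z => alphaPop P Y (Y z) k * alphaPop P Y (Y z) m) P := by
    have := hreg.integrable_alphaPop_dot_mul hY hY (Pi.single k 1) (Pi.single m 1)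
    simpa only [hsingle] using this
  have e : targetMatrix P Y =
      Matrix.of fun k m => ∫ z, alphaPop P Y (Y z) k * alphaPop P Y (Y z) m ∂P := by
    ext k m
    rw [targetMatrix, Matrix.of_apply, Matrix.of_apply, integral_map hY.aemeasurable]
    exact ((measurable_alphaPop hY k).mul (measurable_alphaPop hY m)).aestronglyMeasurable
  rw [e]
  exact (integral_dot_mul_dot_eq hi x y).symm

/-- The target matrix annihilates every `b` orthogonal to `β`, so an eigenvector with nonzero
eigenvalue is orthogonal to all such `b`. The `d` leading eigenvalues are at least `c > 0`. -/
theorem leading_mem_colSpan (hg : Measurable fun u => g u ϑ) (hc : 0 < c) (hdp : d ≤ p)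
    {W : Matrix (Fin p) (Fin d) ℝ}
    (hW : IsLeadingEigenvectors (targetMatrix_isHermitian P (nullResponse g β ϑ)) W) (j : Fin d) :
    W.col j ∈ colSpan β := by
  have hY := measurable_nullResponse hg β
  refine mem_colSpan_of_orthogonal fun b hb => ?_
  have h1 := hreg.targetMatrix_bilin hY b (W.col j)
  rw [hW.2 j, dotProduct_smul, smul_eq_mul] at h1
  have h2 : ∀ t, alphaPop P (nullResponse g β ϑ) t ⬝ᵥ b = 0 := fun t => by
    rw [dotProduct_comm]; exact hreg.dot_alphaPop_null_eq_zero hg hb t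
  simp only [h2, zero_mul, integral_zero] at h1
  have h3 : c ≤ eigDesc (targetMatrix_isHermitian P (nullResponse g β ϑ)) ((j : ℕ) + 1) :=
    hreg.eigenvalue_lower.trans (eigDesc_antitone _ (by omega) (by omega) hdp)
  exact (mul_eq_zero.1 h1).resolve_left (by linarith)

/-- The `d` leading eigenvectors are orthonormal inside a space of dimension at most `d`, hence fill
it. In particular the eigenvalue condition forces `β` to have full rank. -/
theorem exists_orthonormal_frame (hg : Measurable fun u => g u ϑ) (hc : 0 < c) (hdp : d ≤ p) :
    ∃ U : Matrix (Fin p) (Fin d) ℝ, Uᵀ * U = 1 ∧ colSpan U = colSpan β := by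
  obtain ⟨W, hW⟩ := exists_isLeadingEigenvectors hdp
    (targetMatrix_isHermitian P (nullResponse g β ϑ))
  refine ⟨W, hW.1, ?_⟩
  have hle : colSpan W ≤ colSpan β := by
    rw [colSpan, Submodule.span_le]
    rintro _ ⟨j, rfl⟩
    exact hreg.leading_mem_colSpan hg hc hdp hW j
  refine Submodule.eq_of_le_of_finrank_le hle ?_
  have hli : LinearIndependent ℝ W.col := by
    rw [← Matrix.mulVec_injective_iff]
    intro a b hab
    have := congrArg (fun v => Wᵀ *ᵥ v) hab
    simpa [Matrix.mulVec_mulVec, hW.1] using this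
  have h1 : Module.finrank ℝ (colSpan W) = d := by
    rw [colSpan, finrank_span_eq_card hli, Fintype.card_fin]
  have h2 : Module.finrank ℝ (colSpan β) ≤ d := by
    have := finrank_range_le_card (R := ℝ) β.col
    rwa [Fintype.card_fin] at this
  rwa [h1]

section Frame

variable {U : Matrix (Fin p) (Fin d) ℝ} (hU : Uᵀ * U = 1) (hspan : colSpan U = colSpan β)
include hU hspan

omit hU in
theorem alphaPop_null_dot_eq_zero (hg : Measurable fun u => g u ϑ) {x : Fin p → ℝ}
    (hx : Uᵀ *ᵥ x = 0) (t : ℝ) : alphaPop P (nullResponse g β ϑ) t ⬝ᵥ x = 0 := by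
  rw [dotProduct_comm]
  exact hreg.dot_alphaPop_null_eq_zero hg (transpose_mulVec_eq_zero_of_colSpan_eq hspan hx) t

theorem frame_mulVec_alphaPop_null (hg : Measurable fun u => g u ϑ) (t : ℝ) :
    U *ᵥ (Uᵀ *ᵥ alphaPop P (nullResponse g β ϑ) t) = alphaPop P (nullResponse g β ϑ) t :=
  mulVec_transpose_mulVec_of_orthogonal hU fun _ hx => by
    rw [dotProduct_comm]; exact hreg.alphaPop_null_dot_eq_zero hspan hg hx t

/-- `U` and the leading eigenvectors `W` span the same space, so they differ by the orthogonal
matrix `Uᵀ W`, and the form is diagonal in `W`. -/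
theorem le_integral_alphaPop_null_sq (hg : Measurable fun u => g u ϑ) (hc : 0 < c) (hdp : d ≤ p)
    (a : Fin d → ℝ) :
    c * (a ⬝ᵥ a) ≤
      ∫ z, (alphaPop P (nullResponse g β ϑ) (nullResponse g β ϑ z) ⬝ᵥ (U *ᵥ a)) ^ 2 ∂P := by
  obtain ⟨W, hW⟩ := exists_isLeadingEigenvectors hdp
    (targetMatrix_isHermitian P (nullResponse g β ϑ))
  have hcol (j : Fin d) : U *ᵥ (Uᵀ *ᵥ W.col j) = W.col j := by
    refine mulVec_transpose_mulVec_of_orthogonal hU fun x hx => ?_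
    rw [dotProduct_comm]
    refine dot_eq_zero_of_mem_colSpan hx ?_
    rw [hspan]
    exact hreg.leading_mem_colSpan hg hc hdp hW j
  have hUW : U * (Uᵀ * W) = W := by
    ext i j
    have := congrFun (hcol j) i
    rw [Matrix.mulVec_mulVec] at this
    rw [← Matrix.mul_assoc]
    exact this
  have hO : (Uᵀ * W)ᵀ * (Uᵀ * W) = 1 := by
    rw [Matrix.transpose_mul, Matrix.transpose_transpose, Matrix.mul_assoc, hUW, hW.1]
  have hO' := mul_eq_one_comm.1 hO
  have hUa : U *ᵥ a = W *ᵥ ((Uᵀ * W)ᵀ *ᵥ a) := by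
    have h (v : Fin d → ℝ) : W *ᵥ v = U *ᵥ ((Uᵀ * W) *ᵥ v) := by rw [Matrix.mulVec_mulVec, hUW]
    rw [h, Matrix.mulVec_mulVec _ (Uᵀ * W), hO', Matrix.one_mulVec]
  have haa : a ⬝ᵥ a = ((Uᵀ * W)ᵀ *ᵥ a) ⬝ᵥ ((Uᵀ * W)ᵀ *ᵥ a) := by
    rw [mulVec_dot_mulVec]
    rw [Matrix.transpose_transpose, hO']
  simp only [sq]
  rw [← hreg.targetMatrix_bilin (measurable_nullResponse hg β), hUa,
    quadratic_eigenvectors hW.1 hW.2, haa, dot_self_eq_sum_sq, Finset.mul_sum]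
  refine Finset.sum_le_sum fun k _ => mul_le_mul_of_nonneg_right ?_ (sq_nonneg _)
  exact hreg.eigenvalue_lower.trans (eigDesc_antitone _ (by omega) (by omega) hdp)

end Frame

/-- The eigenvalue condition concerns `ψ(Y⁰)`, the sample `ψ(Y)`. Factor the difference of squares:
one factor is at most `C |r G| ‖x‖` by the Lipschitz bound, the other at most `2 ‖x‖`, and `2|G| ≤ 1
+ G²`. -/
theorem integral_alphaPop_null_sq_le (hg : Measurable fun u => g u ϑ) (hG : Measurable G)
    (r : ℝ) (x : Fin p → ℝ) :
    ∫ z, (alphaPop P (nullResponse g β ϑ) (nullResponse g β ϑ z) ⬝ᵥ x) ^ 2 ∂P ≤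
      ∫ z, (alphaPop P (nullResponse g β ϑ) (localResponse g β ϑ B G r z) ⬝ᵥ x) ^ 2 ∂P +
        C * (1 + C) * |r| * (x ⬝ᵥ x) := by
  have hC := hreg.bound_nonneg
  have hY0 := measurable_nullResponse hg β
  have hY := measurable_localResponse hg hG β B r
  have hx := dot_self_nonneg x
  set ψ := alphaPop P (nullResponse g β ϑ) with hψ
  have hpt (z : (Fin p → ℝ) × ℝ) : (ψ (nullResponse g β ϑ z) ⬝ᵥ x) ^ 2 ≤
      (ψ (localResponse g β ϑ B G r z) ⬝ᵥ x) ^ 2 +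
        C * |r| * (x ⬝ᵥ x) * (1 + G (Bᵀ *ᵥ z.1) ^ 2) := by
    set s := ψ (nullResponse g β ϑ z) with hs
    set t := ψ (localResponse g β ϑ B G r z) with ht
    have h1 := hreg.alphaPop_dot_sq_le hY0 (nullResponse g β ϑ z) x
    have h2 := hreg.alphaPop_dot_sq_le hY0 (localResponse g β ϑ B G r z) x
    rw [← hψ, ← hs] at h1
    rw [← hψ, ← ht] at h2
    have h3 := hreg.alphaPop_null_sub_le hg (nullResponse g β ϑ z) (localResponse g β ϑ B G r z)
    rw [← hψ, ← hs, ← ht] at h3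
    have e : nullResponse g β ϑ z - localResponse g β ϑ B G r z = -(r * G (Bᵀ *ᵥ z.1)) := by
      rw [nullResponse, localResponse]; ring
    rw [e, neg_sq, mul_pow] at h3
    set γ := G (Bᵀ *ᵥ z.1)
    have h4 : ((s - t) ⬝ᵥ x) ^ 2 ≤ C ^ 2 * (r ^ 2 * γ ^ 2) * (x ⬝ᵥ x) :=
      (dot_sq_le _ _).trans (mul_le_mul_of_nonneg_right h3 hx)
    rw [sub_dotProduct] at h4
    have h5 : (s ⬝ᵥ x + t ⬝ᵥ x) ^ 2 ≤ 4 * (x ⬝ᵥ x) := by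
      nlinarith [sq_nonneg (s ⬝ᵥ x - t ⬝ᵥ x)]
    have h6 : ((s ⬝ᵥ x - t ⬝ᵥ x) * (s ⬝ᵥ x + t ⬝ᵥ x)) ^ 2 ≤ (2 * C * |r| * |γ| * (x ⬝ᵥ x)) ^ 2 := by
      have e2 : (2 * C * |r| * |γ| * (x ⬝ᵥ x)) ^ 2 =
          C ^ 2 * (r ^ 2 * γ ^ 2) * (x ⬝ᵥ x) * (4 * (x ⬝ᵥ x)) := by
        simp only [mul_pow, sq_abs]; ring
      rw [e2, mul_pow]
      exact mul_le_mul h4 h5 (sq_nonneg _) (by positivity)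
    have h7 := abs_le_of_sq_le_sq' h6 (by positivity)
    have h8 : 2 * |γ| ≤ 1 + γ ^ 2 := by nlinarith [sq_nonneg (|γ| - 1), sq_abs γ]
    have h9 : C * |r| * (x ⬝ᵥ x) * (2 * |γ|) ≤ C * |r| * (x ⬝ᵥ x) * (1 + γ ^ 2) :=
      mul_le_mul_of_nonneg_left h8 (by positivity)
    nlinarith [h7.1, h7.2]
  have i1 : Integrable (fun z => (ψ (nullResponse g β ϑ z) ⬝ᵥ x) ^ 2) P := by
    simp only [sq]; exact hreg.integrable_alphaPop_dot_mul hY0 hY0 x x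
  have i2 : Integrable (fun z => (ψ (localResponse g β ϑ B G r z) ⬝ᵥ x) ^ 2) P := by
    simp only [sq]; exact hreg.integrable_alphaPop_dot_mul hY0 hY x x
  have i3 : Integrable (fun z => C * |r| * (x ⬝ᵥ x) * (1 + G (Bᵀ *ᵥ z.1) ^ 2)) P :=
    ((integrable_const _).add hreg.integrable_departure_sq).const_mul _
  refine (integral_mono i1 (i2.add i3) hpt).trans ?_
  simp only [Pi.add_apply]
  rw [integral_add i2 i3, integral_const_mul,
    integral_add (integrable_const _) hreg.integrable_departure_sq]
  have h1 := mul_le_mul_of_nonneg_left hreg.departure_sq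
    (show 0 ≤ C * |r| * (x ⬝ᵥ x) by positivity)
  simp only [integral_const, probReal_univ, smul_eq_mul]
  nlinarith

end RegularityConditions

/-! ### Empirical second moments of the index coordinates -/

/-- Squared Frobenius distance of the average of `φ φᵀ` along the sample from `N`. -/
noncomputable def indexMomentError {n d : ℕ} (φ : Fin n → Fin d → ℝ) (N : Matrix (Fin d) (Fin d) ℝ) : ℝ :=
  ∑ k, ∑ m, ((n : ℝ)⁻¹ * ∑ j, (φ j k * φ j m - N k m)) ^ 2

theorem sub_le_average_of_indexMomentError_le {n d : ℕ} (hn : 0 < n) (φ : Fin n → Fin d → ℝ)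
    (N : Matrix (Fin d) (Fin d) ℝ) {η : ℝ} (hη : 0 ≤ η) (h : indexMomentError φ N ≤ η ^ 2)
    (b : Fin d → ℝ) :
    b ⬝ᵥ (N *ᵥ b) - η * (b ⬝ᵥ b) ≤ (n : ℝ)⁻¹ * ∑ j, (φ j ⬝ᵥ b) ^ 2 := by
  set E : Matrix (Fin d) (Fin d) ℝ :=
    Matrix.of fun k m => (n : ℝ)⁻¹ * ∑ j, (φ j k * φ j m - N k m) with hE
  have hEN : E = (n : ℝ)⁻¹ • ∑ j, Matrix.vecMulVec (φ j) (φ j) - N := by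
    ext k m
    simp only [hE, Matrix.of_apply, average_sub_const hn, Matrix.sub_apply, Matrix.smul_apply,
      Matrix.sum_apply, Matrix.vecMulVec_apply, smul_eq_mul]
  have h1 : b ⬝ᵥ (E *ᵥ b) = (n : ℝ)⁻¹ * ∑ j, (φ j ⬝ᵥ b) ^ 2 - b ⬝ᵥ (N *ᵥ b) := by
    rw [hEN, Matrix.sub_mulVec, dotProduct_sub, average_quadratic]
  have hb := dot_self_nonneg b
  have h2 : (b ⬝ᵥ (E *ᵥ b)) ^ 2 ≤ (η * (b ⬝ᵥ b)) ^ 2 := by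
    refine (dot_sq_le _ _).trans ?_
    have h3 : (E *ᵥ b) ⬝ᵥ (E *ᵥ b) ≤ η ^ 2 * (b ⬝ᵥ b) :=
      (mulVec_dot_self_le E b).trans (mul_le_mul_of_nonneg_right h hb)
    nlinarith [mul_le_mul_of_nonneg_left h3 hb]
  have := (abs_le_of_sq_le_sq' h2 (by positivity)).1
  linarith

end Target

/-! ### Second moments of centered averages over an i.i.d. sample -/

section Iid

variable {Ω Z : Type*} [MeasurableSpace Ω] [MeasurableSpace Z] {μ : Measure Ω}
  [IsProbabilityMeasure μ] {P : Measure Z} [IsProbabilityMeasure P] {n : ℕ} {S : Fin n → Ω → Z}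

omit [IsProbabilityMeasure P] in
theorem map_prodMk_of_iIndepFun (hS : ∀ i, Measurable (S i)) (hlaw : ∀ i, μ.map (S i) = P)
    (hindep : iIndepFun S μ) {i j : Fin n} (hij : i ≠ j) :
    μ.map (fun ω => (S i ω, S j ω)) = P.prod P := by
  have := (indepFun_iff_map_prod_eq_prod_map_map (hS i).aemeasurable (hS j).aemeasurable).1
    (hindep.indepFun hij)
  rw [this, hlaw, hlaw]

omit [IsProbabilityMeasure P] in
theorem map_prodMk_prodMk_of_iIndepFun (hS : ∀ i, Measurable (S i)) (hlaw : ∀ i, μ.map (S i) = P)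
    (hindep : iIndepFun S μ) {i j k : Fin n} (hij : i ≠ j) (hik : i ≠ k) (hjk : j ≠ k) :
    μ.map (fun ω => ((S i ω, S j ω), S k ω)) = (P.prod P).prod P := by
  have := (indepFun_iff_map_prod_eq_prod_map_map ((hS i).prodMk (hS j)).aemeasurable
    (hS k).aemeasurable).1 (hindep.indepFun_prodMk hS i j k hik hjk)
  rw [this, hlaw, map_prodMk_of_iIndepFun hS hlaw hindep hij]

/-- The second argument is itself a sample point, as for slicing at `Yⱼ`. Expand the square into
`n²` products. If `i`, `k`, `j` are distinct, integrating over the `k`-th point alone gives zero. At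
most `3n` pairs remain (`i = k`, `i = j` or `k = j`), each contributing at most `K`; the pairs
meeting `j` are why the diagonal bound on `f z z` is needed. -/
theorem integral_average_sq_le (hS : ∀ i, Measurable (S i)) (hlaw : ∀ i, μ.map (S i) = P)
    (hindep : iIndepFun S μ) {f : Z → Z → ℝ} (hf : Measurable (Function.uncurry f)) {K : ℝ}
    (hcenter : ∀ u, ∫ s, f s u ∂P = 0)
    (hint : Integrable (fun z : Z × Z => f z.1 z.2 ^ 2) (P.prod P))
    (hK : ∫ z : Z × Z, f z.1 z.2 ^ 2 ∂(P.prod P) ≤ K)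
    (hintd : Integrable (fun z => f z z ^ 2) P) (hKd : ∫ z, f z z ^ 2 ∂P ≤ K) (j : Fin n) :
    Integrable (fun ω => ((n : ℝ)⁻¹ * ∑ i, f (S i ω) (S j ω)) ^ 2) μ ∧
      ∫ ω, ((n : ℝ)⁻¹ * ∑ i, f (S i ω) (S j ω)) ^ 2 ∂μ ≤ 3 * K / n := by
  have hn : 0 < n := j.pos
  have hm (i : Fin n) : Measurable fun ω => f (S i ω) (S j ω) := hf.comp ((hS i).prodMk (hS j))
  have hsq (i : Fin n) : Integrable (fun ω => f (S i ω) (S j ω) ^ 2) μ ∧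
      ∫ ω, f (S i ω) (S j ω) ^ 2 ∂μ ≤ K := by
    have hf2 : Measurable fun z : Z × Z => f z.1 z.2 ^ 2 := hf.pow_const 2
    by_cases hij : i = j
    · subst hij
      have hd : Measurable fun z : Z => f z z ^ 2 :=
        hf2.comp (measurable_id.prodMk measurable_id)
      rw [← hlaw i] at hintd hKd
      rw [integral_map (hS i).aemeasurable hd.aestronglyMeasurable] at hKd
      exact ⟨hintd.comp_measurable (hS i), hKd⟩
    · have hp := map_prodMk_of_iIndepFun hS hlaw hindep hij
      rw [← hp] at hint hK
      rw [integral_map ((hS i).prodMk (hS j)).aemeasurable hf2.aestronglyMeasurable] at hK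
      exact ⟨hint.comp_measurable ((hS i).prodMk (hS j)), hK⟩
  have hL2 (i : Fin n) : MemLp (fun ω => f (S i ω) (S j ω)) 2 μ :=
    (memLp_two_iff_integrable_sq (hm i).aestronglyMeasurable).2 (hsq i).1
  have hprod (i k : Fin n) : Integrable (fun ω => f (S i ω) (S j ω) * f (S k ω) (S j ω)) μ :=
    (hL2 i).integrable_mul (hL2 k)
  have hK0 : 0 ≤ K := (integral_nonneg fun _ => sq_nonneg _).trans (hsq j).2
  have hle (i k : Fin n) : ∫ ω, f (S i ω) (S j ω) * f (S k ω) (S j ω) ∂μ ≤ K := by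
    have h : ∫ ω, f (S i ω) (S j ω) * f (S k ω) (S j ω) ∂μ ≤
        ∫ ω, (f (S i ω) (S j ω) ^ 2 + f (S k ω) (S j ω) ^ 2) / 2 ∂μ := by
      refine integral_mono (hprod i k) (((hsq i).1.add (hsq k).1).div_const 2) fun ω => ?_
      show f (S i ω) (S j ω) * f (S k ω) (S j ω) ≤
        (f (S i ω) (S j ω) ^ 2 + f (S k ω) (S j ω) ^ 2) / 2
      nlinarith [sq_nonneg (f (S i ω) (S j ω) - f (S k ω) (S j ω))]
    rw [integral_div, integral_add (hsq i).1 (hsq k).1] at h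
    linarith [(hsq i).2, (hsq k).2]
  have hzero (i k : Fin n) (hij : i ≠ j) (hkj : k ≠ j) (hik : i ≠ k) :
      ∫ ω, f (S i ω) (S j ω) * f (S k ω) (S j ω) ∂μ = 0 := by
    have hp := map_prodMk_prodMk_of_iIndepFun hS hlaw hindep hij hik hkj.symm
    have hF : Measurable fun z : (Z × Z) × Z => f z.1.1 z.1.2 * f z.2 z.1.2 :=
      (hf.comp measurable_fst).mul
        (hf.comp (measurable_snd.prodMk (measurable_snd.comp measurable_fst)))
    have hm3 : Measurable fun ω => ((S i ω, S j ω), S k ω) := ((hS i).prodMk (hS j)).prodMk (hS k)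
    have e := integral_map (μ := μ) hm3.aemeasurable hF.aestronglyMeasurable
    have hFi : Integrable (fun z : (Z × Z) × Z => f z.1.1 z.1.2 * f z.2 z.1.2)
        ((P.prod P).prod P) := by
      rw [← hp, integrable_map_measure hF.aestronglyMeasurable hm3.aemeasurable]
      exact hprod i k
    rw [hp, integral_prod _ hFi] at e
    rw [← e]
    simp only [integral_const_mul, hcenter, mul_zero, integral_zero]
  have hexp (ω : Ω) : ((n : ℝ)⁻¹ * ∑ i, f (S i ω) (S j ω)) ^ 2 =
      ((n : ℝ)⁻¹) ^ 2 * ∑ i, ∑ k, f (S i ω) (S j ω) * f (S k ω) (S j ω) := by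
    rw [mul_pow, sq (∑ i, f (S i ω) (S j ω)), Finset.sum_mul_sum]
  simp only [hexp]
  have hi1 (i : Fin n) : Integrable (fun ω => ∑ k, f (S i ω) (S j ω) * f (S k ω) (S j ω)) μ :=
    integrable_finsetSum _ fun k _ => hprod i k
  refine ⟨(integrable_finsetSum _ fun i _ => hi1 i).const_mul _, ?_⟩
  rw [integral_const_mul, integral_finsetSum _ fun i _ => hi1 i]
  have hbound : ∑ i, ∫ ω, ∑ k, f (S i ω) (S j ω) * f (S k ω) (S j ω) ∂μ ≤ 3 * n * K := by
    calc ∑ i, ∫ ω, ∑ k, f (S i ω) (S j ω) * f (S k ω) (S j ω) ∂μ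
        ≤ ∑ i : Fin n, ∑ k : Fin n, ((if i = k then K else 0) + (if i = j then K else 0) +
            (if k = j then K else 0)) := by
          refine Finset.sum_le_sum fun i _ => ?_
          rw [integral_finsetSum _ fun k _ => hprod i k]
          refine Finset.sum_le_sum fun k _ => ?_
          by_cases h1 : i = k
          · refine (hle i k).trans ?_
            rw [if_pos h1]
            split_ifs <;> linarith
          · by_cases h2 : i = j
            · refine (hle i k).trans ?_
              rw [if_pos h2]
              split_ifs <;> linarith
            · by_cases h3 : k = j
              · refine (hle i k).trans ?_
                rw [if_pos h3]
                split_ifs; linarith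
              · rw [hzero i k h2 h3 h1]
                simp [h1, h2, h3]
      _ = 3 * n * K := by
          simp only [Finset.sum_add_distrib, Finset.sum_ite_eq, Finset.mem_univ, if_true,
            Finset.sum_ite_eq', Finset.sum_const, Finset.card_univ, Fintype.card_fin, nsmul_eq_mul]
          rw [← Finset.mul_sum]
          simp
          ring
  have hn' : (0 : ℝ) < n := by exact_mod_cast hn
  calc ((n : ℝ)⁻¹) ^ 2 * ∑ i, ∫ ω, ∑ k, f (S i ω) (S j ω) * f (S k ω) (S j ω) ∂μ
      ≤ ((n : ℝ)⁻¹) ^ 2 * (3 * n * K) := by gcongr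
    _ = 3 * K / n := by field_simp

theorem integral_average_sq_le_of_centered (hn : 0 < n) (hS : ∀ i, Measurable (S i))
    (hlaw : ∀ i, μ.map (S i) = P) (hindep : iIndepFun S μ) {f : Z → ℝ} (hf : Measurable f) {K : ℝ}
    (hcenter : ∫ s, f s ∂P = 0) (hint : Integrable (fun z => f z ^ 2) P)
    (hK : ∫ z, f z ^ 2 ∂P ≤ K) :
    Integrable (fun ω => ((n : ℝ)⁻¹ * ∑ i, f (S i ω)) ^ 2) μ ∧
      ∫ ω, ((n : ℝ)⁻¹ * ∑ i, f (S i ω)) ^ 2 ∂μ ≤ 3 * K / n := by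
  refine integral_average_sq_le hS hlaw hindep (f := fun s _ => f s) (hf.comp measurable_fst)
    (fun _ => hcenter) (hint.comp_fst P) ?_ hint hK ⟨0, hn⟩
  have := integral_fun_fst (μ := P) (ν := P) (fun z => f z ^ 2)
  simp only [probReal_univ, one_smul] at this
  rwa [this]

omit [IsProbabilityMeasure μ] in
theorem integral_sum_le_card_mul {ι : Type*} [Fintype ι] {F : ι → Ω → ℝ} {K : ℝ}
    (h : ∀ i, Integrable (F i) μ ∧ ∫ ω, F i ω ∂μ ≤ K) :
    Integrable (fun ω => ∑ i, F i ω) μ ∧ ∫ ω, ∑ i, F i ω ∂μ ≤ Fintype.card ι * K := by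
  refine ⟨integrable_finsetSum _ fun i _ => (h i).1, ?_⟩
  rw [integral_finsetSum _ fun i _ => (h i).1]
  refine (Finset.sum_le_sum fun i _ => (h i).2).trans ?_
  simp

end Iid

/-! ### Expected size of the sampling errors -/

section SamplingErrors

variable {d l p q n : ℕ} {c C : ℝ} {P : Measure ((Fin p → ℝ) × ℝ)} [IsProbabilityMeasure P]
  {g : (Fin d → ℝ) → (Fin l → ℝ) → ℝ} {β : Matrix (Fin p) (Fin d) ℝ} {ϑ : Fin l → ℝ}
  {B : Matrix (Fin p) (Fin q) ℝ} {G : (Fin q → ℝ) → ℝ}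
  {Ω : Type*} [MeasurableSpace Ω] {μ : Measure Ω} [IsProbabilityMeasure μ]
  {S : Fin n → Ω → (Fin p → ℝ) × ℝ}

theorem integral_sub_sq_le {Z : Type*} [MeasurableSpace Z] {P : Measure Z} [IsProbabilityMeasure P]
    {h : Z → ℝ} {m K : ℝ} (hi : Integrable h P) (hsq : Integrable (fun z => h z ^ 2) P)
    (hm : ∫ z, h z ∂P = m) (hK : ∫ z, h z ^ 2 ∂P ≤ K) :
    ∫ z, (h z - m) ∂P = 0 ∧ Integrable (fun z => (h z - m) ^ 2) P ∧
      ∫ z, (h z - m) ^ 2 ∂P ≤ K := by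
  have e : ∀ z, (h z - m) ^ 2 = h z ^ 2 - 2 * m * h z + m ^ 2 := fun z => by ring
  have h1 : Integrable (fun z => h z ^ 2 - 2 * m * h z) P := hsq.sub (hi.const_mul _)
  refine ⟨by rw [integral_sub hi (integrable_const _), hm]; simp, ?_, ?_⟩
  · simp only [e]
    exact h1.add (integrable_const _)
  · simp only [e]
    rw [integral_add h1 (integrable_const _), integral_sub hsq (hi.const_mul _),
      integral_const_mul, hm]
    simp only [integral_const, probReal_univ, smul_eq_mul]
    nlinarith [sq_nonneg m]

namespace RegularityConditions

variable (hreg : RegularityConditions c C P g β ϑ B G)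
include hreg

theorem integral_dot_mul_dot_sq_le {v w : Fin p → ℝ} (hv : ∫ z, (v ⬝ᵥ z.1) ^ 4 ∂P ≤ C)
    (hw : ∫ z, (w ⬝ᵥ z.1) ^ 4 ∂P ≤ C) :
    Integrable (fun z : (Fin p → ℝ) × ℝ => ((v ⬝ᵥ z.1) * (w ⬝ᵥ z.1)) ^ 2) P ∧
      ∫ z, ((v ⬝ᵥ z.1) * (w ⬝ᵥ z.1)) ^ 2 ∂P ≤ C := by
  have hi : Integrable (fun z : (Fin p → ℝ) × ℝ =>
      ((v ⬝ᵥ z.1) ^ 4 + (w ⬝ᵥ z.1) ^ 4) / 2) P :=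
    ((hreg.integrable_dot_fourth v).add (hreg.integrable_dot_fourth w)).div_const 2
  have hle (z : (Fin p → ℝ) × ℝ) : ((v ⬝ᵥ z.1) * (w ⬝ᵥ z.1)) ^ 2 ≤
      ((v ⬝ᵥ z.1) ^ 4 + (w ⬝ᵥ z.1) ^ 4) / 2 := by
    nlinarith [sq_nonneg ((v ⬝ᵥ z.1) ^ 2 - (w ⬝ᵥ z.1) ^ 2)]
  have hm : Measurable fun z : (Fin p → ℝ) × ℝ => ((v ⬝ᵥ z.1) * (w ⬝ᵥ z.1)) ^ 2 :=
    ((measurable_dot_fst v).mul (measurable_dot_fst w)).pow_const 2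
  have h1 : Integrable (fun z : (Fin p → ℝ) × ℝ => ((v ⬝ᵥ z.1) * (w ⬝ᵥ z.1)) ^ 2) P :=
    hi.mono' hm.aestronglyMeasurable (ae_of_all _ fun z => by
      rw [Real.norm_of_nonneg (sq_nonneg _)]; exact hle z)
  refine ⟨h1, (integral_mono h1 hi hle).trans ?_⟩
  rw [integral_div, integral_add (hreg.integrable_dot_fourth v) (hreg.integrable_dot_fourth w)]
  linarith

theorem fourth_moment_single (k : Fin p) :
    ∫ z, ((Pi.single k (1 : ℝ) : Fin p → ℝ) ⬝ᵥ z.1) ^ 4 ∂P ≤ C := by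
  simpa using hreg.fourth_moment k

theorem integral_average_dot_mul_dot_le (hn : 0 < n) (hS : ∀ i, Measurable (S i))
    (hlaw : ∀ i, μ.map (S i) = P) (hindep : iIndepFun S μ) {v w : Fin p → ℝ}
    (hv : ∫ z, (v ⬝ᵥ z.1) ^ 4 ∂P ≤ C) (hw : ∫ z, (w ⬝ᵥ z.1) ^ 4 ∂P ≤ C) :
    Integrable (fun ω => ((n : ℝ)⁻¹ *
      ∑ i, ((v ⬝ᵥ (S i ω).1) * (w ⬝ᵥ (S i ω).1) - v ⬝ᵥ w)) ^ 2) μ ∧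
    ∫ ω, ((n : ℝ)⁻¹ * ∑ i, ((v ⬝ᵥ (S i ω).1) * (w ⬝ᵥ (S i ω).1) - v ⬝ᵥ w)) ^ 2 ∂μ ≤ 3 * C / n := by
  obtain ⟨h1, h2⟩ := hreg.integral_dot_mul_dot_sq_le hv hw
  obtain ⟨e1, e2, e3⟩ := integral_sub_sq_le (hreg.integrable_dot_mul_dot v w) h1
    (hreg.integral_dot_mul_dot v w) h2
  exact integral_average_sq_le_of_centered hn hS hlaw hindep
    (f := fun z => (v ⬝ᵥ z.1) * (w ⬝ᵥ z.1) - v ⬝ᵥ w)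
    (((measurable_dot_fst v).mul (measurable_dot_fst w)).sub_const _) e1 e2 e3

theorem integral_secondMomentError_le (hn : 0 < n) (hS : ∀ i, Measurable (S i))
    (hlaw : ∀ i, μ.map (S i) = P) (hindep : iIndepFun S μ) :
    Integrable (fun ω => secondMomentError fun i => (S i ω).1) μ ∧
      ∫ ω, secondMomentError (fun i => (S i ω).1) ∂μ ≤ p * (p * (3 * C / n)) := by
  have h (k m : Fin p) := hreg.integral_average_dot_mul_dot_le hn hS hlaw hindep
    (hreg.fourth_moment_single k) (hreg.fourth_moment_single m)
  have h' := integral_sum_le_card_mul fun k => integral_sum_le_card_mul (h k)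
  simpa [secondMomentError, Matrix.one_apply, Pi.single_apply, eq_comm] using h'

theorem integral_crossMomentError_le (hn : 0 < n) (hS : ∀ i, Measurable (S i))
    (hlaw : ∀ i, μ.map (S i) = P) (hindep : iIndepFun S μ) {U : Matrix (Fin p) (Fin d) ℝ}
    (hU : Uᵀ * U = 1) (hspan : colSpan U = colSpan β) :
    Integrable (fun ω => crossMomentError (fun i => (S i ω).1) U) μ ∧
      ∫ ω, crossMomentError (fun i => (S i ω).1) U ∂μ ≤ p * (d * (3 * C / n)) := by
  have hcol (j : Fin d) : ∫ z, (U.col j ⬝ᵥ z.1) ^ 4 ∂P ≤ C := by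
    refine hreg.fourth_moment_index _ ?_ ?_
    · rw [← hspan]; exact Submodule.subset_span ⟨j, rfl⟩
    · have := congrFun (congrFun hU j) j
      simpa [Matrix.mul_apply, dotProduct] using this
  have h (k : Fin p) (j : Fin d) := hreg.integral_average_dot_mul_dot_le hn hS hlaw hindep
    (hreg.fourth_moment_single k) (hcol j)
  have h' := integral_sum_le_card_mul fun k => integral_sum_le_card_mul (h k)
  simpa [crossMomentError] using h'

theorem integral_meanError_le (hn : 0 < n) (hS : ∀ i, Measurable (S i))
    (hlaw : ∀ i, μ.map (S i) = P) (hindep : iIndepFun S μ) :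
    Integrable (fun ω => meanError fun i => (S i ω).1) μ ∧
      ∫ ω, meanError (fun i => (S i ω).1) ∂μ ≤ p * (3 * 1 / n) := by
  have h (k : Fin p) := integral_average_sq_le_of_centered hn hS hlaw hindep
    (f := fun z => (Pi.single k (1 : ℝ) : Fin p → ℝ) ⬝ᵥ z.1) (K := 1) (measurable_dot_fst _)
    (hreg.integral_dot _) (hreg.integrable_dot_sq _) (by rw [hreg.integral_dot_sq]; simp)
  have h' := integral_sum_le_card_mul h
  simpa [meanError] using h'

theorem integral_slicingError_le (hn : 0 < n) (hS : ∀ i, Measurable (S i))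
    (hlaw : ∀ i, μ.map (S i) = P) (hindep : iIndepFun S μ) {Y : (Fin p → ℝ) × ℝ → ℝ}
    (hY : Measurable Y) :
    Integrable (fun ω => slicingError (fun i => (S i ω).1) (fun i => Y (S i ω)) (alphaPop P Y)) μ ∧
      ∫ ω, slicingError (fun i => (S i ω).1) (fun i => Y (S i ω)) (alphaPop P Y) ∂μ ≤
        p * (3 * 4 / n) := by
  have h (j : Fin n) (k : Fin p) : Integrable (fun ω => ((n : ℝ)⁻¹ * ∑ i, ((S i ω).1 k *
      (if Y (S i ω) ≤ Y (S j ω) then (1 : ℝ) else 0) - alphaPop P Y (Y (S j ω)) k)) ^ 2) μ ∧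
      ∫ ω, ((n : ℝ)⁻¹ * ∑ i, ((S i ω).1 k *
        (if Y (S i ω) ≤ Y (S j ω) then (1 : ℝ) else 0) - alphaPop P Y (Y (S j ω)) k)) ^ 2 ∂μ ≤
        3 * 4 / n := by
    have hXi : Integrable (fun z : (Fin p → ℝ) × ℝ => z.1 k) P :=
      (hreg.memLp_apply k).integrable (by norm_num)
    have hX2 : Integrable (fun z : (Fin p → ℝ) × ℝ => z.1 k ^ 2) P := by
      simpa using hreg.integrable_dot_sq (Pi.single k 1)
    have hX2e : ∫ z, z.1 k ^ 2 ∂P = 1 := by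
      simpa using hreg.integral_dot_sq (Pi.single k 1)
    have hf : Measurable (Function.uncurry fun s u : (Fin p → ℝ) × ℝ =>
        s.1 k * (if Y s ≤ Y u then (1 : ℝ) else 0) - alphaPop P Y (Y u) k) := by
      refine Measurable.sub (Measurable.mul (by fun_prop)
        (Measurable.ite ?_ measurable_const measurable_const)) ?_
      · exact measurableSet_le (hY.comp measurable_fst) (hY.comp measurable_snd)
      · exact (measurable_alphaPop hY k).comp (hY.comp measurable_snd)
    -- The majorant does not depend on the slicing point and has mean `2 · 1 + 2 = 4`. It therefore
    -- serves off and on the diagonal.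
    have hpt (s u : (Fin p → ℝ) × ℝ) :
        (s.1 k * (if Y s ≤ Y u then (1 : ℝ) else 0) - alphaPop P Y (Y u) k) ^ 2 ≤
          2 * s.1 k ^ 2 + 2 := by
      have h1 : alphaPop P Y (Y u) k ^ 2 ≤ 1 := by
        simpa using hreg.alphaPop_dot_sq_le hY (Y u) (Pi.single k 1)
      have h2 : (s.1 k * (if Y s ≤ Y u then (1 : ℝ) else 0)) ^ 2 ≤ s.1 k ^ 2 := by
        split_ifs
        · simp
        · simp [sq_nonneg]
      nlinarith [sq_nonneg (s.1 k * (if Y s ≤ Y u then (1 : ℝ) else 0) + alphaPop P Y (Y u) k)]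
    have hdom : Integrable (fun z : (Fin p → ℝ) × ℝ => 2 * z.1 k ^ 2 + 2) P :=
      (hX2.const_mul 2).add (integrable_const _)
    have hdome : ∫ z, (2 * z.1 k ^ 2 + 2) ∂P = 4 := by
      rw [integral_add (hX2.const_mul 2) (integrable_const _), integral_const_mul, hX2e]
      norm_num
    have hdom2 := hdom.comp_fst P
    have hdom2e : ∫ z : ((Fin p → ℝ) × ℝ) × ((Fin p → ℝ) × ℝ), (2 * z.1.1 k ^ 2 + 2)
        ∂(P.prod P) = 4 := by
      have := integral_fun_fst (μ := P) (ν := P)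
        (fun z : (Fin p → ℝ) × ℝ => 2 * z.1 k ^ 2 + 2)
      rw [this, hdome]; simp
    have hi1 : Integrable (fun z : ((Fin p → ℝ) × ℝ) × ((Fin p → ℝ) × ℝ) =>
        (z.1.1 k * (if Y z.1 ≤ Y z.2 then (1 : ℝ) else 0) - alphaPop P Y (Y z.2) k) ^ 2)
        (P.prod P) :=
      hdom2.mono' (hf.pow_const 2).aestronglyMeasurable (ae_of_all _ fun z => by
        rw [Real.norm_of_nonneg (sq_nonneg _)]; exact hpt z.1 z.2)
    have hi2 : Integrable (fun z : (Fin p → ℝ) × ℝ =>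
        (z.1 k * (if Y z ≤ Y z then (1 : ℝ) else 0) - alphaPop P Y (Y z) k) ^ 2) P :=
      hdom.mono' ((hf.comp (measurable_id.prodMk measurable_id)).pow_const 2).aestronglyMeasurable
        (ae_of_all _ fun z => by rw [Real.norm_of_nonneg (sq_nonneg _)]; exact hpt z z)
    refine integral_average_sq_le hS hlaw hindep hf (K := 4) (fun u => ?_) hi1
      ((integral_mono hi1 hdom2 fun z => hpt z.1 z.2).trans hdom2e.le) hi2
      ((integral_mono hi2 hdom fun z => hpt z z).trans hdome.le) j
    rw [integral_sub (integrable_mul_indicator hXi hY _) (integrable_const _)]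
    simp [alphaPop]
  have h' := integral_sum_le_card_mul fun j => integral_sum_le_card_mul (h j)
  refine ⟨h'.1.const_mul _, ?_⟩
  simp only [slicingError]
  rw [integral_const_mul]
  refine (mul_le_mul_of_nonneg_left h'.2 (by positivity)).trans (le_of_eq ?_)
  have h0 : (n : ℝ) ≠ 0 := by positivity
  simp only [Fintype.card_fin]
  field_simp

theorem integral_indexMomentError_le (hn : 0 < n) (hS : ∀ i, Measurable (S i))
    (hlaw : ∀ i, μ.map (S i) = P) (hindep : iIndepFun S μ) {Y Y' : (Fin p → ℝ) × ℝ → ℝ}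
    (hY : Measurable Y) (hY' : Measurable Y') {U : Matrix (Fin p) (Fin d) ℝ} (hU : Uᵀ * U = 1) :
    Integrable (fun ω => indexMomentError (fun i => Uᵀ *ᵥ alphaPop P Y (Y' (S i ω)))
      (Matrix.of fun k m => ∫ z, (Uᵀ *ᵥ alphaPop P Y (Y' z)) k * (Uᵀ *ᵥ alphaPop P Y (Y' z)) m ∂P))
      μ ∧
    ∫ ω, indexMomentError (fun i => Uᵀ *ᵥ alphaPop P Y (Y' (S i ω)))
      (Matrix.of fun k m => ∫ z, (Uᵀ *ᵥ alphaPop P Y (Y' z)) k * (Uᵀ *ᵥ alphaPop P Y (Y' z)) m ∂P)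
      ∂μ ≤ d * (d * (3 * 1 / n)) := by
  have hcol (k : Fin d) (t : ℝ) : (Uᵀ *ᵥ alphaPop P Y t) k = alphaPop P Y t ⬝ᵥ U.col k :=
    dotProduct_comm _ _
  have hunit (k : Fin d) : U.col k ⬝ᵥ U.col k = 1 := by
    have := congrFun (congrFun hU k) k
    simpa [Matrix.mul_apply, dotProduct] using this
  have h (k m : Fin d) : Integrable (fun ω => ((n : ℝ)⁻¹ * ∑ i,
      ((Uᵀ *ᵥ alphaPop P Y (Y' (S i ω))) k * (Uᵀ *ᵥ alphaPop P Y (Y' (S i ω))) m -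
        ∫ z, (Uᵀ *ᵥ alphaPop P Y (Y' z)) k * (Uᵀ *ᵥ alphaPop P Y (Y' z)) m ∂P)) ^ 2) μ ∧
      ∫ ω, ((n : ℝ)⁻¹ * ∑ i,
      ((Uᵀ *ᵥ alphaPop P Y (Y' (S i ω))) k * (Uᵀ *ᵥ alphaPop P Y (Y' (S i ω))) m -
        ∫ z, (Uᵀ *ᵥ alphaPop P Y (Y' z)) k * (Uᵀ *ᵥ alphaPop P Y (Y' z)) m ∂P)) ^ 2 ∂μ ≤
        3 * 1 / n := by
    simp only [hcol]
    have hi := hreg.integrable_alphaPop_dot_mul hY hY' (U.col k) (U.col m)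
    have hm : Measurable fun z : (Fin p → ℝ) × ℝ =>
        (alphaPop P Y (Y' z) ⬝ᵥ U.col k) * (alphaPop P Y (Y' z) ⬝ᵥ U.col m) :=
      ((measurable_dot_alphaPop hY _).comp hY').mul ((measurable_dot_alphaPop hY _).comp hY')
    have hb (z : (Fin p → ℝ) × ℝ) :
        ((alphaPop P Y (Y' z) ⬝ᵥ U.col k) * (alphaPop P Y (Y' z) ⬝ᵥ U.col m)) ^ 2 ≤ 1 := by
      have h1 := hreg.alphaPop_dot_sq_le hY (Y' z) (U.col k)
      have h2 := hreg.alphaPop_dot_sq_le hY (Y' z) (U.col m)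
      rw [hunit] at h1 h2
      rw [mul_pow]
      exact mul_le_one₀ h1 (sq_nonneg _) h2
    have hsq : Integrable (fun z : (Fin p → ℝ) × ℝ =>
        ((alphaPop P Y (Y' z) ⬝ᵥ U.col k) * (alphaPop P Y (Y' z) ⬝ᵥ U.col m)) ^ 2) P :=
      Integrable.of_bound (hm.pow_const 2).aestronglyMeasurable 1 (ae_of_all _ fun z => by
        rw [Real.norm_of_nonneg (sq_nonneg _)]; exact hb z)
    have hle : ∫ z, ((alphaPop P Y (Y' z) ⬝ᵥ U.col k) * (alphaPop P Y (Y' z) ⬝ᵥ U.col m)) ^ 2 ∂P ≤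
        1 := (integral_mono hsq (integrable_const 1) hb).trans (by simp)
    obtain ⟨e1, e2, e3⟩ := integral_sub_sq_le hi hsq rfl hle
    exact integral_average_sq_le_of_centered hn hS hlaw hindep (hm.sub_const _) e1 e2 e3
  have h' := integral_sum_le_card_mul fun k => integral_sum_le_card_mul (h k)
  simpa only [indexMomentError, Matrix.of_apply, Fintype.card_fin] using h'

end RegularityConditions

end SamplingErrors

/-! ### Behaviour of the estimators on a sample with small sampling errors -/

section FixedSampleSize

variable {d l p q n : ℕ} {c C : ℝ} {P : Measure ((Fin p → ℝ) × ℝ)} [IsProbabilityMeasure P]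
  {g : (Fin d → ℝ) → (Fin l → ℝ) → ℝ} {β : Matrix (Fin p) (Fin d) ℝ} {ϑ : Fin l → ℝ}
  {B : Matrix (Fin p) (Fin q) ℝ} {G : (Fin q → ℝ) → ℝ}
  {Ω : Type*} [MeasurableSpace Ω] {μ : Measure Ω} [IsProbabilityMeasure μ]
  {S : Fin n → Ω → (Fin p → ℝ) × ℝ}

theorem residual_norm_sq_le {U V : Matrix (Fin p) (Fin d) ℝ} {K : ℝ}
    (h : ∀ j, (V.col j - U *ᵥ (Uᵀ *ᵥ V.col j)) ⬝ᵥ (V.col j - U *ᵥ (Uᵀ *ᵥ V.col j)) ≤ K) :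
    ‖V - U * (Uᵀ * V)‖ ^ 2 ≤ d * K := by
  rw [frobenius_norm_sq, Finset.sum_comm]
  have hle : ∀ j ∈ Finset.univ, ∑ i, (V - U * (Uᵀ * V)) i j ^ 2 ≤ K := fun j _ => by
    refine le_trans (le_of_eq ?_) (h j)
    rw [dot_self_eq_sum_sq]
    refine Finset.sum_congr rfl fun i _ => ?_
    rw [Matrix.mulVec_mulVec, ← Matrix.mul_assoc]
    rfl
  refine (Finset.sum_le_sum hle).trans ?_
  simp

/-- There are two nonnegative sampling errors, `R` of order `p / n` and `T` of order `p² / n` in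
mean, which control the leading eigenvalues and eigenvectors of the sample matrix. -/
theorem RegularityConditions.exists_sampling_errors
    (hreg : RegularityConditions c C P g β ϑ B G) (hg : Measurable fun u => g u ϑ)
    (hG : Measurable G) (hc : 0 < c) (hd : 1 ≤ d) (hdp : d < p) (hn : 0 < n)
    (hS : ∀ i, Measurable (S i)) (hlaw : ∀ i, μ.map (S i) = P) (hindep : iIndepFun S μ) {r : ℝ}
    (hr : C * (1 + C) * |r| ≤ c / 4) {U : Matrix (Fin p) (Fin d) ℝ} (hU : Uᵀ * U = 1)
    (hspan : colSpan U = colSpan β) :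
    ∃ R T : Ω → ℝ, Integrable R μ ∧ Integrable T μ ∧ (∀ ω, 0 ≤ R ω) ∧ (∀ ω, 0 ≤ T ω) ∧
      ∫ ω, R ω ∂μ ≤ (15 + 3 * C * d) * (p / n) ∧
      ∫ ω, T ω ∂μ ≤ (3 * C + 3 * d ^ 2) * (p ^ 2 / n) ∧
      ∀ ω, R ω ≤ 1 / 4 → T ω ≤ 1 / 16 → T ω ≤ (c / 4) ^ 2 →
        40 * R ω + 16 * (C ^ 3 * r ^ 2) ≤ c / 8 →
        (∀ j, 0 ≤ eigDesc (cseMatrix_isHermitian (fun i => (S i ω).1)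
          fun i => localResponse g β ϑ B G r (S i ω)) j) ∧
        eigDesc (cseMatrix_isHermitian (fun i => (S i ω).1)
          fun i => localResponse g β ϑ B G r (S i ω)) (d + 1) ≤
            40 * R ω + 16 * (C ^ 3 * r ^ 2) ∧
        c / 8 ≤ eigDesc (cseMatrix_isHermitian (fun i => (S i ω).1)
          fun i => localResponse g β ϑ B G r (S i ω)) d ∧
        eigDesc (cseMatrix_isHermitian (fun i => (S i ω).1)
          fun i => localResponse g β ϑ B G r (S i ω)) 1 ≤
            2 + 2 * (40 * R ω + 16 * (C ^ 3 * r ^ 2)) ∧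
        ∀ V : Matrix (Fin p) (Fin d) ℝ, IsLeadingEigenvectors
          (cseMatrix_isHermitian (fun i => (S i ω).1)
            fun i => localResponse g β ϑ B G r (S i ω)) V →
          ‖V - U * (Uᵀ * V)‖ ^ 2 ≤ d * (8 / c * (40 * R ω + 16 * (C ^ 3 * r ^ 2))) := by
  have hY0 := measurable_nullResponse hg β
  have hY := measurable_localResponse hg hG β B r
  have hC := hreg.bound_nonneg
  set Y := localResponse g β ϑ B G r
  set ψ := alphaPop P (nullResponse g β ϑ) with hψ
  set N : Matrix (Fin d) (Fin d) ℝ :=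
    Matrix.of fun k m => ∫ z, (Uᵀ *ᵥ ψ (Y z)) k * (Uᵀ *ᵥ ψ (Y z)) m ∂P with hN
  obtain ⟨i1, m1⟩ := hreg.integral_secondMomentError_le hn hS hlaw hindep
  obtain ⟨i2, m2⟩ := hreg.integral_meanError_le hn hS hlaw hindep
  obtain ⟨i3, m3⟩ := hreg.integral_crossMomentError_le hn hS hlaw hindep hU hspan
  obtain ⟨i4, m4⟩ := hreg.integral_slicingError_le hn hS hlaw hindep hY
  obtain ⟨i5, m5⟩ := hreg.integral_indexMomentError_le hn hS hlaw hindep hY0 hY hU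
  have nn5 (φ : Fin n → Fin d → ℝ) (M : Matrix (Fin d) (Fin d) ℝ) : 0 ≤ indexMomentError φ M :=
    Finset.sum_nonneg fun _ _ => Finset.sum_nonneg fun _ _ => sq_nonneg _
  have hn' : (0 : ℝ) < n := by exact_mod_cast hn
  -- `R` gathers the errors that enter the rate. `T` gathers those that only have to fall below a
  -- fixed threshold: the full covariance error, and the law of large numbers for the `d × d`
  -- moments of `Uᵀψ(Y)`.
  refine ⟨fun ω => meanError (fun i => (S i ω).1) + crossMomentError (fun i => (S i ω).1) U +
      slicingError (fun i => (S i ω).1) (fun i => Y (S i ω)) (alphaPop P Y),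
    fun ω => secondMomentError (fun i => (S i ω).1) +
      indexMomentError (fun i => Uᵀ *ᵥ ψ (Y (S i ω))) N,
    (i2.add i3).add i4, i1.add i5, fun ω => ?_, fun ω => ?_, ?_, ?_, ?_⟩
  · exact add_nonneg (add_nonneg (meanError_nonneg _) (crossMomentError_nonneg _ _))
      (slicingError_nonneg _ _ _)
  · exact add_nonneg (secondMomentError_nonneg _) (nn5 _ _)
  · have e := integral_add (i2.add i3) i4
    simp only [Pi.add_apply] at e
    rw [e, integral_add i2 i3]
    refine (add_le_add (add_le_add m2 m3) m4).trans (le_of_eq ?_)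
    ring
  · rw [integral_add i1 i5]
    refine (add_le_add m1 m5).trans ?_
    have hp : (1 : ℝ) ≤ p := by exact_mod_cast (by omega : 1 ≤ p)
    have h1 : (d : ℝ) * (d * (3 * 1 / n)) ≤ 3 * d ^ 2 * (p ^ 2 / n) := by
      have : (d : ℝ) * (d * (3 * 1 / n)) = 3 * d ^ 2 * (1 / n) := by ring
      rw [this]
      gcongr
      nlinarith
    have h2 : (p : ℝ) * (p * (3 * C / n)) = 3 * C * (p ^ 2 / n) := by ring
    rw [h2, add_mul]
    linarith
  · intro ω hR hT hT' hΔ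
    have nn1 := secondMomentError_nonneg fun i => (S i ω).1
    have nn2 := meanError_nonneg fun i => (S i ω).1
    have nn3 := crossMomentError_nonneg (fun i => (S i ω).1) U
    have nn4 := slicingError_nonneg (fun i => (S i ω).1) (fun i => Y (S i ω)) (alphaPop P Y)
    have nn5' := nn5 (fun i => Uᵀ *ᵥ ψ (Y (S i ω))) N
    set X : Fin n → Fin p → ℝ := fun i => (S i ω).1
    set y : Fin n → ℝ := fun i => Y (S i ω)
    set R := meanError X + crossMomentError X U + slicingError X y (alphaPop P Y)
    set a : Fin n → Fin p → ℝ := fun j => alphaHat X y (y j) with ha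
    set Δ := 40 * R + 16 * (C ^ 3 * r ^ 2) with hΔdef
    have hψ1 (t : ℝ) : ψ t ⬝ᵥ ψ t ≤ 1 := hreg.alphaPop_dot_self_le_one hY0 t
    have herr : (n : ℝ)⁻¹ * ∑ j, (a j - ψ (y j)) ⬝ᵥ (a j - ψ (y j)) ≤ Δ :=
      alphaHat_error_le X y hn hU (a := alphaPop P Y)
        (hreg.frame_mulVec_alphaPop_null hU hspan hg) hψ1
        (hreg.alphaPop_local_sub_null_le hg hG r) (by linarith) (by linarith)
    have horth (i : Fin n) (x : Fin p → ℝ) (hx : Uᵀ *ᵥ x = 0) : ψ (y i) ⬝ᵥ x = 0 :=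
      hreg.alphaPop_null_dot_eq_zero hspan hg hx _
    -- Of the population bound `c`, one quarter is lost in passing from `Y⁰` to `Y` and one quarter
    -- to sampling.
    have hlow (b : Fin d → ℝ) :
        c / 2 * (b ⬝ᵥ b) ≤ (n : ℝ)⁻¹ * ∑ i, (ψ (y i) ⬝ᵥ (U *ᵥ b)) ^ 2 := by
      have h1 := hreg.le_integral_alphaPop_null_sq hU hspan hg hc hdp.le b
      have h2 := hreg.integral_alphaPop_null_sq_le hg hG r (U *ᵥ b)
      have hdot (t : ℝ) : ψ t ⬝ᵥ (U *ᵥ b) = (Uᵀ *ᵥ ψ t) ⬝ᵥ b := by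
        rw [Matrix.dotProduct_mulVec, Matrix.mulVec_transpose]
      have h3 : ∫ z, (ψ (Y z) ⬝ᵥ (U *ᵥ b)) ^ 2 ∂P = b ⬝ᵥ (N *ᵥ b) := by
        have hi (k m : Fin d) :
            Integrable (fun z => (Uᵀ *ᵥ ψ (Y z)) k * (Uᵀ *ᵥ ψ (Y z)) m) P := by
          have := hreg.integrable_alphaPop_dot_mul hY0 hY (U.col k) (U.col m)
          refine this.congr (ae_of_all _ fun z => ?_)
          exact congrArg₂ (· * ·) (dotProduct_comm _ _) (dotProduct_comm _ _)
        simp only [hdot, sq]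
        exact integral_dot_mul_dot_eq hi b b
      have h4 := sub_le_average_of_indexMomentError_le hn (fun i => Uᵀ *ᵥ ψ (y i)) N
        (η := c / 4) (by positivity) (by linarith) b
      have h5 : ∀ i, (ψ (y i) ⬝ᵥ (U *ᵥ b)) ^ 2 = ((Uᵀ *ᵥ ψ (y i)) ⬝ᵥ b) ^ 2 := fun i => by
        rw [hdot]
      simp only [h5]
      rw [h3, mulVec_dot_mulVec hU] at h2
      have h6 := mul_le_mul_of_nonneg_right hr (dot_self_nonneg b)
      linarith
    -- Half of `c / 2` survives the comparison of `a` with `ψ`, and `Δ ≤ c / 8` is subtracted.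
    have hlowd : c / 8 ≤ eigDesc (cseMatrix_isHermitian X y) d := by
      have := le_average_eigDesc a (fun i => ψ (y i)) hd hdp.le hU hlow
      refine le_trans ?_ this
      linarith
    refine ⟨average_eigDesc_nonneg a,
      (average_eigDesc_succ_le a (fun i => ψ (y i)) hdp U horth).trans herr, hlowd, ?_, ?_⟩
    · refine (average_eigDesc_one_le a (fun i => ψ (y i)) (by omega) fun i => hψ1 _).trans ?_
      linarith
    · intro V hV
      refine residual_norm_sq_le fun j => ?_
      have hb : V.col j ⬝ᵥ V.col j = 1 := by
        have := congrFun (congrFun hV.1 j) j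
        simpa [Matrix.mul_apply, dotProduct] using this
      have hlam : c / 8 ≤ eigDesc (cseMatrix_isHermitian X y) ((j : ℕ) + 1) :=
        hlowd.trans (eigDesc_antitone _ (by omega) (by omega) hdp.le)
      have h1 := (average_eigenvector_residual_le a (fun i => ψ (y i)) hU horth hb
        (by linarith) (hV.2 j)).trans herr
      have h2 := mul_le_mul_of_nonneg_right hlam
        (dot_self_nonneg (V.col j - U *ᵥ (Uᵀ *ᵥ V.col j)))
      have h3 := h2.trans h1
      rw [div_mul_eq_mul_div, le_div_iff₀ hc]
      linarith

theorem measure_lt_le_ofReal {R : Ω → ℝ} (hR : Integrable R μ) (h0 : ∀ ω, 0 ≤ R ω) {M t : ℝ}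
    (hM : ∫ ω, R ω ∂μ ≤ M) (ht : 0 < t) : μ {ω | t < R ω} ≤ ENNReal.ofReal (M / t) := by
  have h1 := mul_meas_ge_le_integral_of_nonneg (ae_of_all _ h0) hR t
  have h2 : μ.real {ω | t ≤ R ω} ≤ M / t := by
    rw [le_div_iff₀ ht, mul_comm]; exact h1.trans hM
  calc μ {ω | t < R ω} ≤ μ {ω | t ≤ R ω} := measure_mono fun ω (h : t < R ω) => h.le
    _ = ENNReal.ofReal (μ.real {ω | t ≤ R ω}) := by
        rw [measureReal_def, ENNReal.ofReal_toReal (measure_ne_top _ _)]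
    _ ≤ _ := ENNReal.ofReal_le_ofReal h2

end FixedSampleSize

/-! ### Consequences of the rate conditions -/

/-- Both regimes for the rate give `√n r ≥ 1` eventually. This is all that is used: sampling errors
of order `1 / n` are absorbed into `r²`. -/
theorem eventually_rate_pos {r : ℕ → ℝ}
    (hr : (∀ n, r n = 1 / Real.sqrt n) ∨ Tendsto (fun n : ℕ => Real.sqrt n * r n) atTop atTop) :
    ∀ᶠ n : ℕ in atTop, 0 < n ∧ 0 < r n ∧ 1 / (n : ℝ) ≤ r n ^ 2 := by
  have key : ∀ᶠ n : ℕ in atTop, 1 ≤ Real.sqrt n * r n := by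
    rcases hr with h | h
    · filter_upwards [eventually_gt_atTop 0] with n hn
      have : 0 < Real.sqrt n := Real.sqrt_pos.2 (by exact_mod_cast hn)
      rw [h n]
      exact le_of_eq (by field_simp)
    · exact h.eventually_ge_atTop 1
  filter_upwards [key, eventually_gt_atTop 0] with n h1 hn
  have hn' : (0 : ℝ) < n := by exact_mod_cast hn
  have hs : 0 < Real.sqrt n := Real.sqrt_pos.2 hn'
  refine ⟨hn, ?_, ?_⟩
  · by_contra hneg
    nlinarith
  · have h2 := Real.sq_sqrt hn'.le
    rw [div_le_iff₀ hn']
    nlinarith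

theorem tendsto_rate_zero {p : ℕ → ℕ} (hp : ∀ n, 0 < p n) {r : ℕ → ℝ}
    (hpos : ∀ᶠ n in atTop, 0 < r n) (hpr : Tendsto (fun n => (p n : ℝ) * r n) atTop (𝓝 0)) :
    Tendsto r atTop (𝓝 0) := by
  refine squeeze_zero' (hpos.mono fun n h => h.le) (hpos.mono fun n h => ?_) hpr
  have : (1 : ℝ) ≤ p n := by exact_mod_cast hp n
  nlinarith

/-! ### The main theorem: Markov bounds for the sampling errors -/

theorem theorem4p2 {d l : ℕ} (hd : 1 ≤ d)
    -- the regression function, dimensions, parameters, departures and rate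
    (g : (Fin d → ℝ) → (Fin l → ℝ) → ℝ) (hg : ∀ ϑ, Measurable fun u => g u ϑ)
    (p q : ℕ → ℕ) (hdp : ∀ n, d < p n)
    (β : ∀ n, Matrix (Fin (p n)) (Fin d) ℝ) (ϑ : ℕ → Fin l → ℝ)
    (B : ∀ n, Matrix (Fin (p n)) (Fin (q n)) ℝ) (G : ∀ n, (Fin (q n) → ℝ) → ℝ) (r : ℕ → ℝ)
    -- the law of (X, ε) at sample size n
    (P : ∀ n, Measure ((Fin (p n) → ℝ) × ℝ)) [∀ n, IsProbabilityMeasure (P n)]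
    -- the i.i.d. sample (Xᵢ, εᵢ), 1 ≤ i ≤ n
    {Ω : ℕ → Type*} [∀ n, MeasurableSpace (Ω n)] (μ : ∀ n, Measure (Ω n))
    [∀ n, IsProbabilityMeasure (μ n)]
    (S : ∀ n, Fin n → Ω n → (Fin (p n) → ℝ) × ℝ)
    (hS : ∀ n i, Measurable (S n i)) (hlaw : ∀ n i, (μ n).map (S n i) = P n)
    (hindep : ∀ n, iIndepFun (S n) (μ n))
    -- the local alternatives and the regularity conditions, with bounds free of n
    (hH : ∀ n, IsLocalAlternative (P n) (B n) (G n))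
    (c C : ℝ) (hc : 0 < c)
    (hreg : ∀ n, RegularityConditions c C (P n) g (β n) (ϑ n) (B n) (G n))
    -- the rate
    (hr : (∀ n, r n = 1 / Real.sqrt n) ∨ Tendsto (fun n : ℕ => Real.sqrt n * r n) atTop atTop)
    (hpr : Tendsto (fun n => (p n : ℝ) * r n) atTop (𝓝 0)) :
    -- the observed sample
    let X : ∀ n, Ω n → Fin n → Fin (p n) → ℝ := fun n ω i => (S n i ω).1
    let Y : ∀ n, Ω n → Fin n → ℝ := fun n ω i =>
      localResponse g (β n) (ϑ n) (B n) (G n) (r n) (S n i ω)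
    let cₙ : ℕ → ℝ := fun n => r n ^ 2 * Real.log ((r n ^ 2)⁻¹)
    Tendsto (fun n => μ n {ω | mrer (cseMatrix_isHermitian (X n ω) (Y n ω)) (cₙ n) = d})
        atTop (𝓝 1) ∧
      ∀ Bhat : ∀ n, Ω n → Matrix (Fin (p n)) (Fin d) ℝ,
        (∀ n ω, IsLeadingEigenvectors (cseMatrix_isHermitian (X n ω) (Y n ω)) (Bhat n ω)) →
        ∀ BL : ∀ n, Matrix (Fin (p n)) (Fin d) ℝ,
          (∀ n, (BL n)ᵀ * BL n = 1 ∧ colSpan (BL n) = colSpan (β n)) →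
          -- eigenvectors are determined only up to an orthogonal change of basis
          ∃ Q : ∀ n, Ω n → Matrix (Fin d) (Fin d) ℝ,
            (∀ n ω, Q n ω ∈ Matrix.orthogonalGroup (Fin d) ℝ) ∧
            IsBigOInProb μ (fun n ω => ‖Bhat n ω * Q n ω - BL n‖)
              (fun n : ℕ => Real.sqrt (p n) * r n) := by
  intro X Y cₙ
  have hC : 0 ≤ C := (hreg 0).bound_nonneg
  have hrate := eventually_rate_pos hr
  have hr0 : Tendsto r atTop (𝓝 0) :=
    tendsto_rate_zero (fun n => (Nat.zero_le d).trans_lt (hdp n)) (hrate.mono fun n h => h.2.1) hpr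
  -- `T` is only compared with this constant. Markov gives `P(T > τ) ≤ KT (p r)² / τ → 0`, because
  -- `p² / n ≤ (p r)²`.
  set τ := min (1 / 16) ((c / 4) ^ 2) with hτ
  have hτ0 : 0 < τ := lt_min (by norm_num) (by positivity)
  set KR := 15 + 3 * C * d with hKR
  set KT := 3 * C + 3 * (d : ℝ) ^ 2 with hKT
  have hKR0 : 0 < KR := by positivity
  have hKT0 : 0 ≤ KT := by positivity
  have hT0 : Tendsto (fun n => KT * ((p n : ℝ) * r n) ^ 2 / τ) atTop (𝓝 0) := by
    have := ((hpr.pow 2).const_mul KT).div_const τ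
    simpa using this
  have hbias : ∀ᶠ n in atTop, C * (1 + C) * |r n| ≤ c / 4 := by
    have h : Tendsto (fun n => C * (1 + C) * |r n|) atTop (𝓝 0) := by
      simpa using hr0.abs.const_mul (C * (1 + C))
    exact h.eventually_le_const (by positivity)
  have hRmean {n : ℕ} {I : ℝ} (h : I ≤ KR * (p n / n)) (hn : 1 / (n : ℝ) ≤ r n ^ 2) :
      I ≤ KR * (p n * r n ^ 2) := by
    refine h.trans ?_
    rw [div_eq_mul_one_div]
    gcongr
  have hTmean {n : ℕ} {I : ℝ} (h : I ≤ KT * ((p n : ℝ) ^ 2 / n)) (hn : 1 / (n : ℝ) ≤ r n ^ 2) :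
      I ≤ KT * ((p n : ℝ) * r n) ^ 2 := by
    refine h.trans ?_
    rw [div_eq_mul_one_div, mul_pow]
    gcongr
  constructor
  · have hcn : Tendsto cₙ atTop (𝓝 0) := by
      have h1 : cₙ = fun n => Real.negMulLog (r n ^ 2) := by
        ext n
        simp only [cₙ, Real.negMulLog, Real.log_inv]
        ring
      have h2 : Tendsto (fun n => r n ^ 2) atTop (𝓝 0) := by simpa using hr0.pow 2
      rw [h1]
      have h3 := (Real.continuous_negMulLog.tendsto 0).comp h2
      rwa [Real.negMulLog_zero] at h3
    -- On the event `R ≤ r`, with `r² ≤ r`, the error `Δ` is at most `K r`.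
    set K := 40 + 16 * C ^ 3 with hK
    have hK0 : 0 < K := by positivity
    have hlog : ∀ᶠ n in atTop, K ^ 2 ≤ Real.log ((r n ^ 2)⁻¹) := by
      have h1 : Tendsto (fun n => r n ^ 2) atTop (𝓝[>] 0) := by
        refine tendsto_nhdsWithin_iff.2 ⟨by simpa using hr0.pow 2, ?_⟩
        filter_upwards [hrate] with n hn
        exact pow_pos hn.2.1 2
      exact (Real.tendsto_log_atTop.comp (tendsto_inv_nhdsGT_zero.comp h1)).eventually_ge_atTop _
    have hs1 : ∀ᶠ n in atTop, K * r n ≤ c / 8 := by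
      have h : Tendsto (fun n => K * r n) atTop (𝓝 0) := by simpa using hr0.const_mul K
      exact h.eventually_le_const (by positivity)
    -- This yields `λ̂_1 ≤ 2 + 2 · 1/2 = 3`, the value of `L` below.
    have hs2 : ∀ᶠ n in atTop, K * r n ≤ 1 / 2 := by
      have h : Tendsto (fun n => K * r n) atTop (𝓝 0) := by simpa using hr0.const_mul K
      exact h.eventually_le_const (by positivity)
    have hs3 : ∀ᶠ n in atTop, r n ≤ 1 / 4 := hr0.eventually_le_const (by norm_num)
    have hs4 : ∀ᶠ n in atTop, 4 * cₙ n < (c / 8) ^ 2 := by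
      have h : Tendsto (fun n => 4 * cₙ n) atTop (𝓝 0) := by simpa using hcn.const_mul 4
      exact h.eventually_lt_const (by positivity)
    have hs5 : ∀ᶠ n in atTop, 2 * cₙ n * (3 ^ 2 + cₙ n) < (c / 8) ^ 4 := by
      have h : Tendsto (fun n => 2 * cₙ n * (3 ^ 2 + cₙ n)) atTop (𝓝 0) := by
        simpa using (hcn.const_mul 2).mul (hcn.const_add (3 ^ 2))
      exact h.eventually_lt_const (by positivity)
    have hmain : ∀ᶠ n in atTop, 1 - (ENNReal.ofReal (KR * ((p n : ℝ) * r n)) +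
        ENNReal.ofReal (KT * ((p n : ℝ) * r n) ^ 2 / τ)) ≤
        μ n {ω | mrer (cseMatrix_isHermitian (X n ω) (Y n ω)) (cₙ n) = d} := by
      filter_upwards [hrate, hbias, hlog, hs1, hs2, hs3, hs4, hs5] with n hn hb hl h1 h2 h3 h4 h5
      obtain ⟨hn0, hrn, hnr⟩ := hn
      obtain ⟨U, hU, hspan⟩ := (hreg n).exists_orthonormal_frame (hg (ϑ n)) hc (hdp n).le
      obtain ⟨R, T, iR, iT, nR, nT, mR, mT, hgood⟩ := (hreg n).exists_sampling_errors (hg (ϑ n))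
        (hH n).measurable_departure hc hd (hdp n) hn0 (hS n) (hlaw n) (hindep n) hb hU hspan
      -- Covering the whole space by the target event and two bad events bounds the probability
      -- below by subadditivity alone, so the target event need not be measurable.
      have hsub : Set.univ ⊆ {ω | mrer (cseMatrix_isHermitian (X n ω) (Y n ω)) (cₙ n) = d} ∪
          ({ω | r n < R ω} ∪ {ω | τ < T ω}) := by
        intro ω _
        by_cases hRω : r n < R ω
        · exact Or.inr (Or.inl hRω)
        by_cases hTω : τ < T ω
        · exact Or.inr (Or.inr hTω)
        left
        rw [not_lt] at hRω hTω
        have hr1 : r n ^ 2 ≤ r n := by nlinarith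
        have hΔ : 40 * R ω + 16 * (C ^ 3 * r n ^ 2) ≤ K * r n := by
          have := mul_le_mul_of_nonneg_left hr1 (pow_nonneg hC 3)
          rw [hK]
          linarith
        obtain ⟨g1, g2, g3, g4, -⟩ := hgood ω (hRω.trans h3) (hTω.trans (min_le_left _ _))
          (hTω.trans (min_le_right _ _)) (hΔ.trans h1)
        have hcn0 : K ^ 2 * r n ^ 2 ≤ cₙ n := by
          simp only [cₙ]
          rw [mul_comm]
          gcongr
        refine mrer_eq_of_eigenvalue_bounds _ hd (hdp n) (κ := c / 8) (L := 3)
          (lt_of_lt_of_le (by positivity) hcn0) (by positivity) g1 g3 (g4.trans (by linarith))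
          ?_ h4 h5
        refine (pow_le_pow_left₀ (g1 _) (g2.trans hΔ) 2).trans ?_
        rwa [mul_pow]
      have hm := (measure_mono (μ := μ n) hsub).trans
        ((measure_union_le _ _).trans (add_le_add le_rfl (measure_union_le _ _)))
      rw [measure_univ] at hm
      rw [tsub_le_iff_right]
      refine hm.trans (add_le_add le_rfl (add_le_add ?_ ?_))
      -- The threshold `r` for `R` is large enough for Markov, as `p r² / r = p r → 0`, and small
      -- enough for `Δ² ≤ K² r² ≤ cₙ`.
      · have h := measure_lt_le_ofReal iR nR (hRmean mR hnr) hrn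
        have e : KR * (p n * r n ^ 2) / r n = KR * (p n * r n) := by field_simp
        rwa [e] at h
      · exact measure_lt_le_ofReal iT nT (hTmean mT hnr) hτ0
    refine tendsto_of_tendsto_of_tendsto_of_le_of_le' ?_ tendsto_const_nhds hmain
      (Eventually.of_forall fun n => prob_le_one)
    have h1 : Tendsto (fun n => ENNReal.ofReal (KR * ((p n : ℝ) * r n))) atTop (𝓝 0) := by
      simpa using ENNReal.tendsto_ofReal (hpr.const_mul KR)
    have h2 : Tendsto (fun n => ENNReal.ofReal (KT * ((p n : ℝ) * r n) ^ 2 / τ)) atTop (𝓝 0) := by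
      simpa using ENNReal.tendsto_ofReal hT0
    have h3 := ENNReal.Tendsto.sub (tendsto_const_nhds (x := (1 : ENNReal))) (h1.add h2)
      (Or.inl ENNReal.one_ne_top)
    simpa using h3
  · intro Bhat hBhat BL hBL
    -- The rotations are chosen separately for each sample point; no measurability in `ω` is
    -- claimed.
    choose Q hQ hQle using fun (n : ℕ) (ω : Ω n) =>
      exists_orthogonal_alignment hd (hBL n).1 (hBhat n ω).1
    refine ⟨Q, hQ, fun ε hε => ?_⟩
    -- Chosen so that Markov gives `P(R > K₁ p r²) ≤ KR / K₁ = ε / 2`; the other `ε / 2` is left for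
    -- `T`.
    set K₁ := 2 * KR / ε with hK₁
    have hK₁0 : 0 < K₁ := by positivity
    set K₂ := 40 * K₁ + 16 * C ^ 3 with hK₂
    have hK₂0 : 0 < K₂ := by positivity
    -- Here `4d` is the cost of the alignment, the second `d` counts the columns, and `8 / c`
    -- inverts the lower bound on `λ̂_d`.
    refine ⟨Real.sqrt (4 * d * (d * (8 / c * K₂))), ?_⟩
    have hpr2 : Tendsto (fun n => (p n : ℝ) * r n ^ 2) atTop (𝓝 0) := by
      have := hpr.mul hr0
      simpa [sq, mul_assoc] using this
    have hs1 : ∀ᶠ n in atTop, K₁ * ((p n : ℝ) * r n ^ 2) ≤ 1 / 4 := by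
      have h : Tendsto (fun n => K₁ * ((p n : ℝ) * r n ^ 2)) atTop (𝓝 0) := by
        simpa using hpr2.const_mul K₁
      exact h.eventually_le_const (by positivity)
    have hs2 : ∀ᶠ n in atTop, K₂ * ((p n : ℝ) * r n ^ 2) ≤ c / 8 := by
      have h : Tendsto (fun n => K₂ * ((p n : ℝ) * r n ^ 2)) atTop (𝓝 0) := by
        simpa using hpr2.const_mul K₂
      exact h.eventually_le_const (by positivity)
    have hs3 : ∀ᶠ n in atTop, KT * ((p n : ℝ) * r n) ^ 2 / τ ≤ ε / 2 :=
      hT0.eventually_le_const (by positivity)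
    filter_upwards [hrate, hbias, hs1, hs2, hs3] with n hn hb h1 h2 h3
    obtain ⟨hn0, hrn, hnr⟩ := hn
    obtain ⟨R, T, iR, iT, nR, nT, mR, mT, hgood⟩ := (hreg n).exists_sampling_errors (hg (ϑ n))
      (hH n).measurable_departure hc hd (hdp n) hn0 (hS n) (hlaw n) (hindep n) hb
      (hBL n).1 (hBL n).2
    have hp1 : (1 : ℝ) ≤ p n := by exact_mod_cast (Nat.zero_le d).trans_lt (hdp n)
    have hpr0 : 0 < (p n : ℝ) * r n ^ 2 := by positivity
    have hsub : {ω | Real.sqrt (4 * d * (d * (8 / c * K₂))) * (Real.sqrt (p n) * r n) <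
        |‖Bhat n ω * Q n ω - BL n‖|} ⊆
        {ω | K₁ * ((p n : ℝ) * r n ^ 2) < R ω} ∪ {ω | τ < T ω} := by
      intro ω hω
      by_contra hcon
      rw [Set.mem_union, not_or] at hcon
      have hRω : R ω ≤ K₁ * ((p n : ℝ) * r n ^ 2) := not_lt.1 hcon.1
      have hTω : T ω ≤ τ := not_lt.1 hcon.2
      have hΔ : 40 * R ω + 16 * (C ^ 3 * r n ^ 2) ≤ K₂ * ((p n : ℝ) * r n ^ 2) := by
        have h4 : r n ^ 2 ≤ (p n : ℝ) * r n ^ 2 := le_mul_of_one_le_left (sq_nonneg _) hp1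
        have := mul_le_mul_of_nonneg_left h4 (pow_nonneg hC 3)
        rw [hK₂]
        linarith
      obtain ⟨-, -, -, -, g5⟩ := hgood ω (hRω.trans h1) (hTω.trans (min_le_left _ _))
        (hTω.trans (min_le_right _ _)) (hΔ.trans h2)
      have h5 : ‖Bhat n ω * Q n ω - BL n‖ ^ 2 ≤
          (Real.sqrt (4 * d * (d * (8 / c * K₂))) * (Real.sqrt (p n) * r n)) ^ 2 := by
        refine (hQle n ω).trans ?_
        rw [mul_pow, mul_pow, Real.sq_sqrt (by positivity), Real.sq_sqrt (by positivity)]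
        calc 4 * (d : ℝ) * ‖Bhat n ω - BL n * ((BL n)ᵀ * Bhat n ω)‖ ^ 2
            ≤ 4 * d * (d * (8 / c * (K₂ * ((p n : ℝ) * r n ^ 2)))) := by
              refine mul_le_mul_of_nonneg_left ((g5 _ (hBhat n ω)).trans ?_) (by positivity)
              gcongr
          _ = _ := by ring
      have h6 := abs_le_of_sq_le_sq h5 (by positivity)
      exact absurd hω (not_lt.2 h6)
    refine (measure_mono hsub).trans ((measure_union_le _ _).trans ?_)
    have e : ENNReal.ofReal ε = ENNReal.ofReal (ε / 2) + ENNReal.ofReal (ε / 2) := by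
      rw [← ENNReal.ofReal_add (by positivity) (by positivity), add_halves]
    rw [e]
    refine add_le_add ?_ ?_
    · refine (measure_lt_le_ofReal iR nR (hRmean mR hnr) (by positivity)).trans
        (ENNReal.ofReal_le_ofReal (le_of_eq ?_))
      rw [hK₁]
      field_simp
    · exact (measure_lt_le_ofReal iT nT (hTmean mT hnr) hτ0).trans (ENNReal.ofReal_le_ofReal h3)
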